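/- Let $\mathbb{C}(z)[\partial_z]$ be the ring of ordinary differential operators with rational coefficients. For a $\mathbb{C}$-linear subspace $W\subseteq\mathbb{C}(z)^r$ (row vectors) let $M_W$ be the set of $D=(D_1,\dots,D_r)$ with entries in $\mathbb{C}(z)[\partial_z]$ such that $(D_1.p,\dots,D_r.p)\in W$ for all $p\in\mathbb{C}[z]$, and let $L_W\subseteq\mathbb{C}(z)^r$ be the space of leading coefficients of the operators in $M_W$ (together with $0$). The *adelic Grassmannian* $\mathrm{Gr}^{ad}(r)$ is the set of those $W$ such that * $W$ is fat: $p\,\mathbb{C}[z]^r\subseteq W\subseteq q^{-1}\mathbb{C}[z]^r$ for some nonzero polynomials $p,q$; * $W$ is primary decomposable: $W=\bigcap_{\lambda\in\mathbb{C}}W_\lambda$ where, with $\mathcal{O}_\lambda\subset\mathbb{C}(z)$ the ring of functions regular at $\lambda$, each $W_\lambda$ is a $\mathbb{C}$-subspace with $(z-\lambda)^{N_\lambda}\mathcal{O}_\lambda^r\subseteq W_\lambda\subseteq(z-\lambda)^{-N_\lambda}\mathcal{O}_\lambda^r$ for some $N_\lambda$, and $W_\lambda=\mathcal{O}_\lambda^r$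 for all but finitely many $\lambda$; * $L_W=\mathbb{C}[z]^r$. The *stationary Baker function* of $W$ is the $r\times r$ matrix function $\psi_W(x,z)=\widetilde\psi_W(x,z)\,e^{xz}$, where $\widetilde\psi_W$ has entries in $\mathbb{C}(x)\otimes\mathbb{C}(z)$ and is of the form $I+\sum_{i\ge1}a_i(x)z^{-i}$ near $z=\infty$, such that the rows of $\psi_W(x,\cdot)$ belong to $W$ identically in $x$ (that is, for each row, after multiplication by a nonzero polynomial in $x$ that clears its poles in $x$, all the coefficients of its power series expansion in $x$ lie in $W$). The *bispectral dual* $b(W)$ of $W\in\mathrm{Gr}^{ad}(r)$ is the point of $\mathrm{Gr}^{ad}(r)$ with $\psi_{b(W)}(x,z)=\psi_W(z,x)^t$. For $U\in\mathrm{Gr}^{ad}(r)$ and $V\in\mathrm{Gr}^{ad}(s)$ let $\mathcal{D}(U,V)$ be the set of all $r\times s$ matrices $D$ with entries in $\mathbb{C}(z)[\partial_z]$ such that $U\star D\subseteq V$; here $\varphi\star D:=(D^t.\varphi^t)^t$, where the dot denotes the usual action of matrices of differential operators on matrices of functions. **Proposition.** Let $U\in\mathrm{Gr}^{ad}(r)$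 and $V\in\mathrm{Gr}^{ad}(s)$. 1. $\psi_U$, $\psi_V$, $b(U)$ and $b(V)$ exist and are unique. Moreover $b$ is induced by the bispectral involution of the Calogero–Moser spaces: if $X,Y$ are $n\times n$, $v$ is $n\times r$ and $w$ is $r\times n$ with $[X,Y]+vw=-I$, and $\widetilde\psi_U(x,z)=I+w(xI+X)^{-1}(zI-Y)^{-1}v$, then $\widetilde\psi_{b(U)}$ is given by the same formula for the quadruple $-(Y^t,X^t;w^t,v^t)$; similarly for $V$. 2. For each $D\in\mathcal{D}(U,V)$ there is exactly one $r\times s$ matrix $\Theta$ with entries in $\mathbb{C}(x)[\partial_x]$ such that $\psi_U(x,z)\star D(z)=\Theta(x).\psi_V(x,z)$, and the map $D(z)\mapsto\Theta(z)^t$ is a bijection from $\mathcal{D}(U,V)$ onto $\mathcal{D}(b(V),b(U))$. -/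

import Mathlib

open scoped TensorProduct Polynomial

noncomputable section

namespace AdelicGr

/-! ### The derivative on the field `ℂ(z)` -/

/-- The quotient rule `(p / q)' = (p' q - p q') / q ^ 2`, for `p / q` in lowest terms. -/
def ratDerivFun (f : RatFunc ℂ) : RatFunc ℂ :=
  algebraMap ℂ[X] (RatFunc ℂ)
      (Polynomial.derivative f.num * f.denom - f.num * Polynomial.derivative f.denom) /
    algebraMap ℂ[X] (RatFunc ℂ) f.denom ^ 2

lemma quotient_rule_aux (a b n d : ℂ[X]) (h0 : a * d = n * b) :
    (Polynomial.derivative n * d - n * Polynomial.derivative d) * b ^ 2 =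
      (Polynomial.derivative a * b - a * Polynomial.derivative b) * d ^ 2 := by
  have h1 : Polynomial.derivative a * d + a * Polynomial.derivative d =
      Polynomial.derivative n * b + n * Polynomial.derivative b := by
    rw [← Polynomial.derivative_mul, ← Polynomial.derivative_mul, h0]
  generalize Polynomial.derivative a = a' at *
  generalize Polynomial.derivative b = b' at *
  generalize Polynomial.derivative n = n' at *
  generalize Polynomial.derivative d = d' at *
  linear_combination (-(b * d)) * h1 + (b' * d + b * d') * h0

lemma ratDerivFun_div (a b : ℂ[X]) (hb : b ≠ 0) :
    ratDerivFun (algebraMap ℂ[X] (RatFunc ℂ) a / algebraMap ℂ[X] (RatFunc ℂ) b) =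
      algebraMap ℂ[X] (RatFunc ℂ)
          (Polynomial.derivative a * b - a * Polynomial.derivative b) /
        algebraMap ℂ[X] (RatFunc ℂ) b ^ 2 := by
  generalize hf : algebraMap ℂ[X] (RatFunc ℂ) a / algebraMap ℂ[X] (RatFunc ℂ) b = f
  have hb' : algebraMap ℂ[X] (RatFunc ℂ) b ≠ 0 := RatFunc.algebraMap_ne_zero hb
  have hd' : algebraMap ℂ[X] (RatFunc ℂ) f.denom ≠ 0 :=
    RatFunc.algebraMap_ne_zero f.denom_ne_zero
  have h0 : a * f.denom = f.num * b := by
    apply RatFunc.algebraMap_injective ℂ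
    rw [map_mul, map_mul]
    have h1 := hf.trans (RatFunc.num_div_denom f).symm
    rwa [div_eq_div_iff hb' hd'] at h1
  rw [ratDerivFun, div_eq_div_iff (pow_ne_zero 2 hd') (pow_ne_zero 2 hb'), ← map_pow, ← map_pow,
    ← map_mul, ← map_mul, quotient_rule_aux a b _ _ h0]

lemma exists_div (f : RatFunc ℂ) : ∃ a b : ℂ[X], b ≠ 0 ∧
    f = algebraMap ℂ[X] (RatFunc ℂ) a / algebraMap ℂ[X] (RatFunc ℂ) b :=
  ⟨f.num, f.denom, f.denom_ne_zero, (RatFunc.num_div_denom f).symm⟩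

/-- The derivation `d/dz` of the field `ℂ(z)`. -/
def ratDeriv : Derivation ℂ (RatFunc ℂ) (RatFunc ℂ) :=
  Derivation.mk'
    { toFun := ratDerivFun
      map_add' := by
        intro f g
        obtain ⟨a, b, hb, rfl⟩ := exists_div f
        obtain ⟨c, d, hd, rfl⟩ := exists_div g
        have hb' : algebraMap ℂ[X] (RatFunc ℂ) b ≠ 0 := RatFunc.algebraMap_ne_zero hb
        have hd' : algebraMap ℂ[X] (RatFunc ℂ) d ≠ 0 := RatFunc.algebraMap_ne_zero hd
        rw [div_add_div _ _ hb' hd', ← map_mul, ← map_mul, ← map_mul, ← map_add,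
          ratDerivFun_div _ _ (mul_ne_zero hb hd), ratDerivFun_div _ _ hb, ratDerivFun_div _ _ hd]
        simp only [Polynomial.derivative_mul, map_add, map_sub, map_mul]
        field_simp
        ring
      map_smul' := by
        intro t f
        obtain ⟨a, b, hb, rfl⟩ := exists_div f
        have h : t • (algebraMap ℂ[X] (RatFunc ℂ) a / algebraMap ℂ[X] (RatFunc ℂ) b) =
            algebraMap ℂ[X] (RatFunc ℂ) (Polynomial.C t * a) /
              algebraMap ℂ[X] (RatFunc ℂ) b := by
          rw [map_mul, mul_div_assoc, RatFunc.algebraMap_C, RatFunc.smul_eq_C_mul]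
        rw [h, ratDerivFun_div _ _ hb, ratDerivFun_div _ _ hb, RingHom.id_apply,
          RatFunc.smul_eq_C_mul, ← RatFunc.algebraMap_C, ← mul_div_assoc, ← map_mul]
        congr 2
        simp only [Polynomial.derivative_mul, Polynomial.derivative_C]
        ring }
    (by
      intro f g
      obtain ⟨a, b, hb, rfl⟩ := exists_div f
      obtain ⟨c, d, hd, rfl⟩ := exists_div g
      have hb' : algebraMap ℂ[X] (RatFunc ℂ) b ≠ 0 := RatFunc.algebraMap_ne_zero hb
      have hd' : algebraMap ℂ[X] (RatFunc ℂ) d ≠ 0 := RatFunc.algebraMap_ne_zero hd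
      simp only [LinearMap.coe_mk, AddHom.coe_mk, smul_eq_mul]
      rw [div_mul_div_comm, ← map_mul, ← map_mul,
        ratDerivFun_div _ _ (mul_ne_zero hb hd), ratDerivFun_div _ _ hb, ratDerivFun_div _ _ hd]
      simp only [Polynomial.derivative_mul, map_add, map_sub, map_mul]
      field_simp
      ring)

/-! ### Differential operators with rational coefficients -/

/-- A differential operator `∑ k, a k ∂ ^ k` in `ℂ(z)[∂]`, given by its finitely many
coefficients `a k`.  (Only the set of operators and its actions are used below, not
the product of operators.) -/
abbrev DiffOp : Type := ℕ →₀ RatFunc ℂ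

/-- The action `D.f = ∑ k, a k f⁽ᵏ⁾` of an operator on `ℂ(z)`. -/
def DiffOp.act (D : DiffOp) (f : RatFunc ℂ) : RatFunc ℂ :=
  D.sum fun k a => a * ratDeriv^[k] f

/-- The action `u ⋆ D = (Dᵗ.uᵗ)ᵗ` of an `r × s` matrix of operators on a row vector. -/
def rowStar {r s : ℕ} (u : Fin r → RatFunc ℂ) (D : Matrix (Fin r) (Fin s) DiffOp) :
    Fin s → RatFunc ℂ :=
  fun j => ∑ i, (D i j).act (u i)

/-! ### The adelic Grassmannian -/

/-- The embedding `ℂ[z]ʳ ⊆ ℂ(z)ʳ`. -/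
def polyVec {r : ℕ} (f : Fin r → ℂ[X]) : Fin r → RatFunc ℂ :=
  fun j => algebraMap ℂ[X] (RatFunc ℂ) (f j)

/-- `p ℂ[z]ʳ ⊆ W ⊆ q⁻¹ ℂ[z]ʳ` for some nonzero polynomials `p`, `q`. -/
def IsFat {r : ℕ} (W : Submodule ℂ (Fin r → RatFunc ℂ)) : Prop :=
  ∃ p q : ℂ[X], p ≠ 0 ∧ q ≠ 0 ∧
    (∀ f : Fin r → ℂ[X], polyVec (fun j => p * f j) ∈ W) ∧
    ∀ f ∈ W, ∃ g : Fin r → ℂ[X], (fun j => algebraMap ℂ[X] (RatFunc ℂ) q * f j) = polyVec g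

/-- The rational function `f` has no pole at `c`. -/
def RegularAt (c : ℂ) (f : RatFunc ℂ) : Prop := f.denom.eval c ≠ 0

/-- `z - c` as an element of `ℂ(z)`. -/
def linFactor (c : ℂ) : RatFunc ℂ := RatFunc.X - RatFunc.C c

/-- `w` is `c`-primary: with `O_c ⊆ ℂ(z)` the local ring of functions regular at `c`, one has
`(z - c) ^ N O_cʳ ⊆ w ⊆ (z - c) ^ (-N) O_cʳ` for some `N`. -/
def IsPrimaryAt {r : ℕ} (c : ℂ) (w : Submodule ℂ (Fin r → RatFunc ℂ)) : Prop :=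
  ∃ N : ℕ, (∀ f : Fin r → RatFunc ℂ, (∀ j, RegularAt c (f j)) →
      (fun j => linFactor c ^ N * f j) ∈ w) ∧
    ∀ f ∈ w, ∀ j, RegularAt c (linFactor c ^ N * f j)

/-- `W` is cut out by conditions that each involve only one point of `ℂ`: it is the intersection
of `c`-primary subspaces `w c` (`c ∈ ℂ`), where `w c = O_cʳ` for all but finitely many `c`. -/
def IsPrimaryDecomposable {r : ℕ} (W : Submodule ℂ (Fin r → RatFunc ℂ)) : Prop :=
  ∃ w : ℂ → Submodule ℂ (Fin r → RatFunc ℂ),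
    (∀ c, IsPrimaryAt c (w c)) ∧
    {c | ¬ ∀ f, f ∈ w c ↔ ∀ j, RegularAt c (f j)}.Finite ∧
    W = ⨅ c, w c

/-- The operators `D = (D_1, …, D_r)` with `D.ℂ[z] ⊆ W`. -/
def opModule {r : ℕ} (W : Submodule ℂ (Fin r → RatFunc ℂ)) : Set (Fin r → DiffOp) :=
  {D | ∀ p : ℂ[X], (fun j => (D j).act (algebraMap ℂ[X] (RatFunc ℂ) p)) ∈ W}

/-- The space of leading coefficients (vectors in `ℂ(z)ʳ`) of the operators in `opModule W`,
together with zero. -/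
def leadingCoeffs {r : ℕ} (W : Submodule ℂ (Fin r → RatFunc ℂ)) : Set (Fin r → RatFunc ℂ) :=
  {a | ∃ D ∈ opModule W, ∃ n : ℕ, (∀ k, n < k → ∀ j, D j k = 0) ∧ ∀ j, a j = D j n}

/-- The adelic Grassmannian of rank `r`. -/
def Grad (r : ℕ) : Set (Submodule ℂ (Fin r → RatFunc ℂ)) :=
  {W | IsFat W ∧ IsPrimaryDecomposable W ∧ leadingCoeffs W = Set.range polyVec}

/-- `𝒟(U, V)`: the `r × s` matrices of operators `D` such that `U ⋆ D ⊆ V`. -/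
def opSpace {r s : ℕ} (U : Submodule ℂ (Fin r → RatFunc ℂ))
    (V : Submodule ℂ (Fin s → RatFunc ℂ)) : Set (Matrix (Fin r) (Fin s) DiffOp) :=
  {D | ∀ u ∈ U, rowStar u D ∈ V}

/-! ### Functions of two variables

The ring `ℂ(x) ⊗ ℂ(z)` is the ring of rational functions of the two independent variables
`x`, `z` with a denominator of the form `θ(x) q(z)`.  An element `φ` of it is used to
represent the function `φ(x, z) e ^ {x z}`. -/

/-- `ℂ(x) ⊗ ℂ(z)`; the left factor contains the functions of `x`. -/
abbrev Fun2 : Type := RatFunc ℂ ⊗[ℂ] RatFunc ℂ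

/-- `φ(x, z) ↦ φ(z, x)`. -/
def swapXZ : Fun2 → Fun2 := Algebra.TensorProduct.comm ℂ (RatFunc ℂ) (RatFunc ℂ)

/-- `∂_x` on functions `φ(x, z) e ^ {x z}`:  `φ ↦ ∂φ/∂x + z φ`. -/
def nablaX (φ : Fun2) : Fun2 :=
  LinearMap.rTensor (RatFunc ℂ) ratDeriv.toLinearMap φ + ((1 : RatFunc ℂ) ⊗ₜ[ℂ] RatFunc.X) * φ

/-- `∂_z` on functions `φ(x, z) e ^ {x z}`:  `φ ↦ ∂φ/∂z + x φ`. -/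
def nablaZ (φ : Fun2) : Fun2 :=
  LinearMap.lTensor (RatFunc ℂ) ratDeriv.toLinearMap φ + (RatFunc.X ⊗ₜ[ℂ] (1 : RatFunc ℂ)) * φ

/-- The action of the operator `D(x) = ∑ k, a k (x) ∂_x ^ k` on `φ(x, z) e ^ {x z}`. -/
def DiffOp.actX (D : DiffOp) (φ : Fun2) : Fun2 :=
  D.sum fun k a => (a ⊗ₜ[ℂ] (1 : RatFunc ℂ)) * nablaX^[k] φ

/-- The action of the operator `D(z) = ∑ k, a k (z) ∂_z ^ k` on `φ(x, z) e ^ {x z}`. -/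
def DiffOp.actZ (D : DiffOp) (φ : Fun2) : Fun2 :=
  D.sum fun k a => ((1 : RatFunc ℂ) ⊗ₜ[ℂ] a) * nablaZ^[k] φ

/-- `Θ(x).ψ`, for a matrix of operators in `x`. -/
def leftAct {l m n : ℕ} (Θ : Matrix (Fin l) (Fin m) DiffOp) (ψ : Matrix (Fin m) (Fin n) Fun2) :
    Matrix (Fin l) (Fin n) Fun2 :=
  Matrix.of fun i j => ∑ k, (Θ i k).actX (ψ k j)

/-- `ψ ⋆ D(z) = (D(z)ᵗ.ψᵗ)ᵗ`, for a matrix of operators in `z`. -/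
def rightAct {l m n : ℕ} (ψ : Matrix (Fin l) (Fin m) Fun2) (D : Matrix (Fin m) (Fin n) DiffOp) :
    Matrix (Fin l) (Fin n) Fun2 :=
  Matrix.of fun i j => ∑ k, (D k j).actZ (ψ i k)

/-! ### The stationary Baker function -/

/-- The functions in `ℂ(x) ⊗ ℂ(z)` that vanish at `z = ∞`, i.e. whose expansion there has the
form `∑ i ≥ 1, a i (x) z ^ (-i)`. -/
def vanishAtInfty : Submodule ℂ Fun2 :=
  Submodule.span ℂ {φ | ∃ a f : RatFunc ℂ, f.num.degree < f.denom.degree ∧ φ = a ⊗ₜ[ℂ] f}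

/-- The row vector `φ(x, z) e ^ {x z}` belongs to `W` as a function of `z`, identically in `x`:
after multiplication by a nonzero polynomial `θ(x)` that clears its poles in `x`, so that
`θ(x) φ(x, z) = ∑ k, a k (z) x ^ k`, the function `θ(x) φ(x, z) e ^ {x z}` is a power series in
`x`, and all its coefficients `∑ k ≤ m, a k (z) z ^ (m - k) / (m - k)!` lie in `W`. -/
def RowMem {r : ℕ} (φ : Fin r → Fun2) (W : Submodule ℂ (Fin r → RatFunc ℂ)) : Prop :=
  ∃ θ : ℂ[X], θ ≠ 0 ∧ ∃ a : Fin r → (ℕ →₀ RatFunc ℂ),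
    (∀ j, (algebraMap ℂ[X] (RatFunc ℂ) θ ⊗ₜ[ℂ] (1 : RatFunc ℂ)) * φ j =
      (a j).sum fun k b => (RatFunc.X ^ k) ⊗ₜ[ℂ] b) ∧
    ∀ m : ℕ, (fun j => ∑ k ∈ Finset.range (m + 1),
      a j k * (RatFunc.X ^ (m - k) / ((m - k).factorial : RatFunc ℂ))) ∈ W

/-- `ψ(x, z) e ^ {x z}` is the stationary Baker function of `W`: one has
`ψ = 1 + ∑ i ≥ 1, a i (x) z ^ (-i)`, and each row of `ψ e ^ {x z}` belongs to `W`. -/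
def IsBaker {r : ℕ} (W : Submodule ℂ (Fin r → RatFunc ℂ))
    (ψ : Matrix (Fin r) (Fin r) Fun2) : Prop :=
  (∀ i j, (ψ - 1) i j ∈ vanishAtInfty) ∧ ∀ i, RowMem (ψ i) W

/-- The stationary Baker function of `W` (without the factor `e ^ {x z}`). -/
def baker {r : ℕ} (W : Submodule ℂ (Fin r → RatFunc ℂ)) : Matrix (Fin r) (Fin r) Fun2 :=
  Classical.epsilon (IsBaker W)

/-! ### The bispectral involution -/

/-- `W'` is a point of the adelic Grassmannian with `ψ_{W'}(x, z) = ψ_W(z, x)ᵗ`. -/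
def IsBispectralDual {r : ℕ} (W W' : Submodule ℂ (Fin r → RatFunc ℂ)) : Prop :=
  W' ∈ Grad r ∧ IsBaker W' ((baker W).transpose.map swapXZ)

/-- The bispectral involution `b`. -/
def bisp {r : ℕ} (W : Submodule ℂ (Fin r → RatFunc ℂ)) : Submodule ℂ (Fin r → RatFunc ℂ) :=
  Classical.epsilon (IsBispectralDual W)

/-- A quadruple `(X, Y; v, w)` with `[X, Y] + v w = -1`, representing a point of the
Calogero–Moser space `𝒞_n(r)`. -/
structure CMQuadruple (n r : ℕ) where
  X : Matrix (Fin n) (Fin n) ℂ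
  Y : Matrix (Fin n) (Fin n) ℂ
  v : Matrix (Fin n) (Fin r) ℂ
  w : Matrix (Fin r) (Fin n) ℂ
  moment : X * Y - Y * X + v * w = -1

/-- `b(X, Y; v, w) = -(Yᵗ, Xᵗ; wᵗ, vᵗ)`. -/
def CMQuadruple.dual {n r : ℕ} (q : CMQuadruple n r) : CMQuadruple n r where
  X := -q.Y.transpose
  Y := -q.X.transpose
  v := -q.w.transpose
  w := -q.v.transpose
  moment := by
    have h := congrArg Matrix.transpose q.moment
    simp only [Matrix.transpose_add, Matrix.transpose_sub, Matrix.transpose_mul,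
      Matrix.transpose_neg, Matrix.transpose_one] at h
    simpa using h

/-- `1 + w (x + X)⁻¹ (z - Y)⁻¹ v`. -/
def CMQuadruple.baker {n r : ℕ} (q : CMQuadruple n r) : Matrix (Fin r) (Fin r) Fun2 :=
  let c := algebraMap ℂ (RatFunc ℂ)
  let L : Matrix (Fin r) (Fin n) (RatFunc ℂ) :=
    q.w.map c * (Matrix.scalar (Fin n) RatFunc.X + q.X.map c)⁻¹
  let R : Matrix (Fin n) (Fin r) (RatFunc ℂ) :=
    (Matrix.scalar (Fin n) RatFunc.X - q.Y.map c)⁻¹ * q.v.map c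
  1 + L.map (fun f => f ⊗ₜ[ℂ] (1 : RatFunc ℂ)) * R.map (fun f => (1 : RatFunc ℂ) ⊗ₜ[ℂ] f)

end AdelicGr

end

open scoped TensorProduct Polynomial

noncomputable section

namespace AdelicGr

section

/-! ### Polynomial and proper parts of rational functions -/

/-! A function φ(x,z)e^{xz} is stored as φ ∈ ℂ(x) ⊗ ℂ(z). For an operator D(z) one has D.e^{xz} =
`sym D` · e^{xz}, and the coefficient of x^m/m! on the left is D.z^m. So a row φe^{xz} lies in W
identically in x exactly when some θ(x)φ is the symbol of an operator in `opM W` (`rowMem_iff`).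
Composition of such operators on the right with z and ∂ makes these rows a module `rowModule W` over
ℂ(x)[∂_x].

Baker functions. An element of `rowModule W` that vanishes at z = ∞ is zero, because a nonzero
operator in `opM W` has a leading coefficient that is polynomial, whereas here it would also be
proper (`rowModule_inf_vanish`). This gives uniqueness; existence is a dimension count
(`exists_finite_codim`, `exists_isBaker`). Division by ψ = 1 + O(1/z) then shows that ψ freely
generates `rowModule W` (`exists_rowOp_eq`, `eq_zero_of_rowOp_mem`). Primary decomposability says
that every element of W is D.1 for some D in `opM W` (`exists_op_of_mem`), so that W is recovered
from ψ (`IsBaker.le`).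

Bispectral duality. Baker functions of points of the Grassmannian satisfy a condition that does not
mention W, `HalfBaker`: ψ - 1 is proper in both variables, and some p(z)e_i is Ξ(x).ψ for each i.
The main point is that this condition survives transposition with exchange of x and z
(`HalfBaker.dual`), again by a dimension count. Conversely a `HalfBaker` matrix is the Baker
function of `rowSpace ψ`, a point of the Grassmannian (`HalfBaker.rowSpace_mem_Grad`); this produces
b(W). The Calogero–Moser statement is then a matrix identity (`CMQuadruple.baker_dual`).

Operators. If U ⋆ D ⊆ V, the rows of ψ_U ⋆ D lie in `rowModule V`, hence ψ_U ⋆ D = Θ.ψ_V with Θ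
unique. Conversely such an equation forces U ⋆ D ⊆ V (`mem_opSpace_of_rightAct`). Transposing and
exchanging x and z turns it into ψ_{b(V)} ⋆ Θᵗ = Dᵗ.ψ_{b(U)}, the equation of the same kind for Θᵗ,
and doing so twice changes nothing. -/

/-- The inclusion `ℂ[z] ⊆ ℂ(z)`. -/
abbrev toK (p : ℂ[X]) : RatFunc ℂ := algebraMap ℂ[X] (RatFunc ℂ) p

lemma toK_ne_zero {p : ℂ[X]} (h : p ≠ 0) : toK p ≠ 0 := RatFunc.algebraMap_ne_zero h

lemma toK_C (c : ℂ) : toK (Polynomial.C c) = algebraMap ℂ (RatFunc ℂ) c := by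
  rw [toK, ← Polynomial.algebraMap_eq, ← IsScalarTower.algebraMap_apply]

lemma toK_smul (c : ℂ) (p : ℂ[X]) : toK (c • p) = c • toK p := by
  rw [Polynomial.smul_eq_C_mul, toK, map_mul, Algebra.smul_def, ← toK_C]

/-- `ℂ[z]` as a subspace of `ℂ(z)`. -/
def Pol : Submodule ℂ (RatFunc ℂ) where
  carrier := Set.range toK
  add_mem' := by
    rintro _ _ ⟨a, rfl⟩ ⟨b, rfl⟩
    exact ⟨a + b, map_add _ _ _⟩
  zero_mem' := ⟨0, map_zero _⟩
  smul_mem' := by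
    rintro c _ ⟨a, rfl⟩
    exact ⟨c • a, toK_smul c a⟩

lemma toK_mem_Pol (p : ℂ[X]) : toK p ∈ Pol := ⟨p, rfl⟩

lemma Pol_mul {f g : RatFunc ℂ} (hf : f ∈ Pol) (hg : g ∈ Pol) : f * g ∈ Pol := by
  obtain ⟨a, rfl⟩ := hf
  obtain ⟨b, rfl⟩ := hg
  exact ⟨a * b, map_mul _ _ _⟩

lemma ratDeriv_toK (p : ℂ[X]) : ratDeriv (toK p) = toK (Polynomial.derivative p) := by
  have h := ratDerivFun_div p 1 one_ne_zero
  rw [map_one, div_one] at h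
  change ratDerivFun _ = _
  rw [h]
  simp

lemma ratDeriv_div (a b : ℂ[X]) (hb : b ≠ 0) :
    ratDeriv (toK a / toK b) =
      toK (Polynomial.derivative a * b - a * Polynomial.derivative b) / toK (b ^ 2) := by
  rw [toK, toK, toK, toK, map_pow]
  exact ratDerivFun_div a b hb

lemma iterate_ratDeriv_toK (k : ℕ) (p : ℂ[X]) :
    ratDeriv^[k] (toK p) = toK (Polynomial.derivative^[k] p) := by
  induction k generalizing p with
  | zero => rfl
  | succ k ih => rw [Function.iterate_succ_apply, ratDeriv_toK, ih, Function.iterate_succ_apply]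

/-- Properness is defined through the reduced fraction; this allows it to be tested on any fraction.
-/
lemma degree_lt_iff_of_div {a b : ℂ[X]} (hb : b ≠ 0) :
    (toK a / toK b).num.degree < (toK a / toK b).denom.degree ↔ a.degree < b.degree := by
  set f := toK a / toK b with hf
  have hd : f.denom ≠ 0 := f.denom_ne_zero
  have h0 : a * f.denom = f.num * b := by
    apply RatFunc.algebraMap_injective ℂ
    rw [map_mul, map_mul]
    have h1 := hf.symm.trans (RatFunc.num_div_denom f).symm
    rwa [div_eq_div_iff (toK_ne_zero hb) (toK_ne_zero hd)] at h1
  have h2 := congrArg Polynomial.degree h0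
  rw [Polynomial.degree_mul, Polynomial.degree_mul] at h2
  rw [Polynomial.degree_eq_natDegree hb, Polynomial.degree_eq_natDegree hd] at h2 ⊢
  rcases eq_or_ne a 0 with rfl | ha
  · have : f.num = 0 := by simp [hf]
    simp [this]
  · have hn : f.num ≠ 0 := by
      intro h
      rw [h, zero_mul] at h0
      exact mul_ne_zero ha hd h0
    rw [Polynomial.degree_eq_natDegree ha, Polynomial.degree_eq_natDegree hn] at h2 ⊢
    norm_cast at h2 ⊢
    omega

lemma degree_mul_lt_degree_mul {p q d : ℂ[X]} (h : p.degree < q.degree) (hd : d ≠ 0) :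
    (d * p).degree < (d * q).degree := by
  have hq : q ≠ 0 := by
    rintro rfl
    simp at h
  rcases eq_or_ne p 0 with rfl | hp
  · rw [mul_zero, Polynomial.degree_zero, bot_lt_iff_ne_bot, Ne, Polynomial.degree_eq_bot]
    exact mul_ne_zero hd hq
  · rw [Polynomial.degree_mul, Polynomial.degree_mul, Polynomial.degree_eq_natDegree hp,
      Polynomial.degree_eq_natDegree hq, Polynomial.degree_eq_natDegree hd] at *
    norm_cast at *
    omega

/-- The rational functions vanishing at infinity. -/
def Pr : Submodule ℂ (RatFunc ℂ) where
  carrier := {f | f.num.degree < f.denom.degree}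
  add_mem' := by
    intro f g hf hg
    obtain ⟨a, b, hb, rfl⟩ := exists_div f
    obtain ⟨c, d, hd, rfl⟩ := exists_div g
    have hf' := (degree_lt_iff_of_div hb).1 hf
    have hg' := (degree_lt_iff_of_div hd).1 hg
    rw [div_add_div _ _ (toK_ne_zero hb) (toK_ne_zero hd), ← map_mul, ← map_mul, ← map_mul,
      ← map_add]
    refine (degree_lt_iff_of_div (mul_ne_zero hb hd)).2 ?_
    refine (Polynomial.degree_add_le _ _).trans_lt (max_lt ?_ ?_)
    · rw [mul_comm a d, mul_comm b d]
      exact degree_mul_lt_degree_mul hf' hd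
    · exact degree_mul_lt_degree_mul hg' hb
  zero_mem' := by simp
  smul_mem' := by
    intro c f hf
    obtain ⟨a, b, hb, rfl⟩ := exists_div f
    have hf' := (degree_lt_iff_of_div hb).1 hf
    have h : c • (toK a / toK b) = toK (c • a) / toK b := by
      rw [toK_smul, smul_div_assoc]
    rw [h]
    exact (degree_lt_iff_of_div hb).2 ((Polynomial.degree_smul_le c a).trans_lt hf')

lemma div_mem_Pr {a b : ℂ[X]} (hb : b ≠ 0) : toK a / toK b ∈ Pr ↔ a.degree < b.degree :=
  degree_lt_iff_of_div hb

lemma exists_div_of_mem_Pr {f : RatFunc ℂ} (hf : f ∈ Pr) :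
    ∃ a b : ℂ[X], b ≠ 0 ∧ a.degree < b.degree ∧ f = toK a / toK b :=
  ⟨f.num, f.denom, f.denom_ne_zero, hf, (RatFunc.num_div_denom f).symm⟩

lemma toK_mem_Pr {p : ℂ[X]} : toK p ∈ Pr ↔ p = 0 := by
  have h := div_mem_Pr (a := p) (b := 1) one_ne_zero
  rw [toK, toK, map_one, div_one] at h
  rw [h, Polynomial.degree_one, Nat.WithBot.lt_zero_iff, Polynomial.degree_eq_bot]

lemma Pr_mul {f g : RatFunc ℂ} (hf : f ∈ Pr) (hg : g ∈ Pr) : f * g ∈ Pr := by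
  obtain ⟨a, b, hb, hab, rfl⟩ := exists_div_of_mem_Pr hf
  obtain ⟨c, d, hd, hcd, rfl⟩ := exists_div_of_mem_Pr hg
  rw [div_mul_div_comm, ← map_mul, ← map_mul, div_mem_Pr (mul_ne_zero hb hd)]
  rcases eq_or_ne a 0 with rfl | ha
  · rw [zero_mul, Polynomial.degree_zero, bot_lt_iff_ne_bot, Ne, Polynomial.degree_eq_bot]
    exact mul_ne_zero hb hd
  · refine (degree_mul_lt_degree_mul hcd ha).trans ?_
    rw [mul_comm a, mul_comm b]
    refine degree_mul_lt_degree_mul hab hd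

lemma Pr_deriv {f : RatFunc ℂ} (hf : f ∈ Pr) : ratDeriv f ∈ Pr := by
  obtain ⟨a, b, hb, hab, rfl⟩ := exists_div_of_mem_Pr hf
  rw [ratDeriv_div a b hb, div_mem_Pr (pow_ne_zero 2 hb)]
  rcases eq_or_ne a 0 with rfl | ha
  · rw [Polynomial.derivative_zero, zero_mul, zero_mul, sub_zero, Polynomial.degree_zero,
      bot_lt_iff_ne_bot, Ne, Polynomial.degree_eq_bot]
    exact pow_ne_zero 2 hb
  have key : ∀ u v : ℂ[X], u.degree < b.degree → v.degree ≤ b.degree →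
      (u * v).degree < (b ^ 2).degree := by
    intro u v hu hv
    rcases eq_or_ne v 0 with rfl | hv0
    · rw [mul_zero, Polynomial.degree_zero, bot_lt_iff_ne_bot, Ne, Polynomial.degree_eq_bot]
      exact pow_ne_zero 2 hb
    · rw [mul_comm, pow_two]
      refine (degree_mul_lt_degree_mul hu hv0).trans_le ?_
      rw [Polynomial.degree_mul, Polynomial.degree_mul]
      gcongr
  refine (Polynomial.degree_sub_le _ _).trans_lt (max_lt ?_ ?_)
  · exact key _ _ (Polynomial.degree_derivative_le.trans_lt hab) le_rfl
  · exact key _ _ hab Polynomial.degree_derivative_le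

lemma X_mul_Pr {f : RatFunc ℂ} (hf : f ∈ Pr) :
    ∃ c : ℂ, toK Polynomial.X * f - algebraMap ℂ (RatFunc ℂ) c ∈ Pr := by
  obtain ⟨a, b, hb, hab, rfl⟩ := exists_div_of_mem_Pr hf
  have hbn : b.degree = b.natDegree := Polynomial.degree_eq_natDegree hb
  have ha : ∀ n, b.natDegree ≤ n → a.coeff n = 0 := fun n hn =>
    Polynomial.coeff_eq_zero_of_degree_lt (hab.trans_le (by rw [hbn]; exact_mod_cast hn))
  rcases Nat.eq_zero_or_pos b.natDegree with h0 | hpos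
  · refine ⟨0, ?_⟩
    have : a = 0 := by
      ext n
      exact ha n (by omega)
    simp [this]
  -- The constant is the value of zf at infinity. The truncated subtraction is harmless since
  -- `b.natDegree` is positive here.
  refine ⟨a.coeff (b.natDegree - 1) / b.leadingCoeff, ?_⟩
  have hb' := toK_ne_zero hb
  have hl : b.leadingCoeff ≠ 0 := Polynomial.leadingCoeff_ne_zero.2 hb
  have e : toK Polynomial.X * (toK a / toK b) -
      algebraMap ℂ (RatFunc ℂ) (a.coeff (b.natDegree - 1) / b.leadingCoeff) =
      toK (Polynomial.X * a -
        Polynomial.C (a.coeff (b.natDegree - 1) / b.leadingCoeff) * b) / toK b := by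
    rw [← toK_C]
    simp only [toK, map_sub, map_mul] at hb' ⊢
    field_simp
  rw [e, div_mem_Pr hb, hbn, Polynomial.degree_lt_iff_coeff_zero]
  intro m hm
  obtain ⟨m, rfl⟩ : ∃ k, m = k + 1 := ⟨m - 1, by omega⟩
  rw [Polynomial.coeff_sub, Polynomial.coeff_X_mul, Polynomial.coeff_C_mul]
  rcases eq_or_lt_of_le hm with h | h
  · rw [← h, Polynomial.coeff_natDegree, div_mul_cancel₀ _ hl, h, Nat.add_sub_cancel, sub_self]
  · rw [ha m (by omega), Polynomial.coeff_eq_zero_of_natDegree_lt h, mul_zero, sub_zero]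

lemma sub_div_mem_Pr (f : RatFunc ℂ) : f - toK (f.num / f.denom) ∈ Pr := by
  have hd : f.denom ≠ 0 := f.denom_ne_zero
  have e : f - toK (f.num / f.denom) = toK (f.num % f.denom) / toK f.denom := by
    have hd' := toK_ne_zero hd
    have h2 := congrArg toK (EuclideanDomain.div_add_mod f.num f.denom)
    rw [eq_div_iff hd', sub_mul]
    nth_rewrite 1 [← RatFunc.num_div_denom f]
    rw [div_mul_cancel₀ _ hd', ← toK, ← h2]
    simp only [toK, map_add, map_mul]
    ring
  rw [e, div_mem_Pr hd]
  exact EuclideanDomain.mod_lt _ hd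

lemma eq_of_sub_mem_Pr {f : RatFunc ℂ} {p q : ℂ[X]} (hp : f - toK p ∈ Pr) (hq : f - toK q ∈ Pr) :
    p = q := by
  have h := Pr.sub_mem hq hp
  rw [sub_sub_sub_cancel_left, toK, toK, ← map_sub] at h
  exact sub_eq_zero.1 (toK_mem_Pr.1 h)

/-- The polynomial part of a rational function. -/
def polyPart : RatFunc ℂ →ₗ[ℂ] ℂ[X] where
  toFun f := f.num / f.denom
  map_add' f g := by
    refine eq_of_sub_mem_Pr (sub_div_mem_Pr _) ?_
    have := Pr.add_mem (sub_div_mem_Pr f) (sub_div_mem_Pr g)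
    convert this using 1
    simp only [toK, map_add]
    ring
  map_smul' c f := by
    refine eq_of_sub_mem_Pr (sub_div_mem_Pr _) ?_
    have := Pr.smul_mem c (sub_div_mem_Pr f)
    rwa [smul_sub, ← toK_smul] at this

lemma sub_polyPart_mem (f : RatFunc ℂ) : f - toK (polyPart f) ∈ Pr := sub_div_mem_Pr f

lemma polyPart_eq {f : RatFunc ℂ} {p : ℂ[X]} (h : f - toK p ∈ Pr) : polyPart f = p :=
  eq_of_sub_mem_Pr (sub_polyPart_mem f) h

lemma polyPart_toK (p : ℂ[X]) : polyPart (toK p) = p := polyPart_eq (by simp)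

lemma polyPart_eq_zero {f : RatFunc ℂ} : polyPart f = 0 ↔ f ∈ Pr := by
  refine ⟨fun h => ?_, fun h => polyPart_eq (by simpa using h)⟩
  have := sub_polyPart_mem f
  rwa [h, toK, map_zero, sub_zero] at this

lemma polyPart_deriv (f : RatFunc ℂ) :
    polyPart (ratDeriv f) = Polynomial.derivative (polyPart f) := by
  refine polyPart_eq ?_
  rw [← ratDeriv_toK, ← map_sub]
  exact Pr_deriv (sub_polyPart_mem f)

/-- The coefficient of `z ^ k` in the expansion of a rational function at infinity. -/
def coef (k : ℕ) : RatFunc ℂ →ₗ[ℂ] ℂ := Polynomial.lcoeff ℂ k ∘ₗ polyPart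

lemma coef_apply (k : ℕ) (f : RatFunc ℂ) : coef k f = (polyPart f).coeff k := rfl

lemma coef_toK (k : ℕ) (p : ℂ[X]) : coef k (toK p) = p.coeff k := by
  rw [coef_apply, polyPart_toK]

lemma coef_X_pow (k n : ℕ) :
    coef k ((RatFunc.X : RatFunc ℂ) ^ n) = if k = n then 1 else 0 := by
  have : (RatFunc.X : RatFunc ℂ) ^ n = toK (Polynomial.X ^ n) := by
    rw [toK, map_pow, RatFunc.algebraMap_X]
  rw [this, coef_toK, Polynomial.coeff_X_pow]

lemma coef_X_mul (k : ℕ) (f : RatFunc ℂ) : coef (k + 1) (RatFunc.X * f) = coef k f := by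
  obtain ⟨c, hc⟩ := X_mul_Pr (sub_polyPart_mem f)
  have : polyPart (RatFunc.X * f) = Polynomial.X * polyPart f + Polynomial.C c := by
    refine polyPart_eq ?_
    convert hc using 1
    rw [← toK_C]
    simp only [toK, map_add, map_mul, RatFunc.algebraMap_X]
    ring
  rw [coef_apply, this, Polynomial.coeff_add, Polynomial.coeff_X_mul, Polynomial.coeff_C_succ,
    add_zero, coef_apply]

/-- The rational functions of degree less than `n` at infinity. -/
def F (n : ℕ) : Submodule ℂ (RatFunc ℂ) where
  carrier := {f | ∀ k, n ≤ k → coef k f = 0}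
  add_mem' hf hg k hk := by rw [map_add, hf k hk, hg k hk, add_zero]
  zero_mem' k _ := map_zero _
  smul_mem' c f hf k hk := by rw [map_smul, hf k hk, smul_zero]

lemma mem_F {n : ℕ} {f : RatFunc ℂ} : f ∈ F n ↔ ∀ k, n ≤ k → coef k f = 0 := Iff.rfl

lemma F_mono {m n : ℕ} (h : m ≤ n) : F m ≤ F n := fun _ hf k hk => hf k (h.trans hk)

lemma F_zero : F 0 = Pr := by
  ext f
  rw [mem_F, ← polyPart_eq_zero]
  constructor
  · intro h
    ext k
    exact h k (Nat.zero_le k)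
  · intro h k _
    rw [coef_apply, h, Polynomial.coeff_zero]

lemma Pr_le_F (n : ℕ) : Pr ≤ F n := F_zero ▸ F_mono (Nat.zero_le n)

lemma toK_mem_F {n : ℕ} {p : ℂ[X]} : toK p ∈ F n ↔ p.degree < n := by
  rw [mem_F, Polynomial.degree_lt_iff_coeff_zero]
  simp only [coef_toK]

lemma exists_mem_F (f : RatFunc ℂ) : ∃ n, f ∈ F n := by
  refine ⟨(polyPart f).natDegree + 1, fun k hk => ?_⟩
  exact Polynomial.coeff_eq_zero_of_natDegree_lt (Nat.lt_of_succ_le hk)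

lemma X_mul_mem_F {n : ℕ} {f : RatFunc ℂ} (hf : f ∈ F n) : RatFunc.X * f ∈ F (n + 1) := by
  intro k hk
  obtain ⟨k, rfl⟩ : ∃ l, k = l + 1 := ⟨k - 1, by omega⟩
  rw [coef_X_mul, hf k (by omega)]

lemma F_deriv {n : ℕ} {f : RatFunc ℂ} (hf : f ∈ F n) : ratDeriv f ∈ F n := by
  intro k hk
  rw [coef_apply, polyPart_deriv, Polynomial.coeff_derivative, ← coef_apply, hf (k + 1) (by omega),
    zero_mul]

lemma X_pow_mem_F (n : ℕ) : (RatFunc.X : RatFunc ℂ) ^ n ∈ F (n + 1) := by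
  intro k hk
  rw [coef_X_pow, if_neg (by omega)]

lemma sub_coef_mem_F {n : ℕ} {f : RatFunc ℂ} (hf : f ∈ F (n + 1)) :
    f - coef n f • RatFunc.X ^ n ∈ F n := by
  intro k hk
  rw [map_sub, map_smul, coef_X_pow]
  rcases eq_or_lt_of_le hk with rfl | h
  · simp
  · rw [if_neg (by omega), hf k (by omega), smul_zero, sub_zero]

/-- The rational functions that are regular at infinity. -/
def Finf : Subalgebra ℂ (RatFunc ℂ) where
  carrier := F 1
  add_mem' := (F 1).add_mem
  mul_mem' := by
    intro f g hf hg
    have hf' := sub_coef_mem_F (n := 0) hf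
    have hg' := sub_coef_mem_F (n := 0) hg
    rw [F_zero, pow_zero] at hf' hg'
    -- Each factor is split into its value at infinity and a proper part, which reduces the claim to
    -- `Pr_mul`.
    have e : f * g = (f - coef 0 f • 1) * (g - coef 0 g • 1) + coef 0 f • (g - coef 0 g • 1) +
        coef 0 g • (f - coef 0 f • 1) + (coef 0 f * coef 0 g) • 1 := by
      simp only [Algebra.smul_def, mul_one, map_mul]
      ring
    rw [e]
    refine (F 1).add_mem (Pr_le_F 1 (Pr.add_mem (Pr.add_mem (Pr_mul hf' hg')
      (Pr.smul_mem _ hg')) (Pr.smul_mem _ hf'))) ((F 1).smul_mem _ ?_)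
    simpa using X_pow_mem_F 0
  algebraMap_mem' c := by
    rw [Algebra.algebraMap_eq_smul_one]
    refine (F 1).smul_mem _ ?_
    simpa using X_pow_mem_F 0

lemma Finf_mul_Pr {f g : RatFunc ℂ} (hf : f ∈ Finf) (hg : g ∈ Pr) : f * g ∈ Pr := by
  have hf' := sub_coef_mem_F (n := 0) hf
  rw [F_zero, pow_zero] at hf'
  have e : f * g = (f - coef 0 f • 1) * g + coef 0 f • g := by
    simp only [Algebra.smul_def, mul_one]
    ring
  rw [e]
  exact Pr.add_mem (Pr_mul hf' hg) (Pr.smul_mem _ hg)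

lemma Pol_inf_Pr {f : RatFunc ℂ} (h1 : f ∈ Pol) (h2 : f ∈ Pr) : f = 0 := by
  obtain ⟨p, rfl⟩ := h1
  rw [toK_mem_Pr.1 h2, toK, map_zero]

lemma toK_X : toK Polynomial.X = RatFunc.X := RatFunc.algebraMap_X

lemma X_pow_mem_Pol (n : ℕ) : (RatFunc.X : RatFunc ℂ) ^ n ∈ Pol :=
  ⟨Polynomial.X ^ n, by rw [toK, map_pow, RatFunc.algebraMap_X]⟩

lemma ratDeriv_X : ratDeriv (RatFunc.X : RatFunc ℂ) = 1 := by
  rw [← toK_X, ratDeriv_toK, Polynomial.derivative_X, toK, map_one]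

end

section

/-! ### Subspaces of `ℂ(x) ⊗ ℂ(z)` -/

/-- The subspace `A ⊗ B` of `ℂ(x) ⊗ ℂ(z)`. -/
def box (A B : Submodule ℂ (RatFunc ℂ)) : Submodule ℂ Fun2 :=
  Submodule.map₂ (TensorProduct.mk ℂ (RatFunc ℂ) (RatFunc ℂ)) A B

section box
variable {A A' B B' : Submodule ℂ (RatFunc ℂ)}

lemma tmul_mem_box {a b : RatFunc ℂ} (ha : a ∈ A) (hb : b ∈ B) : a ⊗ₜ[ℂ] b ∈ box A B :=
  Submodule.apply_mem_map₂ _ ha hb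

lemma box_le {P : Submodule ℂ Fun2} : box A B ≤ P ↔ ∀ a ∈ A, ∀ b ∈ B, a ⊗ₜ[ℂ] b ∈ P :=
  Submodule.map₂_le

lemma box_mono (hA : A ≤ A') (hB : B ≤ B') : box A B ≤ box A' B' :=
  Submodule.map₂_le_map₂ hA hB

lemma mem_box_top (φ : Fun2) : φ ∈ box ⊤ ⊤ := by
  induction φ using TensorProduct.induction_on with
  | zero => exact zero_mem _
  | tmul a b => exact tmul_mem_box trivial trivial
  | add a b ha hb => exact add_mem ha hb

lemma box_ext {N : Type*} [AddCommGroup N] [Module ℂ N] {f g : Fun2 →ₗ[ℂ] N}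
    (h : ∀ a ∈ A, ∀ b ∈ B, f (a ⊗ₜ[ℂ] b) = g (a ⊗ₜ[ℂ] b)) {φ : Fun2} (hφ : φ ∈ box A B) :
    f φ = g φ :=
  (box_le (P := LinearMap.eqLocus f g)).2 h hφ

lemma box_map {f : Fun2 →ₗ[ℂ] Fun2}
    (h : ∀ a ∈ A, ∀ b ∈ B, f (a ⊗ₜ[ℂ] b) ∈ box A' B') {φ : Fun2} (hφ : φ ∈ box A B) :
    f φ ∈ box A' B' :=
  (box_le (P := (box A' B').comap f)).2 h hφ

/-- `φ ∈ A ⊗ ℂ(z)` if and only if all slices of `φ` in the second variable are in `A`. -/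
lemma mem_box_top_iff {φ : Fun2} : φ ∈ box A ⊤ ↔
    ∀ f : RatFunc ℂ →ₗ[ℂ] ℂ,
      TensorProduct.rid ℂ (RatFunc ℂ) (LinearMap.lTensor (RatFunc ℂ) f φ) ∈ A := by
  constructor
  · intro h f
    refine (box_le (P := A.comap ((TensorProduct.rid ℂ (RatFunc ℂ)).toLinearMap ∘ₗ
      LinearMap.lTensor (RatFunc ℂ) f))).2 (fun a ha b _ => ?_) h
    simpa using A.smul_mem _ ha
  · intro h
    classical
    let 𝓑 := Module.Basis.ofVectorSpace ℂ (RatFunc ℂ)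
    have e : φ = (TensorProduct.equivFinsuppOfBasisRight 𝓑 φ).sum
        fun i m => m ⊗ₜ[ℂ] 𝓑 i := by
      rw [← TensorProduct.equivFinsuppOfBasisRight_symm_apply, LinearEquiv.symm_apply_apply]
    rw [e]
    refine Submodule.sum_mem _ fun i _ => tmul_mem_box ?_ Submodule.mem_top
    have h2 : TensorProduct.equivFinsuppOfBasisRight 𝓑 φ i =
        TensorProduct.rid ℂ (RatFunc ℂ) (LinearMap.lTensor (RatFunc ℂ) (𝓑.coord i) φ) := by
      rw [TensorProduct.equivFinsuppOfBasisRight_apply]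
    rw [h2]
    exact h _

/-- Membership in A ⊗ ℂ(z) is tested slice by slice, where intersections are immediate. -/
lemma box_inf_box_left {φ : Fun2} (h : φ ∈ box A ⊤) (h' : φ ∈ box A' ⊤) :
    φ ∈ box (A ⊓ A') ⊤ :=
  mem_box_top_iff.2 fun f => ⟨mem_box_top_iff.1 h f, mem_box_top_iff.1 h' f⟩

lemma box_inf_box {φ : Fun2} (h : φ ∈ box A ⊤) (h' : φ ∈ box ⊤ B) : φ ∈ box A B := by
  -- A projector of ℂ(x) onto A, tensored with the identity, fixes φ by `h` and sends ℂ(x) ⊗ B into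
  -- A ⊗ B.
  obtain ⟨C, hC⟩ := A.exists_isCompl
  have h1 : LinearMap.rTensor (RatFunc ℂ) (A.subtype ∘ₗ Submodule.projectionOnto A C hC) φ = φ := by
    refine box_ext (g := LinearMap.id) (fun a ha b _ => ?_) h
    have := Submodule.projectionOnto_apply_left hC ⟨a, ha⟩
    simp only [LinearMap.rTensor_tmul, LinearMap.comp_apply, LinearMap.id_apply]
    rw [this]
    rfl
  rw [← h1]
  refine box_map (fun a _ b hb => ?_) h'
  rw [LinearMap.rTensor_tmul]
  exact tmul_mem_box (Submodule.coe_mem _) hb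

end box

/-! ### The actions of operators as bilinear maps -/

/-- `nablaX` as a linear map. -/
def nX : Fun2 →ₗ[ℂ] Fun2 :=
  LinearMap.rTensor (RatFunc ℂ) ratDeriv.toLinearMap +
    LinearMap.mulLeft ℂ ((1 : RatFunc ℂ) ⊗ₜ[ℂ] RatFunc.X)

/-- `nablaZ` as a linear map. -/
def nZ : Fun2 →ₗ[ℂ] Fun2 :=
  LinearMap.lTensor (RatFunc ℂ) ratDeriv.toLinearMap +
    LinearMap.mulLeft ℂ (RatFunc.X ⊗ₜ[ℂ] (1 : RatFunc ℂ))

lemma nX_tmul (a b : RatFunc ℂ) :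
    nX (a ⊗ₜ[ℂ] b) = ratDeriv a ⊗ₜ[ℂ] b + a ⊗ₜ[ℂ] (RatFunc.X * b) := by
  simp [nX]

lemma nZ_tmul (a b : RatFunc ℂ) :
    nZ (a ⊗ₜ[ℂ] b) = a ⊗ₜ[ℂ] ratDeriv b + (RatFunc.X * a) ⊗ₜ[ℂ] b := by
  simp [nZ]

lemma nablaX_iterate (k : ℕ) (φ : Fun2) : nablaX^[k] φ = (nX ^ k) φ := by
  rw [Module.End.coe_pow]
  rfl

lemma nablaZ_iterate (k : ℕ) (φ : Fun2) : nablaZ^[k] φ = (nZ ^ k) φ := by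
  rw [Module.End.coe_pow]
  rfl

/-- Multiplication by `a(x)`. -/
def mX (a : RatFunc ℂ) : Fun2 →ₗ[ℂ] Fun2 := LinearMap.mulLeft ℂ (a ⊗ₜ[ℂ] (1 : RatFunc ℂ))

/-- Multiplication by `b(z)`. -/
def mZ (b : RatFunc ℂ) : Fun2 →ₗ[ℂ] Fun2 := LinearMap.mulLeft ℂ ((1 : RatFunc ℂ) ⊗ₜ[ℂ] b)

lemma mX_apply (a : RatFunc ℂ) (φ : Fun2) : mX a φ = (a ⊗ₜ[ℂ] (1 : RatFunc ℂ)) * φ := rfl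

lemma mZ_apply (b : RatFunc ℂ) (φ : Fun2) : mZ b φ = ((1 : RatFunc ℂ) ⊗ₜ[ℂ] b) * φ := rfl

lemma mX_tmul (a b c : RatFunc ℂ) : mX a (b ⊗ₜ[ℂ] c) = (a * b) ⊗ₜ[ℂ] c := by
  simp [mX]

lemma mZ_tmul (a b c : RatFunc ℂ) : mZ a (b ⊗ₜ[ℂ] c) = b ⊗ₜ[ℂ] (a * c) := by
  simp [mZ]

lemma mX_mX (a b : RatFunc ℂ) (φ : Fun2) : mX a (mX b φ) = mX (a * b) φ := by
  rw [mX_apply, mX_apply, mX_apply, ← mul_assoc, Algebra.TensorProduct.tmul_mul_tmul, mul_one]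

lemma mZ_mZ (a b : RatFunc ℂ) (φ : Fun2) : mZ a (mZ b φ) = mZ (a * b) φ := by
  rw [mZ_apply, mZ_apply, mZ_apply, ← mul_assoc, Algebra.TensorProduct.tmul_mul_tmul, mul_one]

lemma mX_one (φ : Fun2) : mX 1 φ = φ := by
  rw [mX_apply, ← Algebra.TensorProduct.one_def, one_mul]

lemma mZ_one (φ : Fun2) : mZ 1 φ = φ := by
  rw [mZ_apply, ← Algebra.TensorProduct.one_def, one_mul]

lemma mX_injective {a : RatFunc ℂ} (ha : a ≠ 0) : Function.Injective (mX a) := by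
  intro φ χ h
  rw [← mX_one φ, ← mX_one χ, ← inv_mul_cancel₀ ha, ← mX_mX, h, mX_mX]

lemma mZ_injective {a : RatFunc ℂ} (ha : a ≠ 0) : Function.Injective (mZ a) := by
  intro φ χ h
  rw [← mZ_one φ, ← mZ_one χ, ← inv_mul_cancel₀ ha, ← mZ_mZ, h, mZ_mZ]

lemma fun2_ext {N : Type*} [AddCommGroup N] [Module ℂ N] {f g : Fun2 →ₗ[ℂ] N}
    (h : ∀ a b, f (a ⊗ₜ[ℂ] b) = g (a ⊗ₜ[ℂ] b)) (φ : Fun2) : f φ = g φ :=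
  box_ext (A := ⊤) (B := ⊤) (fun a _ b _ => h a b) (mem_box_top φ)

/-- These are ∂_x and ∂_z conjugated by e^{xz}, so they commute although each involves both
variables. -/
lemma nX_nZ (φ : Fun2) : nX (nZ φ) = nZ (nX φ) := by
  refine fun2_ext (f := nX ∘ₗ nZ) (g := nZ ∘ₗ nX) (fun a b => ?_) φ
  simp only [LinearMap.comp_apply, nZ_tmul, nX_tmul, map_add, Derivation.leibniz, ratDeriv_X,
    smul_eq_mul, mul_one, TensorProduct.add_tmul, TensorProduct.tmul_add]
  abel

lemma mX_nZ (a : RatFunc ℂ) (φ : Fun2) : mX a (nZ φ) = nZ (mX a φ) := by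
  refine fun2_ext (f := mX a ∘ₗ nZ) (g := nZ ∘ₗ mX a) (fun b c => ?_) φ
  simp only [LinearMap.comp_apply, nZ_tmul, mX_tmul, map_add, mul_left_comm]

lemma mZ_nX (a : RatFunc ℂ) (φ : Fun2) : mZ a (nX φ) = nX (mZ a φ) := by
  refine fun2_ext (f := mZ a ∘ₗ nX) (g := nX ∘ₗ mZ a) (fun b c => ?_) φ
  simp only [LinearMap.comp_apply, nX_tmul, mZ_tmul, map_add, mul_left_comm]

lemma mX_mZ (a b : RatFunc ℂ) (φ : Fun2) : mX a (mZ b φ) = mZ b (mX a φ) := by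
  rw [mX_apply, mX_apply, mZ_apply, mZ_apply, mul_left_comm]

lemma nX_mX (a : RatFunc ℂ) (φ : Fun2) : nX (mX a φ) = mX a (nX φ) + mX (ratDeriv a) φ := by
  refine fun2_ext (f := nX ∘ₗ mX a) (g := mX a ∘ₗ nX + mX (ratDeriv a)) (fun b c => ?_) φ
  simp only [LinearMap.comp_apply, LinearMap.add_apply, nX_tmul, mX_tmul, map_add,
    Derivation.leibniz, smul_eq_mul, TensorProduct.add_tmul]
  rw [mul_comm (ratDeriv a) b]
  abel

lemma commute_pow {f g : Fun2 →ₗ[ℂ] Fun2} (h : ∀ φ, f (g φ) = g (f φ)) (n : ℕ) (φ : Fun2) :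
    f ((g ^ n) φ) = (g ^ n) (f φ) := by
  have : Commute f g := LinearMap.ext h
  exact LinearMap.congr_fun (this.pow_right n) φ

/-- The action of operators in `x`, as a bilinear map. -/
def aX : DiffOp →ₗ[ℂ] Fun2 →ₗ[ℂ] Fun2 :=
  Finsupp.lsum ℂ fun k => LinearMap.lcomp ℂ Fun2 (nX ^ k) ∘ₗ LinearMap.mul ℂ Fun2 ∘ₗ
    (TensorProduct.mk ℂ (RatFunc ℂ) (RatFunc ℂ)).flip 1

/-- The action of operators in `z`, as a bilinear map. -/
def aZ : DiffOp →ₗ[ℂ] Fun2 →ₗ[ℂ] Fun2 :=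
  Finsupp.lsum ℂ fun k => LinearMap.lcomp ℂ Fun2 (nZ ^ k) ∘ₗ LinearMap.mul ℂ Fun2 ∘ₗ
    TensorProduct.mk ℂ (RatFunc ℂ) (RatFunc ℂ) 1

lemma aX_apply (D : DiffOp) (φ : Fun2) : aX D φ = D.sum fun k a => mX a ((nX ^ k) φ) := by
  rw [aX, Finsupp.lsum_apply, Finsupp.sum, LinearMap.sum_apply]
  rfl

lemma aZ_apply (D : DiffOp) (φ : Fun2) : aZ D φ = D.sum fun k a => mZ a ((nZ ^ k) φ) := by
  rw [aZ, Finsupp.lsum_apply, Finsupp.sum, LinearMap.sum_apply]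
  rfl

lemma actX_eq (D : DiffOp) (φ : Fun2) : D.actX φ = aX D φ := by
  rw [aX_apply, DiffOp.actX]
  simp only [nablaX_iterate, mX_apply]

lemma actZ_eq (D : DiffOp) (φ : Fun2) : D.actZ φ = aZ D φ := by
  rw [aZ_apply, DiffOp.actZ]
  simp only [nablaZ_iterate, mZ_apply]

lemma aX_single (k : ℕ) (a : RatFunc ℂ) (φ : Fun2) :
    aX (Finsupp.single k a) φ = mX a ((nX ^ k) φ) := by
  rw [aX_apply, Finsupp.sum_single_index]
  rw [mX_apply, TensorProduct.zero_tmul, zero_mul]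

/-- Operators in `x` commute with every linear map that commutes with `∂_x` and with `ℂ(x)`. -/
lemma aX_commute {f : Fun2 →ₗ[ℂ] Fun2} (h1 : ∀ φ, f (nX φ) = nX (f φ))
    (h2 : ∀ a φ, f (mX a φ) = mX a (f φ)) (D : DiffOp) (φ : Fun2) :
    f (aX D φ) = aX D (f φ) := by
  rw [aX_apply, aX_apply, Finsupp.sum, Finsupp.sum, map_sum]
  refine Finset.sum_congr rfl fun k _ => ?_
  rw [h2, commute_pow h1]

lemma aZ_commute {f : Fun2 →ₗ[ℂ] Fun2} (h1 : ∀ φ, f (nZ φ) = nZ (f φ))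
    (h2 : ∀ a φ, f (mZ a φ) = mZ a (f φ)) (D : DiffOp) (φ : Fun2) :
    f (aZ D φ) = aZ D (f φ) := by
  rw [aZ_apply, aZ_apply, Finsupp.sum, Finsupp.sum, map_sum]
  refine Finset.sum_congr rfl fun k _ => ?_
  rw [h2, commute_pow h1]

lemma mZ_aX (b : RatFunc ℂ) (D : DiffOp) (φ : Fun2) : mZ b (aX D φ) = aX D (mZ b φ) :=
  aX_commute (mZ_nX b) (fun a φ => (mX_mZ a b φ).symm) D φ

lemma mX_aZ (a : RatFunc ℂ) (D : DiffOp) (φ : Fun2) : mX a (aZ D φ) = aZ D (mX a φ) :=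
  aZ_commute (mX_nZ a) (fun b φ => mX_mZ a b φ) D φ

/-- Operators in x act on ψ from one side and operators in z from the other; all exchanges of the
two actions below rest on this. -/
lemma aX_aZ (D E : DiffOp) (φ : Fun2) : aX D (aZ E φ) = aZ E (aX D φ) := by
  refine aZ_commute (fun φ => ?_) (fun b φ => ?_) E φ
  · exact (aX_commute (fun φ => (nX_nZ φ).symm) (fun a φ => (mX_nZ a φ).symm) D φ).symm
  · exact (mZ_aX b D φ).symm

/-! ### Exchange of the variables -/

/-- `swapXZ` as a linear map. -/
def sw : Fun2 ≃ₗ[ℂ] Fun2 := (Algebra.TensorProduct.comm ℂ (RatFunc ℂ) (RatFunc ℂ)).toLinearEquiv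

lemma sw_tmul (a b : RatFunc ℂ) : sw (a ⊗ₜ[ℂ] b) = b ⊗ₜ[ℂ] a := rfl

lemma sw_sw (φ : Fun2) : sw (sw φ) = φ :=
  fun2_ext (f := sw.toLinearMap ∘ₗ sw.toLinearMap) (g := LinearMap.id) (fun _ _ => rfl) φ

lemma sw_one : sw 1 = 1 := map_one (Algebra.TensorProduct.comm ℂ (RatFunc ℂ) (RatFunc ℂ))

lemma sw_nX (φ : Fun2) : sw (nX φ) = nZ (sw φ) := by
  refine fun2_ext (f := sw.toLinearMap ∘ₗ nX) (g := nZ ∘ₗ sw.toLinearMap) (fun a b => ?_) φ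
  simp [nX_tmul, nZ_tmul, sw_tmul]

lemma sw_mX (a : RatFunc ℂ) (φ : Fun2) : sw (mX a φ) = mZ a (sw φ) := by
  refine fun2_ext (f := sw.toLinearMap ∘ₗ mX a) (g := mZ a ∘ₗ sw.toLinearMap) (fun a b => ?_) φ
  simp [mX_tmul, mZ_tmul, sw_tmul]

lemma sw_mZ (a : RatFunc ℂ) (φ : Fun2) : sw (mZ a φ) = mX a (sw φ) := by
  rw [← sw_sw (mX a (sw φ)), sw_mX, sw_sw]

lemma sw_nX_pow (k : ℕ) (φ : Fun2) : sw ((nX ^ k) φ) = (nZ ^ k) (sw φ) := by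
  induction k generalizing φ with
  | zero => rfl
  | succ k ih => rw [pow_succ, pow_succ, Module.End.mul_apply, Module.End.mul_apply, ih, sw_nX]

lemma sw_aX (D : DiffOp) (φ : Fun2) : sw (aX D φ) = aZ D (sw φ) := by
  rw [aX_apply, aZ_apply, Finsupp.sum, Finsupp.sum, map_sum]
  refine Finset.sum_congr rfl fun k _ => ?_
  rw [sw_mX, sw_nX_pow]

lemma sw_aZ (D : DiffOp) (φ : Fun2) : sw (aZ D φ) = aX D (sw φ) := by
  rw [← sw_sw (aX D (sw φ)), sw_aX, sw_sw]

lemma sw_mem_box {A B : Submodule ℂ (RatFunc ℂ)} {φ : Fun2} :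
    sw φ ∈ box A B ↔ φ ∈ box B A := by
  have key : ∀ {A B : Submodule ℂ (RatFunc ℂ)} {φ : Fun2}, φ ∈ box B A → sw φ ∈ box A B :=
    fun h => box_map (f := sw.toLinearMap) (fun a ha b hb => tmul_mem_box hb ha) h
  exact ⟨fun h => sw_sw φ ▸ key h, key⟩

end

section

/-! ### Coefficients of the expansions at infinity -/

/-- The coefficient of `z ^ k` in the expansion of `φ(x, z)` at `z = ∞`. -/
def coefZ (k : ℕ) : Fun2 →ₗ[ℂ] RatFunc ℂ :=
  (TensorProduct.rid ℂ (RatFunc ℂ)).toLinearMap ∘ₗ LinearMap.lTensor (RatFunc ℂ) (coef k)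

/-- The coefficient of `x ^ k` in the expansion of `φ(x, z)` at `x = ∞`. -/
def coefX (k : ℕ) : Fun2 →ₗ[ℂ] RatFunc ℂ :=
  (TensorProduct.lid ℂ (RatFunc ℂ)).toLinearMap ∘ₗ LinearMap.rTensor (RatFunc ℂ) (coef k)

lemma coefZ_tmul (k : ℕ) (a b : RatFunc ℂ) : coefZ k (a ⊗ₜ[ℂ] b) = coef k b • a := by
  simp [coefZ]

lemma coefX_tmul (k : ℕ) (a b : RatFunc ℂ) : coefX k (a ⊗ₜ[ℂ] b) = coef k a • b := by
  simp [coefX]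

lemma coefZ_sw (k : ℕ) (φ : Fun2) : coefZ k (sw φ) = coefX k φ := by
  refine fun2_ext (f := coefZ k ∘ₗ sw.toLinearMap) (g := coefX k) (fun a b => ?_) φ
  rw [coefX_tmul, LinearMap.comp_apply, LinearEquiv.coe_coe, sw_tmul, coefZ_tmul]

lemma coefZ_mX (k : ℕ) (a : RatFunc ℂ) (φ : Fun2) : coefZ k (mX a φ) = a * coefZ k φ := by
  refine fun2_ext (f := coefZ k ∘ₗ mX a) (g := LinearMap.mulLeft ℂ a ∘ₗ coefZ k)
    (fun b c => ?_) φ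
  simp only [LinearMap.comp_apply, mX_tmul, coefZ_tmul, LinearMap.mulLeft_apply, mul_smul_comm]

lemma coefZ_mem {A : Submodule ℂ (RatFunc ℂ)} {k : ℕ} {φ : Fun2} (h : φ ∈ box A ⊤) :
    coefZ k φ ∈ A :=
  mem_box_top_iff.1 h (coef k)

lemma coefX_mem {A : Submodule ℂ (RatFunc ℂ)} {k : ℕ} {φ : Fun2} (h : φ ∈ box ⊤ A) :
    coefX k φ ∈ A := by
  rw [← coefZ_sw]
  exact coefZ_mem (sw_mem_box.2 h)

lemma coefZ_eq_zero {n k : ℕ} (h : n ≤ k) {φ : Fun2} (hφ : φ ∈ box ⊤ (F n)) : coefZ k φ = 0 := by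
  refine box_ext (f := coefZ k) (g := 0) (fun a _ b hb => ?_) hφ
  rw [coefZ_tmul, hb k h, zero_smul, LinearMap.zero_apply]

lemma sub_coefZ_mem {A : Submodule ℂ (RatFunc ℂ)} {n : ℕ} {φ : Fun2} (h : φ ∈ box A (F (n + 1))) :
    φ - coefZ n φ ⊗ₜ[ℂ] (RatFunc.X ^ n) ∈ box A (F n) := by
  refine box_map (f := LinearMap.id - (TensorProduct.mk ℂ _ _).flip (RatFunc.X ^ n) ∘ₗ coefZ n)
    (fun a ha b hb => ?_) h
  have e : a ⊗ₜ[ℂ] b - coefZ n (a ⊗ₜ[ℂ] b) ⊗ₜ[ℂ] (RatFunc.X ^ n) =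
      a ⊗ₜ[ℂ] (b - coef n b • RatFunc.X ^ n) := by
    rw [coefZ_tmul, TensorProduct.tmul_sub, TensorProduct.smul_tmul]
  change a ⊗ₜ[ℂ] b - coefZ n (a ⊗ₜ[ℂ] b) ⊗ₜ[ℂ] (RatFunc.X ^ n) ∈ _
  rw [e]
  exact tmul_mem_box ha (sub_coef_mem_F hb)

lemma exists_mem_box_F (φ : Fun2) : ∃ n, φ ∈ box ⊤ (F n) := by
  induction φ using TensorProduct.induction_on with
  | zero => exact ⟨0, zero_mem _⟩
  | tmul a b =>
    obtain ⟨n, hn⟩ := exists_mem_F b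
    exact ⟨n, tmul_mem_box Submodule.mem_top hn⟩
  | add a b ha hb =>
    obtain ⟨m, hm⟩ := ha
    obtain ⟨n, hn⟩ := hb
    exact ⟨max m n, add_mem (box_mono le_rfl (F_mono (le_max_left _ _)) hm)
      (box_mono le_rfl (F_mono (le_max_right _ _)) hn)⟩

lemma exists_forall_mem_box_F {r : ℕ} (φ : Fin r → Fun2) : ∃ n, ∀ j, φ j ∈ box ⊤ (F n) := by
  choose n hn using fun j => exists_mem_box_F (φ j)
  exact ⟨Finset.univ.sup n, fun j =>
    box_mono le_rfl (F_mono (Finset.le_sup (Finset.mem_univ j))) (hn j)⟩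

/-! ### Stability properties of the operators -/

lemma nX_mem {A A' B B' : Submodule ℂ (RatFunc ℂ)} (hA : A ≤ A') (hA' : ∀ a ∈ A, ratDeriv a ∈ A')
    (hB : B ≤ B') (hB' : ∀ b ∈ B, RatFunc.X * b ∈ B') {φ : Fun2} (h : φ ∈ box A B) :
    nX φ ∈ box A' B' := by
  refine box_map (fun a ha b hb => ?_) h
  rw [nX_tmul]
  exact add_mem (tmul_mem_box (hA' a ha) (hB hb)) (tmul_mem_box (hA ha) (hB' b hb))

lemma nX_pow_mem {A B : Submodule ℂ (RatFunc ℂ)} (hA' : ∀ a ∈ A, ratDeriv a ∈ A)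
    (hB' : ∀ b ∈ B, RatFunc.X * b ∈ B) {φ : Fun2} (h : φ ∈ box A B) (k : ℕ) :
    (nX ^ k) φ ∈ box A B := by
  induction k with
  | zero => exact h
  | succ k ih =>
    rw [pow_succ', Module.End.mul_apply]
    exact nX_mem le_rfl hA' le_rfl hB' ih

lemma nX_pow_mem_F {A : Submodule ℂ (RatFunc ℂ)} (hA' : ∀ a ∈ A, ratDeriv a ∈ A) {n : ℕ}
    {φ : Fun2} (h : φ ∈ box A (F n)) (k : ℕ) : (nX ^ k) φ ∈ box A (F (n + k)) := by
  induction k with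
  | zero => exact h
  | succ k ih =>
    rw [pow_succ', Module.End.mul_apply]
    exact nX_mem le_rfl hA' (F_mono (Nat.le_succ _)) (fun b hb => X_mul_mem_F hb) ih

lemma mX_mem {A A' B : Submodule ℂ (RatFunc ℂ)} {a : RatFunc ℂ} (ha : ∀ b ∈ A, a * b ∈ A')
    {φ : Fun2} (h : φ ∈ box A B) : mX a φ ∈ box A' B := by
  refine box_map (fun b hb c hc => ?_) h
  rw [mX_tmul]
  exact tmul_mem_box (ha b hb) hc

lemma aX_mem {A B : Submodule ℂ (RatFunc ℂ)} (hA' : ∀ a ∈ A, ratDeriv a ∈ A)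
    (hB' : ∀ b ∈ B, RatFunc.X * b ∈ B) {D : DiffOp} (hD : ∀ k, ∀ a ∈ A, D k * a ∈ A) {φ : Fun2}
    (h : φ ∈ box A B) : aX D φ ∈ box A B := by
  rw [aX_apply]
  exact Submodule.sum_mem _ fun k _ => mX_mem (hD k) (nX_pow_mem hA' hB' h k)

lemma X_mul_mem_Pol {b : RatFunc ℂ} (hb : b ∈ Pol) : RatFunc.X * b ∈ Pol :=
  Pol_mul (toK_X ▸ toK_mem_Pol _) hb

lemma aX_mem_Pol (D : DiffOp) {φ : Fun2} (h : φ ∈ box ⊤ Pol) : aX D φ ∈ box ⊤ Pol :=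
  aX_mem (fun _ _ => Submodule.mem_top) (fun _ hb => X_mul_mem_Pol hb) (fun _ _ _ => Submodule.mem_top) h

lemma aZ_mem_Pol (D : DiffOp) {φ : Fun2} (h : φ ∈ box Pol ⊤) : aZ D φ ∈ box Pol ⊤ := by
  rw [← sw_mem_box, sw_aZ]
  exact aX_mem_Pol D (sw_mem_box.2 h)

lemma coefZ_nX {n : ℕ} {φ : Fun2} (h : φ ∈ box ⊤ (F (n + 1))) :
    coefZ (n + 1) (nX φ) = coefZ n φ := by
  refine box_ext (f := coefZ (n + 1) ∘ₗ nX) (fun a _ b hb => ?_) h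
  rw [LinearMap.comp_apply, nX_tmul, map_add, coefZ_tmul, coefZ_tmul, coefZ_tmul, coef_X_mul,
    hb (n + 1) le_rfl, zero_smul, zero_add]

lemma coefZ_nX_pow {n : ℕ} {φ : Fun2} (h : φ ∈ box ⊤ (F (n + 1))) (k : ℕ) :
    coefZ (n + k) ((nX ^ k) φ) = coefZ n φ := by
  induction k with
  | zero => rfl
  | succ k ih =>
    rw [pow_succ', Module.End.mul_apply, ← add_assoc, coefZ_nX, ih]
    have := nX_pow_mem_F (fun _ _ => Submodule.mem_top) h k
    rwa [Nat.add_right_comm] at this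

lemma aX_eq_sum_range {D : DiffOp} {m : ℕ} (hD : ∀ k, m < k → D k = 0) (φ : Fun2) :
    aX D φ = ∑ k ∈ Finset.range (m + 1), mX (D k) ((nX ^ k) φ) := by
  rw [aX_apply]
  refine Finsupp.sum_of_support_subset _ (fun k hk => ?_) _ fun k _ => ?_
  · rw [Finset.mem_range, Nat.lt_succ_iff]
    by_contra h
    exact Finsupp.mem_support_iff.1 hk (hD k (not_le.1 h))
  · rw [mX_apply, TensorProduct.zero_tmul, zero_mul]

/-- The leading term of `D.φ` in `z`. -/
lemma aX_lead {D : DiffOp} {m : ℕ} (hD : ∀ k, m < k → D k = 0) {n : ℕ} {φ : Fun2}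
    (h : φ ∈ box ⊤ (F (n + 1))) :
    aX D φ ∈ box ⊤ (F (n + m + 1)) ∧ coefZ (n + m) (aX D φ) = D m * coefZ n φ := by
  have h1 : ∀ k, (nX ^ k) φ ∈ box ⊤ (F (n + 1 + k)) := nX_pow_mem_F (fun _ _ => Submodule.mem_top) h
  rw [aX_eq_sum_range hD]
  constructor
  · refine Submodule.sum_mem _ fun k hk => mX_mem (fun _ _ => Submodule.mem_top)
      (box_mono le_rfl (F_mono ?_) (h1 k))
    rw [Finset.mem_range] at hk
    omega
  · rw [map_sum, Finset.sum_eq_single_of_mem m (Finset.self_mem_range_succ m), coefZ_mX,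
      coefZ_nX_pow h]
    intro k hk hkm
    rw [Finset.mem_range] at hk
    rw [coefZ_mX, coefZ_eq_zero (n := n + 1 + k) (by omega) (h1 k), mul_zero]

lemma aZ_lead {D : DiffOp} {m : ℕ} (hD : ∀ k, m < k → D k = 0) {n : ℕ} {φ : Fun2}
    (h : φ ∈ box (F (n + 1)) ⊤) :
    aZ D φ ∈ box (F (n + m + 1)) ⊤ ∧ coefX (n + m) (aZ D φ) = D m * coefX n φ := by
  have := aX_lead hD (sw_mem_box.2 h)
  rwa [← sw_aZ, sw_mem_box, coefZ_sw, coefZ_sw] at this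

lemma nX_pow_one (n : ℕ) : (nX ^ n) (1 : Fun2) = (1 : RatFunc ℂ) ⊗ₜ[ℂ] (RatFunc.X ^ n) := by
  induction n with
  | zero => rfl
  | succ n ih =>
    rw [pow_succ', Module.End.mul_apply, ih, nX_tmul, Derivation.map_one_eq_zero,
      TensorProduct.zero_tmul, zero_add, pow_succ']

/-! ### Division -/

/-- The action of a row of operators in `x` on a matrix. -/
def rowOp {r m : ℕ} (Ξ : Fin r → DiffOp) (ψ : Matrix (Fin r) (Fin m) Fun2) : Fin m → Fun2 :=
  fun j => ∑ i, aX (Ξ i) (ψ i j)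

lemma leftAct_apply {l m n : ℕ} (Θ : Matrix (Fin l) (Fin m) DiffOp)
    (ψ : Matrix (Fin m) (Fin n) Fun2) (i : Fin l) : leftAct Θ ψ i = rowOp (Θ i) ψ := by
  funext j
  simp only [leftAct, Matrix.of_apply, rowOp, actX_eq]

lemma rowOp_add {r m : ℕ} (Ξ Ξ' : Fin r → DiffOp) (ψ : Matrix (Fin r) (Fin m) Fun2) :
    rowOp (Ξ + Ξ') ψ = rowOp Ξ ψ + rowOp Ξ' ψ := by
  funext j
  simp [rowOp, Finset.sum_add_distrib]

lemma rowOp_sub {r m : ℕ} (Ξ Ξ' : Fin r → DiffOp) (ψ : Matrix (Fin r) (Fin m) Fun2) :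
    rowOp (Ξ - Ξ') ψ = rowOp Ξ ψ - rowOp Ξ' ψ := by
  funext j
  simp [rowOp, Finset.sum_sub_distrib]

/-- Row vectors of operators are divisible with remainder by a matrix `ψ = 1 + O(z⁻¹)`. -/
lemma exists_division {r : ℕ} (R : Subalgebra ℂ (RatFunc ℂ)) (hR : ∀ a ∈ R, ratDeriv a ∈ R)
    {ψ : Matrix (Fin r) (Fin r) Fun2} (hψ : ∀ i j, (ψ - 1) i j ∈ box R.toSubmodule Pr) (n : ℕ)
    (φ : Fin r → Fun2) (hφ : ∀ j, φ j ∈ box R.toSubmodule (F n)) :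
    ∃ Ξ : Fin r → DiffOp, (∀ i k, Ξ i k ∈ R) ∧
      ∀ j, φ j - rowOp Ξ ψ j ∈ box R.toSubmodule Pr := by
  induction n generalizing φ with
  | zero =>
    refine ⟨0, fun i k => R.zero_mem, fun j => ?_⟩
    rw [F_zero] at hφ
    simpa [rowOp] using hφ j
  | succ n ih =>
    have hc : ∀ j, coefZ n (φ j) ∈ R := fun j => coefZ_mem (box_mono le_rfl le_top (hφ j))
    -- ∂_x^n contributes z^n, so applying these monomials to ψ = 1 + O(1/z) reproduces the z^n-terms
    -- of φ; the contribution of ψ - 1 has degree below n in z.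
    set Ξ₀ : Fin r → DiffOp := fun i => Finsupp.single n (coefZ n (φ i)) with hΞ₀
    have h1 : ∀ j, φ j - rowOp Ξ₀ ψ j ∈ box R.toSubmodule (F n) := by
      intro j
      have e : rowOp Ξ₀ ψ j = coefZ n (φ j) ⊗ₜ[ℂ] (RatFunc.X ^ n) +
          ∑ i, mX (coefZ n (φ i)) ((nX ^ n) ((ψ - 1) i j)) := by
        have h2 : ∀ i, aX (Ξ₀ i) (ψ i j) = mX (coefZ n (φ i)) ((nX ^ n) ((ψ - 1) i j)) +
            if i = j then coefZ n (φ j) ⊗ₜ[ℂ] (RatFunc.X ^ n) else 0 := by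
          intro i
          rw [hΞ₀, aX_single, Matrix.sub_apply, map_sub, map_sub]
          rcases eq_or_ne i j with rfl | hij
          · rw [if_pos rfl, Matrix.one_apply_eq, nX_pow_one, mX_tmul, mul_one, sub_add_cancel]
          · rw [if_neg hij, Matrix.one_apply_ne hij, map_zero, map_zero, sub_zero, add_zero]
        rw [rowOp, Finset.sum_congr rfl fun i _ => h2 i, Finset.sum_add_distrib,
          Finset.sum_ite_eq', if_pos (Finset.mem_univ j), add_comm]
      rw [e, ← sub_sub]
      refine sub_mem (sub_coefZ_mem (hφ j)) (Submodule.sum_mem _ fun i _ => ?_)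
      refine mX_mem (A := R.toSubmodule) (fun b hb => R.mul_mem (hc i) hb) ?_
      have := nX_pow_mem_F hR (n := 0) (by rw [F_zero]; exact hψ i j) n
      rwa [Nat.zero_add] at this
    obtain ⟨Ξ, hΞ, h⟩ := ih _ h1
    refine ⟨Ξ₀ + Ξ, fun i k => R.add_mem ?_ (hΞ i k), fun j => ?_⟩
    · rw [hΞ₀, Finsupp.single_apply]
      split_ifs
      · exact hc i
      · exact R.zero_mem
    · have := h j
      rwa [sub_sub, ← Pi.add_apply, ← rowOp_add] at this

/-- Only the diagonal 1 of ψ and the top derivative reach degree m in z. Hence Ξ can be read off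
from Ξ.ψ, from the top order down. -/
lemma coefZ_rowOp {r m : ℕ} {ψ : Matrix (Fin r) (Fin r) Fun2}
    (hψ : ∀ i j, (ψ - 1) i j ∈ box ⊤ Pr) {Ξ : Fin r → DiffOp}
    (hΞ : ∀ i k, m < k → Ξ i k = 0) (j : Fin r) : coefZ m (rowOp Ξ ψ j) = Ξ j m := by
  have h1 : ∀ i, ψ i j = (1 : Matrix (Fin r) (Fin r) Fun2) i j + (ψ - 1) i j := fun i => by
    rw [Matrix.sub_apply, add_sub_cancel]
  have h2 : ∀ i, (1 : Matrix (Fin r) (Fin r) Fun2) i j ∈ box ⊤ (F 1) := by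
    intro i
    rw [Matrix.one_apply]
    split_ifs
    · exact tmul_mem_box Submodule.mem_top (by simpa using X_pow_mem_F 0)
    · exact zero_mem _
  have h3 : ∀ i, coefZ 0 (ψ i j) = if i = j then 1 else 0 := by
    intro i
    have h0 : coefZ 0 ((ψ - 1) i j) = 0 := coefZ_eq_zero le_rfl (F_zero ▸ hψ i j)
    rw [h1, map_add, h0, add_zero, Matrix.one_apply]
    split_ifs
    · rw [Algebra.TensorProduct.one_def, coefZ_tmul]
      have := coef_X_pow 0 0
      rw [pow_zero] at this
      rw [this, if_pos rfl, one_smul]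
    · exact map_zero _
  have h4 : ∀ i, ψ i j ∈ box ⊤ (F (0 + 1)) := fun i => by
    rw [h1]
    exact add_mem (h2 i) (box_mono le_rfl (Pr_le_F 1) (hψ i j))
  have h5 : ∀ i, coefZ m (aX (Ξ i) (ψ i j)) = if i = j then Ξ j m else 0 := by
    intro i
    have := (aX_lead (hΞ i) (h4 i)).2
    rw [Nat.zero_add] at this
    rw [this, h3]
    split_ifs with h
    · rw [mul_one, h]
    · rw [mul_zero]
  rw [rowOp, map_sum, Finset.sum_congr rfl fun i _ => h5 i, Finset.sum_ite_eq',
    if_pos (Finset.mem_univ j)]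

lemma exists_order_bound {r : ℕ} (Ξ : Fin r → DiffOp) : ∃ m, ∀ i k, m ≤ k → Ξ i k = 0 := by
  refine ⟨Finset.univ.sup fun i => (Ξ i).support.sup id + 1, fun i k hk => ?_⟩
  by_contra h
  have h1 := Finset.le_sup (f := id) (Finsupp.mem_support_iff.2 h)
  have h2 := Finset.le_sup (f := fun i => (Ξ i).support.sup id + 1) (Finset.mem_univ i)
  simp only [id] at h1 h2
  omega

/-- A property of the coefficients of `Ξ` that is verified from the top down. -/
lemma order_lt_of_forall {r n : ℕ} {Ξ : Fin r → DiffOp}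
    (h : ∀ m, n ≤ m → (∀ i k, m < k → Ξ i k = 0) → ∀ i, Ξ i m = 0) (i : Fin r) (k : ℕ)
    (hk : n ≤ k) : Ξ i k = 0 := by
  obtain ⟨N, hN⟩ := exists_order_bound Ξ
  -- Downward induction on m starting from the order bound N; d is the number of steps still
  -- available below N.
  have key : ∀ d m, n ≤ m → N ≤ m + d → ∀ i k, m ≤ k → Ξ i k = 0 := by
    intro d
    induction d with
    | zero => exact fun m _ hm i k hk => hN i k (by omega)
    | succ d ih =>
      intro m hm hmd i k hk
      have h1 := ih (m + 1) (by omega) (by omega)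
      rcases eq_or_lt_of_le hk with rfl | hk
      · exact h m hm (fun i k hk => h1 i k hk) i
      · exact h1 i k hk
  exact key N k hk (by omega) i k le_rfl

/-- The order of `Ξ` is at most the degree of `Ξ.ψ` in `z`, when `ψ = 1 + O(z⁻¹)`. -/
lemma order_lt_of_rowOp_mem {r n : ℕ} {ψ : Matrix (Fin r) (Fin r) Fun2}
    (hψ : ∀ i j, (ψ - 1) i j ∈ box ⊤ Pr) {Ξ : Fin r → DiffOp}
    (h : ∀ j, rowOp Ξ ψ j ∈ box ⊤ (F n)) (i : Fin r) (k : ℕ) (hk : n ≤ k) : Ξ i k = 0 := by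
  refine order_lt_of_forall (fun m hm h1 j => ?_) i k hk
  rw [← coefZ_rowOp hψ h1 j]
  exact coefZ_eq_zero hm (h j)

lemma eq_zero_of_rowOp_mem {r : ℕ} {ψ : Matrix (Fin r) (Fin r) Fun2}
    (hψ : ∀ i j, (ψ - 1) i j ∈ box ⊤ Pr) {Ξ : Fin r → DiffOp}
    (h : ∀ j, rowOp Ξ ψ j ∈ box ⊤ Pr) : Ξ = 0 := by
  funext i
  ext k
  exact order_lt_of_rowOp_mem hψ (by rwa [F_zero]) i k (Nat.zero_le k)

end

section

/-! ### Operators and their symbols -/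

/-- The derivation of `ℂ(z)` as an endomorphism. -/
abbrev dK : Module.End ℂ (RatFunc ℂ) := ratDeriv.toLinearMap

lemma dK_pow (k : ℕ) (f : RatFunc ℂ) : (dK ^ k) f = ratDeriv^[k] f := by
  rw [Module.End.coe_pow]
  rfl

/-- The action of operators on `ℂ(z)`, as a bilinear map. -/
def aK : DiffOp →ₗ[ℂ] RatFunc ℂ →ₗ[ℂ] RatFunc ℂ :=
  Finsupp.lsum ℂ fun k => LinearMap.lcomp ℂ (RatFunc ℂ) (dK ^ k) ∘ₗ LinearMap.mul ℂ (RatFunc ℂ)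

lemma aK_apply (D : DiffOp) (f : RatFunc ℂ) : aK D f = D.sum fun k a => a * (dK ^ k) f := by
  rw [aK, Finsupp.lsum_apply, Finsupp.sum, LinearMap.sum_apply]
  rfl

lemma act_eq (D : DiffOp) (f : RatFunc ℂ) : D.act f = aK D f := by
  rw [aK_apply, DiffOp.act]
  simp only [dK_pow]

lemma aK_single (k : ℕ) (a f : RatFunc ℂ) : aK (Finsupp.single k a) f = a * (dK ^ k) f := by
  rw [aK_apply, Finsupp.sum_single_index (zero_mul _)]

/-- The symbol `∑ k, a k (z) x ^ k` of an operator. -/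
def sym : DiffOp →ₗ[ℂ] Fun2 :=
  Finsupp.lsum ℂ fun k => TensorProduct.mk ℂ (RatFunc ℂ) (RatFunc ℂ) (RatFunc.X ^ k)

lemma sym_apply (D : DiffOp) : sym D = D.sum fun k b => (RatFunc.X ^ k) ⊗ₜ[ℂ] b := rfl

lemma sym_single (k : ℕ) (b : RatFunc ℂ) :
    sym (Finsupp.single k b) = (RatFunc.X ^ k) ⊗ₜ[ℂ] b := by
  rw [sym_apply, Finsupp.sum_single_index]
  exact TensorProduct.tmul_zero _ _

/-- Linear maps on the space of operators are determined by their values on monomials. -/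
lemma op_ext {N : Type*} [AddCommGroup N] [Module ℂ N] {f g : DiffOp →ₗ[ℂ] N}
    (h : ∀ k a, f (Finsupp.single k a) = g (Finsupp.single k a)) (D : DiffOp) : f D = g D :=
  LinearMap.congr_fun (Finsupp.lhom_ext h) D

lemma coefX_sym (k : ℕ) (D : DiffOp) : coefX k (sym D) = D k := by
  refine op_ext (f := coefX k ∘ₗ sym) (g := Finsupp.lapply k) (fun n a => ?_) D
  rw [LinearMap.comp_apply, sym_single, coefX_tmul, coef_X_pow, Finsupp.lapply_apply,
    Finsupp.single_apply]
  rcases eq_or_ne k n with rfl | h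
  · simp
  · simp [h, h.symm]

lemma sym_injective : Function.Injective sym := by
  intro D E h
  ext k
  rw [← coefX_sym, h, coefX_sym]

lemma sym_mem {A : Submodule ℂ (RatFunc ℂ)} {D : DiffOp} (h : ∀ k, D k ∈ A) :
    sym D ∈ box Pol A :=
  Submodule.sum_mem _ fun k _ => tmul_mem_box (X_pow_mem_Pol k) (h k)

lemma exists_sym_eq {φ : Fun2} (h : φ ∈ box Pol ⊤) : ∃ D, sym D = φ := by
  refine (box_le (P := LinearMap.range sym)).2 ?_ h
  rintro _ ⟨p, rfl⟩ b -
  refine ⟨p.sum fun k c => Finsupp.single k (c • b), ?_⟩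
  nth_rewrite 2 [p.as_sum_support_C_mul_X_pow]
  rw [Polynomial.sum, map_sum, toK, map_sum, TensorProduct.sum_tmul]
  refine Finset.sum_congr rfl fun k _ => ?_
  rw [sym_single, map_mul, ← toK, toK_C, map_pow, RatFunc.algebraMap_X, ← Algebra.smul_def,
    TensorProduct.smul_tmul]

/-- Composition with `∂` on the left. -/
def del : Module.End ℂ DiffOp :=
  Finsupp.lsum ℂ fun k => Finsupp.lsingle k ∘ₗ dK + Finsupp.lsingle (k + 1)

lemma del_single (k : ℕ) (a : RatFunc ℂ) :
    del (Finsupp.single k a) = Finsupp.single k (ratDeriv a) + Finsupp.single (k + 1) a := by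
  simp [del]

lemma aK_del (D : DiffOp) (f : RatFunc ℂ) : aK (del D) f = ratDeriv (aK D f) := by
  refine op_ext (f := aK.flip f ∘ₗ del) (g := dK ∘ₗ aK.flip f) (fun k a => ?_) D
  simp only [LinearMap.comp_apply, LinearMap.flip_apply, del_single, map_add, aK_single,
    Derivation.coeFn_coe, Derivation.leibniz, smul_eq_mul, pow_succ', Module.End.mul_apply]
  ring

/-- The symbol is the factor in D.e^{xz} = (sym D)e^{xz}. Composition on the left therefore acts on
symbols by operators in z, and composition on the right (`sym_shift`, `sym_mulZ`) by operators in x.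
-/
lemma sym_del (D : DiffOp) : sym (del D) = nZ (sym D) := by
  refine op_ext (f := sym ∘ₗ del) (g := nZ ∘ₗ sym) (fun k a => ?_) D
  simp only [LinearMap.comp_apply, del_single, map_add, sym_single, nZ_tmul, pow_succ']

lemma aK_smul (a : RatFunc ℂ) (D : DiffOp) (f : RatFunc ℂ) : aK (a • D) f = a * aK D f := by
  rw [aK_apply, aK_apply, Finsupp.sum_smul_index (fun _ => zero_mul _), Finsupp.mul_sum]
  simp only [mul_assoc]

lemma sym_smul (a : RatFunc ℂ) (D : DiffOp) : sym (a • D) = mZ a (sym D) := by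
  rw [sym_apply, sym_apply, Finsupp.sum_smul_index (fun _ => TensorProduct.tmul_zero _ _),
    Finsupp.sum, Finsupp.sum, map_sum]
  simp only [mZ_tmul]

/-- The product of two operators. -/
def comp (D T : DiffOp) : DiffOp := D.sum fun k a => a • (del ^ k) T

lemma aK_comp (D T : DiffOp) (f : RatFunc ℂ) : aK (comp D T) f = aK D (aK T f) := by
  have h : ∀ k, aK ((del ^ k) T) f = (dK ^ k) (aK T f) := by
    intro k
    induction k with
    | zero => rfl
    | succ k ih =>
      rw [pow_succ', Module.End.mul_apply, aK_del, ih, pow_succ', Module.End.mul_apply]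
      rfl
  rw [comp, aK_apply D, Finsupp.sum, map_sum, LinearMap.sum_apply, Finsupp.sum]
  simp only [aK_smul, h]

lemma sym_comp (D T : DiffOp) : sym (comp D T) = aZ D (sym T) := by
  have h : ∀ k, sym ((del ^ k) T) = (nZ ^ k) (sym T) := by
    intro k
    induction k with
    | zero => rfl
    | succ k ih =>
      rw [pow_succ', Module.End.mul_apply, sym_del, ih, pow_succ', Module.End.mul_apply]
  rw [comp, aZ_apply, Finsupp.sum, map_sum, Finsupp.sum]
  simp only [sym_smul, h]

/-- Composition with `∂` on the right. -/
def shift : Module.End ℂ DiffOp := Finsupp.lsum ℂ fun k => Finsupp.lsingle (k + 1)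

lemma shift_single (k : ℕ) (a : RatFunc ℂ) :
    shift (Finsupp.single k a) = Finsupp.single (k + 1) a := by
  simp [shift]

lemma aK_shift (D : DiffOp) (f : RatFunc ℂ) : aK (shift D) f = aK D (ratDeriv f) := by
  refine op_ext (f := aK.flip f ∘ₗ shift) (g := aK.flip (ratDeriv f)) (fun k a => ?_) D
  simp only [LinearMap.comp_apply, LinearMap.flip_apply, shift_single, aK_single, pow_succ,
    Module.End.mul_apply]
  rfl

lemma sym_shift (D : DiffOp) : sym (shift D) = mX RatFunc.X (sym D) := by
  refine op_ext (f := sym ∘ₗ shift) (g := mX RatFunc.X ∘ₗ sym) (fun k a => ?_) D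
  simp only [LinearMap.comp_apply, shift_single, sym_single, mX_tmul, pow_succ']

lemma shift_succ (D : DiffOp) (k : ℕ) : shift D (k + 1) = D k := by
  refine op_ext (f := Finsupp.lapply (k + 1) ∘ₗ shift) (g := Finsupp.lapply k) (fun n a => ?_) D
  simp [shift_single, Finsupp.single_apply]

lemma shift_pow_apply (n : ℕ) (D : DiffOp) (k : ℕ) : (shift ^ n) D (k + n) = D k := by
  induction n with
  | zero => rfl
  | succ n ih => rw [pow_succ', Module.End.mul_apply, ← add_assoc, shift_succ, ih]

lemma aeval_apply_comp {M N : Type*} [AddCommGroup M] [Module ℂ M] [AddCommGroup N] [Module ℂ N]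
    {f : Module.End ℂ M} {g : Module.End ℂ N} {h : M →ₗ[ℂ] N} (H : ∀ m, h (f m) = g (h m))
    (θ : ℂ[X]) (m : M) : h (Polynomial.aeval f θ m) = Polynomial.aeval g θ (h m) := by
  induction θ using Polynomial.induction_on' with
  | add p q hp hq => rw [map_add, map_add, LinearMap.add_apply, map_add, hp, hq,
      LinearMap.add_apply]
  | monomial n c =>
    have : ∀ n, h ((f ^ n) m) = (g ^ n) (h m) := by
      intro n
      induction n with
      | zero => rfl
      | succ n ih => rw [pow_succ', Module.End.mul_apply, H, ih, pow_succ', Module.End.mul_apply]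
    rw [Polynomial.aeval_monomial, Polynomial.aeval_monomial, Module.End.mul_apply,
      Module.End.mul_apply, Module.algebraMap_end_apply, Module.algebraMap_end_apply, map_smul,
      this]

lemma aeval_mX (θ : ℂ[X]) (φ : Fun2) : Polynomial.aeval (mX RatFunc.X) θ φ = mX (toK θ) φ := by
  induction θ using Polynomial.induction_on' with
  | add p q hp hq =>
    rw [map_add, LinearMap.add_apply, hp, hq, toK, toK, toK, map_add, mX_apply, mX_apply, mX_apply,
      TensorProduct.add_tmul, add_mul]
  | monomial n c =>
    have : ∀ n, ((mX RatFunc.X) ^ n) φ = mX (RatFunc.X ^ n) φ := by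
      intro n
      induction n with
      | zero => rw [pow_zero, pow_zero, mX_one, Module.End.one_apply]
      | succ n ih => rw [pow_succ', Module.End.mul_apply, ih, mX_mX, pow_succ']
    rw [Polynomial.aeval_monomial, Module.End.mul_apply, this, Module.algebraMap_end_apply,
      ← Polynomial.C_mul_X_pow_eq_monomial, toK, map_mul, map_pow, RatFunc.algebraMap_X, ← toK,
      toK_C, ← Algebra.smul_def, mX_apply, mX_apply, ← smul_mul_assoc,
      TensorProduct.smul_tmul']

/-- Composition with `θ(∂)` on the right. -/
def shiftPoly (θ : ℂ[X]) : Module.End ℂ DiffOp := Polynomial.aeval shift θ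

lemma sym_shiftPoly (θ : ℂ[X]) (D : DiffOp) : sym (shiftPoly θ D) = mX (toK θ) (sym D) := by
  rw [← aeval_mX, shiftPoly]
  exact aeval_apply_comp sym_shift θ D

lemma aK_shiftPoly (θ : ℂ[X]) (D : DiffOp) (p : ℂ[X]) :
    aK (shiftPoly θ D) (toK p) = aK D (toK (Polynomial.aeval Polynomial.derivative θ p)) := by
  induction θ using Polynomial.induction_on' generalizing p with
  | add a b ha hb =>
    have h : ∀ p q : ℂ[X], toK (p + q) = toK p + toK q := fun p q => map_add _ _ _
    rw [shiftPoly, map_add, LinearMap.add_apply, map_add, LinearMap.add_apply, map_add,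
      LinearMap.add_apply, h, map_add]
    exact congrArg₂ _ (ha p) (hb p)
  | monomial n c =>
    have : ∀ n p, aK ((shift ^ n) D) (toK p) = aK D (toK ((Polynomial.derivative ^ n) p)) := by
      intro n
      induction n with
      | zero => exact fun _ => rfl
      | succ n ih =>
        intro p
        rw [pow_succ', Module.End.mul_apply, aK_shift, ratDeriv_toK, ih, pow_succ,
          Module.End.mul_apply]
    rw [shiftPoly, Polynomial.aeval_monomial, Polynomial.aeval_monomial, Module.End.mul_apply,
      Module.End.mul_apply, Module.algebraMap_end_apply, Module.algebraMap_end_apply, map_smul,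
      LinearMap.smul_apply, this, toK_smul, map_smul]

/-- Composition with `z` on the right. -/
def mulZ : Module.End ℂ DiffOp :=
  Finsupp.lsum ℂ fun k => Finsupp.lsingle k ∘ₗ LinearMap.mulLeft ℂ (RatFunc.X : RatFunc ℂ) +
    -- From ∂^k z = z ∂^k + k ∂^(k-1); for k = 0 the truncated index is cancelled by the factor k.
    (k : ℂ) • Finsupp.lsingle (k - 1)

lemma mulZ_single (k : ℕ) (a : RatFunc ℂ) : mulZ (Finsupp.single k a) =
    Finsupp.single k (RatFunc.X * a) + (k : ℂ) • Finsupp.single (k - 1) a := by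
  simp [mulZ]

lemma dK_pow_X_mul (k : ℕ) (f : RatFunc ℂ) :
    (dK ^ k) (RatFunc.X * f) = RatFunc.X * (dK ^ k) f + (k : ℂ) • (dK ^ (k - 1)) f := by
  induction k with
  | zero => simp
  | succ k ih =>
    rw [pow_succ', Module.End.mul_apply, ih, map_add, map_smul]
    have h1 : ∀ g, dK (RatFunc.X * g) = RatFunc.X * dK g + g := by
      intro g
      change ratDeriv _ = _ * ratDeriv g + _
      rw [Derivation.leibniz, ratDeriv_X, smul_eq_mul, smul_eq_mul, mul_one]
    rw [h1, Nat.add_sub_cancel, Module.End.mul_apply]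
    rcases k with _ | k
    · simp
    · rw [Nat.add_sub_cancel, pow_succ' _ k, Module.End.mul_apply, Nat.cast_succ (k + 1), add_smul,
        one_smul]
      abel

lemma aK_mulZ (D : DiffOp) (f : RatFunc ℂ) : aK (mulZ D) f = aK D (RatFunc.X * f) := by
  refine op_ext (f := aK.flip f ∘ₗ mulZ) (g := aK.flip (RatFunc.X * f)) (fun k a => ?_) D
  simp only [LinearMap.comp_apply, LinearMap.flip_apply, mulZ_single, map_add, map_smul,
    aK_single, dK_pow_X_mul, mul_add, mul_smul_comm]
  ring

lemma sym_mulZ (D : DiffOp) : sym (mulZ D) = nX (sym D) := by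
  refine op_ext (f := sym ∘ₗ mulZ) (g := nX ∘ₗ sym) (fun k a => ?_) D
  simp only [LinearMap.comp_apply, mulZ_single, map_add, map_smul, sym_single, nX_tmul,
    Derivation.leibniz_pow, ratDeriv_X, smul_eq_mul, mul_one]
  rw [add_comm, TensorProduct.smul_tmul', ← Nat.cast_smul_eq_nsmul ℂ]

lemma mulZ_lead {D : DiffOp} {m : ℕ} (hD : ∀ k, m < k → D k = 0) :
    (∀ k, m < k → mulZ D k = 0) ∧ mulZ D m = RatFunc.X * D m := by
  have h : ∀ k, mulZ D k = RatFunc.X * D k + ((k + 1 : ℕ) : ℂ) • D (k + 1) := by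
    intro k
    refine op_ext (f := Finsupp.lapply k ∘ₗ mulZ) (g := LinearMap.mulLeft ℂ (RatFunc.X : RatFunc ℂ) ∘ₗ
      Finsupp.lapply k + ((k + 1 : ℕ) : ℂ) • Finsupp.lapply (k + 1)) (fun n a => ?_) D
    simp only [LinearMap.comp_apply, LinearMap.add_apply, LinearMap.smul_apply, mulZ_single,
      Finsupp.lapply_apply, Finsupp.add_apply, Finsupp.smul_apply, LinearMap.mulLeft_apply,
      Finsupp.single_apply, mul_ite, mul_zero]
    congr 1
    rcases n with _ | n
    · rw [if_neg (Nat.succ_ne_zero k).symm, Nat.cast_zero, zero_smul, smul_zero]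
    · rw [Nat.add_sub_cancel]
      by_cases h : n = k
      · rw [h]
        simp
      · rw [if_neg h, if_neg (by omega), smul_zero, smul_zero]
  constructor
  · intro k hk
    rw [h, hD k hk, hD (k + 1) (by omega), mul_zero, smul_zero, add_zero]
  · rw [h, hD (m + 1) (by omega), smul_zero, add_zero]

end

section

/-! ### Membership of functions `φ e ^ {x z}` in a subspace -/

lemma aK_toK_X_pow (D : DiffOp) (m : ℕ) :
    aK D (toK (Polynomial.X ^ m)) = (m.factorial : ℂ) • ∑ k ∈ Finset.range (m + 1),
      D k * (RatFunc.X ^ (m - k) / ((m - k).factorial : RatFunc ℂ)) := by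
  have h0 : ∀ k, (dK ^ k) (toK (Polynomial.X ^ m)) =
      (Nat.descFactorial m k : ℂ) • RatFunc.X ^ (m - k) := by
    intro k
    rw [dK_pow, iterate_ratDeriv_toK, Polynomial.iterate_derivative_X_pow_eq_smul, toK_smul, toK,
      map_pow, RatFunc.algebraMap_X]
  have h1 : aK D (toK (Polynomial.X ^ m)) = ∑ k ∈ Finset.range (m + 1),
      D k * (dK ^ k) (toK (Polynomial.X ^ m)) := by
    rw [aK_apply, Finsupp.sum]
    have h2 : ∀ k, k ∉ Finset.range (m + 1) → D k * (dK ^ k) (toK (Polynomial.X ^ m)) = 0 := by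
      intro k hk
      rw [Finset.mem_range, Nat.lt_succ_iff, not_le] at hk
      rw [h0, Nat.descFactorial_of_lt hk, Nat.cast_zero, zero_smul, mul_zero]
    refine (Finset.sum_subset Finset.subset_union_left fun k _ hk => ?_).trans
      (Finset.sum_subset (Finset.subset_union_right (s₁ := D.support)) fun k _ hk => h2 k hk).symm
    rw [Finsupp.notMem_support_iff.1 hk, zero_mul]
  rw [h1, Finset.smul_sum]
  refine Finset.sum_congr rfl fun k hk => ?_
  rw [Finset.mem_range, Nat.lt_succ_iff] at hk
  have h3 : ((m - k).factorial : RatFunc ℂ) ≠ 0 := by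
    exact_mod_cast Nat.factorial_ne_zero _
  have h4 : (m.factorial : RatFunc ℂ) = (m - k).factorial * m.descFactorial k := by
    exact_mod_cast (Nat.factorial_mul_descFactorial hk).symm
  rw [h0, Algebra.smul_def, Algebra.smul_def, map_natCast, map_natCast, h4]
  field_simp

variable {r s : ℕ}

/-- The operators `D` with `D.ℂ[z] ⊆ W`, as a subspace. -/
def opM (W : Submodule ℂ (Fin r → RatFunc ℂ)) : Submodule ℂ (Fin r → DiffOp) where
  carrier := opModule W
  add_mem' := by
    intro D E hD hE p
    have := W.add_mem (hD p) (hE p)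
    convert this using 1
    funext j
    simp [act_eq]
  zero_mem' := by
    intro p
    convert W.zero_mem using 1
    funext j
    simp [act_eq]
  smul_mem' := by
    intro c D hD p
    have := W.smul_mem c (hD p)
    convert this using 1
    funext j
    simp [act_eq]

lemma mem_opM {W : Submodule ℂ (Fin r → RatFunc ℂ)} {D : Fin r → DiffOp} :
    D ∈ opM W ↔ ∀ p : ℂ[X], (fun j => aK (D j) (toK p)) ∈ W := by
  simp only [← act_eq]
  rfl

/-- The displayed sum is D.z^m / m!, and the monomials span ℂ[z]. -/
lemma mem_opM_iff_X_pow {W : Submodule ℂ (Fin r → RatFunc ℂ)} {D : Fin r → DiffOp} :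
    D ∈ opM W ↔ ∀ m : ℕ, (fun j => ∑ k ∈ Finset.range (m + 1),
      D j k * (RatFunc.X ^ (m - k) / ((m - k).factorial : RatFunc ℂ))) ∈ W := by
  have h1 : ∀ m : ℕ, (fun j => aK (D j) (toK (Polynomial.X ^ m))) =
      (m.factorial : ℂ) • fun j => ∑ k ∈ Finset.range (m + 1),
        D j k * (RatFunc.X ^ (m - k) / ((m - k).factorial : RatFunc ℂ)) := by
    intro m
    funext j
    rw [aK_toK_X_pow]
    rfl
  rw [mem_opM]
  constructor
  · intro h m
    have := h (Polynomial.X ^ m)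
    rw [h1] at this
    exact (W.smul_mem_iff (by exact_mod_cast m.factorial_ne_zero)).1 this
  · intro h p
    induction p using Polynomial.induction_on' with
    | add p q hp hq =>
      convert W.add_mem hp hq using 1
      funext j
      simp [toK]
    | monomial n c =>
      convert W.smul_mem c (W.smul_mem (n.factorial : ℂ) (h n)) using 1
      rw [← h1]
      funext j
      rw [Pi.smul_apply, ← map_smul, ← toK_smul, Polynomial.smul_X_eq_monomial]

/-- The bridge between functions and operators: θφe^{xz} is D.e^{xz}, whose power series
coefficients in x are the D.z^m / m!. -/
lemma rowMem_iff {W : Submodule ℂ (Fin r → RatFunc ℂ)} {φ : Fin r → Fun2} :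
    RowMem φ W ↔ ∃ θ : ℂ[X], θ ≠ 0 ∧ ∃ D ∈ opM W, ∀ j, mX (toK θ) (φ j) = sym (D j) := by
  constructor
  · rintro ⟨θ, hθ, D, h1, h2⟩
    exact ⟨θ, hθ, D, mem_opM_iff_X_pow.2 h2, h1⟩
  · rintro ⟨θ, hθ, D, h2, h1⟩
    exact ⟨θ, hθ, D, h1, mem_opM_iff_X_pow.1 h2⟩

lemma shiftPoly_mem_opM {W : Submodule ℂ (Fin r → RatFunc ℂ)} {D : Fin r → DiffOp}
    (hD : D ∈ opM W) (θ : ℂ[X]) : (fun j => shiftPoly θ (D j)) ∈ opM W := by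
  rw [mem_opM] at *
  intro p
  simp only [aK_shiftPoly]
  exact hD _

lemma mulZ_mem_opM {W : Submodule ℂ (Fin r → RatFunc ℂ)} {D : Fin r → DiffOp}
    (hD : D ∈ opM W) : (fun j => mulZ (D j)) ∈ opM W := by
  rw [mem_opM] at *
  intro p
  have := hD (Polynomial.X * p)
  simpa only [aK_mulZ, toK, map_mul, RatFunc.algebraMap_X] using this

/-- The rows `φ` such that `φ e ^ {x z}` belongs to `W` identically in `x`. -/
def rowModule (W : Submodule ℂ (Fin r → RatFunc ℂ)) : Submodule ℂ (Fin r → Fun2) where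
  carrier := {φ | RowMem φ W}
  add_mem' := by
    intro φ χ hφ hχ
    obtain ⟨θ, hθ, D, hD, h⟩ := rowMem_iff.1 hφ
    obtain ⟨η, hη, E, hE, h'⟩ := rowMem_iff.1 hχ
    refine rowMem_iff.2 ⟨θ * η, mul_ne_zero hθ hη, _, add_mem (shiftPoly_mem_opM hD η)
      (shiftPoly_mem_opM hE θ), fun j => ?_⟩
    have e : toK (θ * η) = toK θ * toK η := map_mul _ _ _
    rw [Pi.add_apply, Pi.add_apply, map_add, map_add, sym_shiftPoly, sym_shiftPoly, ← h, ← h',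
      mX_mX, mX_mX, e, mul_comm (toK θ)]
  zero_mem' := rowMem_iff.2 ⟨1, one_ne_zero, 0, zero_mem _, fun j => by simp⟩
  smul_mem' := by
    intro c φ hφ
    obtain ⟨θ, hθ, D, hD, h⟩ := rowMem_iff.1 hφ
    refine rowMem_iff.2 ⟨θ, hθ, c • D, (opM W).smul_mem c hD, fun j => ?_⟩
    rw [Pi.smul_apply, Pi.smul_apply, map_smul, map_smul, h]

lemma sym_mem_rowModule {W : Submodule ℂ (Fin r → RatFunc ℂ)} {D : Fin r → DiffOp}
    (hD : D ∈ opM W) : (fun j => sym (D j)) ∈ rowModule W :=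
  rowMem_iff.2 ⟨1, one_ne_zero, D, hD, fun j => by rw [toK, map_one, mX_one]⟩

lemma mX_mem_rowModule {W : Submodule ℂ (Fin r → RatFunc ℂ)} {φ : Fin r → Fun2}
    (hφ : φ ∈ rowModule W) (a : RatFunc ℂ) : (fun j => mX a (φ j)) ∈ rowModule W := by
  obtain ⟨θ, hθ, D, hD, h⟩ := rowMem_iff.1 hφ
  obtain ⟨n, d, hd, rfl⟩ := exists_div a
  refine rowMem_iff.2 ⟨θ * d, mul_ne_zero hθ hd, _, shiftPoly_mem_opM hD n, fun j => ?_⟩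
  rw [sym_shiftPoly, ← h, mX_mX, mX_mX]
  congr 2
  have hd' := toK_ne_zero hd
  simp only [toK, map_mul] at *
  field_simp

lemma nX_mem_rowModule {W : Submodule ℂ (Fin r → RatFunc ℂ)} {φ : Fin r → Fun2}
    (hφ : φ ∈ rowModule W) : (fun j => nX (φ j)) ∈ rowModule W := by
  obtain ⟨θ, hθ, D, hD, h⟩ := rowMem_iff.1 hφ
  have hθ' := toK_ne_zero hθ
  -- With ∇ for `nX`, ∇φ = θ⁻¹∇(θφ) - θ⁻¹θ'φ. Here θφ is the symbol of D, and ∇ on symbols is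
  -- composition with z on the right.
  have h1 := mX_mem_rowModule (sym_mem_rowModule (mulZ_mem_opM hD)) (toK θ)⁻¹
  have h2 := mX_mem_rowModule hφ ((toK θ)⁻¹ * ratDeriv (toK θ))
  convert sub_mem h1 h2 using 1
  funext j
  rw [Pi.sub_apply, sym_mulZ, ← h, nX_mX, map_add, mX_mX, mX_mX, inv_mul_cancel₀ hθ', mX_one,
    add_sub_cancel_right]

lemma aX_mem_rowModule {W : Submodule ℂ (Fin r → RatFunc ℂ)} {φ : Fin r → Fun2}
    (hφ : φ ∈ rowModule W) (D : DiffOp) : (fun j => aX D (φ j)) ∈ rowModule W := by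
  have h : ∀ k, (fun j => (nX ^ k) (φ j)) ∈ rowModule W := by
    intro k
    induction k with
    | zero => exact hφ
    | succ k ih =>
      simp only [pow_succ', Module.End.mul_apply]
      exact nX_mem_rowModule ih
  convert Submodule.sum_mem (rowModule W) (fun k (_ : k ∈ D.support) =>
    mX_mem_rowModule (h k) (D k)) using 1
  funext j
  rw [aX_apply, Finset.sum_apply]
  rfl

lemma rowOp_mem_rowModule {W : Submodule ℂ (Fin r → RatFunc ℂ)}
    {ψ : Matrix (Fin s) (Fin r) Fun2} (hψ : ∀ i, ψ i ∈ rowModule W) (Ξ : Fin s → DiffOp) :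
    rowOp Ξ ψ ∈ rowModule W := by
  convert Submodule.sum_mem (rowModule W) (fun i (_ : i ∈ Finset.univ) =>
    aX_mem_rowModule (hψ i) (Ξ i)) using 1
  funext j
  rw [Finset.sum_apply]
  rfl

lemma derivative_surjective (p : ℂ[X]) : ∃ q : ℂ[X], Polynomial.derivative q = p := by
  induction p using Polynomial.induction_on' with
  | add p q hp hq =>
    obtain ⟨a, rfl⟩ := hp
    obtain ⟨b, rfl⟩ := hq
    exact ⟨a + b, Polynomial.derivative_add⟩
  | monomial n c =>
    refine ⟨Polynomial.monomial (n + 1) (c / (n + 1)), ?_⟩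
    have : (n : ℂ) + 1 ≠ 0 := by exact_mod_cast n.succ_ne_zero
    rw [Polynomial.derivative_monomial, Nat.add_sub_cancel, Nat.cast_succ, div_mul_cancel₀ _ this]

/-- An operator `θ(∂)` with constant coefficients is surjective on polynomials. -/
lemma aeval_derivative_surjective {θ : ℂ[X]} (hθ : θ ≠ 0) (p : ℂ[X]) :
    ∃ q : ℂ[X], Polynomial.aeval Polynomial.derivative θ q = p := by
  -- θ = X^n η with η(0) ≠ 0. Since ∂ is nilpotent on p, a Bézout relation between η and a power of
  -- X that kills p inverts η(∂) there; the factor ∂^n is handled by repeated integration.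
  obtain ⟨η, h, hη⟩ := Polynomial.exists_eq_pow_rootMultiplicity_mul_and_not_dvd θ hθ 0
  rw [map_zero, sub_zero] at h hη
  have hc : IsCoprime (Polynomial.X ^ (p.natDegree + 1)) η :=
    ((Polynomial.irreducible_X.coprime_iff_not_dvd).2 hη).pow_left
  obtain ⟨u, v, huv⟩ := hc
  have h1 : Polynomial.aeval Polynomial.derivative η
      (Polynomial.aeval Polynomial.derivative v p) = p := by
    have := congrArg (fun f => Polynomial.aeval (Polynomial.derivative (R := ℂ)) f p) huv
    simp only [map_add, map_mul, map_pow, Polynomial.aeval_X, map_one, LinearMap.add_apply,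
      Module.End.mul_apply, Module.End.one_apply] at this
    rw [Module.End.coe_pow, Polynomial.iterate_derivative_eq_zero (Nat.lt_succ_self _), map_zero,
      zero_add] at this
    rw [← Module.End.mul_apply, ← map_mul, mul_comm, map_mul, Module.End.mul_apply]
    exact this
  have h2 : ∀ n, ∀ f : ℂ[X], ∃ q, (Polynomial.derivative ^ n) q = f := by
    intro n
    induction n with
    | zero => exact fun f => ⟨f, rfl⟩
    | succ n ih =>
      intro f
      obtain ⟨g, rfl⟩ := derivative_surjective f
      obtain ⟨q, rfl⟩ := ih g
      exact ⟨q, by rw [pow_succ', Module.End.mul_apply]⟩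
  obtain ⟨q, hq⟩ := h2 (θ.rootMultiplicity 0) (Polynomial.aeval Polynomial.derivative v p)
  refine ⟨q, ?_⟩
  rw [h, mul_comm, map_mul, map_pow, Polynomial.aeval_X, Module.End.mul_apply, hq, h1]

/-- If `φ e ^ {x z}` belongs to `W` and `φ` has no poles in `x`, then all its coefficients
are in `W`. -/
lemma mem_opM_of_sym_mem {W : Submodule ℂ (Fin r → RatFunc ℂ)} {D : Fin r → DiffOp}
    (hD : (fun j => sym (D j)) ∈ rowModule W) : D ∈ opM W := by
  obtain ⟨θ, hθ, E, hE, h⟩ := rowMem_iff.1 hD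
  rw [mem_opM] at *
  intro p
  -- θ(x) sym D = sym E means E = D θ(∂). Writing the given polynomial as θ(∂)q, its image under D
  -- is E.q, which lies in W.
  obtain ⟨q, rfl⟩ := aeval_derivative_surjective hθ p
  convert hE q using 2 with j
  rw [← aK_shiftPoly]
  congr 2
  apply sym_injective
  rw [← h, sym_shiftPoly]

/-- The action of a matrix of operators in `z` on a row. -/
def starZ (φ : Fin r → Fun2) (D : Matrix (Fin r) (Fin s) DiffOp) : Fin s → Fun2 :=
  fun j => ∑ i, aZ (D i j) (φ i)

lemma rightAct_apply {l : ℕ} (ψ : Matrix (Fin l) (Fin r) Fun2)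
    (D : Matrix (Fin r) (Fin s) DiffOp) (i : Fin l) : rightAct ψ D i = starZ (ψ i) D := by
  funext j
  simp only [rightAct, Matrix.of_apply, starZ, actZ_eq]

lemma rowStar_eq (u : Fin r → RatFunc ℂ) (D : Matrix (Fin r) (Fin s) DiffOp) :
    rowStar u D = fun j => ∑ i, aK (D i j) (u i) := by
  funext j
  simp only [rowStar, act_eq]

/-- The product of a row and a matrix of operators. -/
def compRow (T : Fin r → DiffOp) (D : Matrix (Fin r) (Fin s) DiffOp) : Fin s → DiffOp :=
  fun j => ∑ i, comp (D i j) (T i)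

lemma sym_compRow (T : Fin r → DiffOp) (D : Matrix (Fin r) (Fin s) DiffOp) :
    (fun j => sym (compRow T D j)) = starZ (fun i => sym (T i)) D := by
  funext j
  simp only [compRow, map_sum, sym_comp, starZ]

lemma aK_compRow (T : Fin r → DiffOp) (D : Matrix (Fin r) (Fin s) DiffOp) (f : RatFunc ℂ) :
    (fun j => aK (compRow T D j) f) = rowStar (fun i => aK (T i) f) D := by
  rw [rowStar_eq]
  funext j
  simp only [compRow, map_sum, LinearMap.sum_apply, aK_comp]

lemma compRow_mem_opM {U : Submodule ℂ (Fin r → RatFunc ℂ)} {V : Submodule ℂ (Fin s → RatFunc ℂ)}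
    {D : Matrix (Fin r) (Fin s) DiffOp} (hD : D ∈ opSpace U V) {T : Fin r → DiffOp}
    (hT : T ∈ opM U) : compRow T D ∈ opM V := by
  rw [mem_opM] at *
  intro p
  rw [aK_compRow]
  exact hD _ (hT p)

lemma starZ_mem_rowModule {U : Submodule ℂ (Fin r → RatFunc ℂ)}
    {V : Submodule ℂ (Fin s → RatFunc ℂ)} {D : Matrix (Fin r) (Fin s) DiffOp}
    (hD : D ∈ opSpace U V) {φ : Fin r → Fun2} (hφ : φ ∈ rowModule U) :
    starZ φ D ∈ rowModule V := by
  obtain ⟨θ, hθ, T, hT, h⟩ := rowMem_iff.1 hφ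
  refine rowMem_iff.2 ⟨θ, hθ, _, compRow_mem_opM hD hT, fun j => ?_⟩
  have := congrFun (sym_compRow T D) j
  rw [this, starZ, starZ, map_sum]
  simp only [mX_aZ, h]

lemma starZ_rowOp {m : ℕ} (Ξ : Fin m → DiffOp) (ψ : Matrix (Fin m) (Fin r) Fun2)
    (D : Matrix (Fin r) (Fin s) DiffOp) : starZ (rowOp Ξ ψ) D = rowOp Ξ (rightAct ψ D) := by
  funext j
  simp only [starZ, rowOp, map_sum, rightAct, Matrix.of_apply, actZ_eq, aX_aZ]
  exact Finset.sum_comm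

/-- Operators that preserve polynomials have polynomial coefficients. -/
lemma mem_Pol_of_aK_mem {D : DiffOp} (h : ∀ p, aK D (toK p) ∈ Pol) (k : ℕ) : D k ∈ Pol := by
  induction k using Nat.strong_induction_on with
  | _ k ih =>
    -- D.z^k is k! times the kth coefficient plus polynomial multiples of earlier coefficients, so
    -- the coefficients are obtained recursively.
    have h1 := h (Polynomial.X ^ k)
    have h0 : (k.factorial : ℂ) ≠ 0 := by exact_mod_cast k.factorial_ne_zero
    rw [aK_toK_X_pow, Pol.smul_mem_iff h0, Finset.sum_range_succ] at h1
    have h2 : ∑ i ∈ Finset.range k,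
        D i * (RatFunc.X ^ (k - i) / ((k - i).factorial : RatFunc ℂ)) ∈ Pol := by
      refine Submodule.sum_mem _ fun i hi => Pol_mul (ih i (Finset.mem_range.1 hi)) ?_
      have := Pol.smul_mem (((k - i).factorial : ℂ)⁻¹) (X_pow_mem_Pol (k - i))
      rwa [Algebra.smul_def, map_inv₀, map_natCast, mul_comm, ← div_eq_mul_inv] at this
    have h3 := (Submodule.add_mem_iff_right _ h2).1 h1
    simpa using h3

end

section

/-! ### Existence and uniqueness of the stationary Baker function -/

variable {r : ℕ}

lemma vanishAtInfty_eq : vanishAtInfty = box ⊤ Pr := by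
  refine le_antisymm (Submodule.span_le.2 ?_) (box_le.2 fun a _ b hb => ?_)
  · rintro _ ⟨a, f, hf, rfl⟩
    exact tmul_mem_box Submodule.mem_top hf
  · exact Submodule.subset_span ⟨a, b, hb, rfl⟩

/-- The operator `θ(∂)`. -/
def constOp : ℂ[X] →ₗ[ℂ] DiffOp :=
  LinearMap.applyₗ (Finsupp.single 0 1) ∘ₗ (Polynomial.aeval shift).toLinearMap

lemma sym_constOp (θ : ℂ[X]) : sym (constOp θ) = toK θ ⊗ₜ[ℂ] 1 := by
  have := sym_shiftPoly θ (Finsupp.single 0 1)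
  rw [sym_single, pow_zero, mX_tmul, mul_one] at this
  exact this

lemma constOp_apply (θ : ℂ[X]) (k : ℕ) : constOp θ k = algebraMap ℂ (RatFunc ℂ) (θ.coeff k) := by
  rw [← coefX_sym, sym_constOp, coefX_tmul, coef_toK, Algebra.algebraMap_eq_smul_one]

lemma mem_leadingCoeffs {W : Submodule ℂ (Fin r → RatFunc ℂ)} {D : Fin r → DiffOp}
    (hD : D ∈ opM W) {n : ℕ} (hn : ∀ j k, n < k → D j k = 0) :
    (fun j => D j n) ∈ leadingCoeffs W :=
  ⟨D, hD, n, fun k hk j => hn j k hk, fun _ => rfl⟩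

lemma lead_mem_Pol {W : Submodule ℂ (Fin r → RatFunc ℂ)}
    (hL : leadingCoeffs W = Set.range polyVec) {D : Fin r → DiffOp}
    (hD : D ∈ opM W) {n : ℕ} (hn : ∀ j k, n < k → D j k = 0) (j : Fin r) : D j n ∈ Pol := by
  have h := mem_leadingCoeffs hD hn
  rw [hL] at h
  obtain ⟨f, hf⟩ := h
  exact ⟨f j, congrFun hf j⟩

lemma coeff_mem_of_sym_mem {A : Submodule ℂ (RatFunc ℂ)} {D : DiffOp} (h : sym D ∈ box ⊤ A)
    (k : ℕ) : D k ∈ A := by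
  rw [← coefX_sym]
  exact coefX_mem h

/-- After clearing poles in x, φ is the symbol of an operator in `opM W` with proper coefficients.
Its leading coefficient is also polynomial, hence zero, and this repeats down to order 0. -/
lemma rowModule_inf_vanish {W : Submodule ℂ (Fin r → RatFunc ℂ)}
    (hL : leadingCoeffs W = Set.range polyVec) {φ : Fin r → Fun2} (hφ : φ ∈ rowModule W)
    (h : ∀ j, φ j ∈ box ⊤ Pr) : φ = 0 := by
  obtain ⟨θ, hθ, D, hD, e⟩ := rowMem_iff.1 hφ
  have hPr : ∀ j k, D j k ∈ Pr := fun j k => by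
    refine coeff_mem_of_sym_mem ?_ k
    rw [← e]
    exact mX_mem (fun _ _ => Submodule.mem_top) (h j)
  have hD0 : ∀ j k, D j k = 0 := fun j k =>
    order_lt_of_forall (n := 0)
      (fun m _ hm j => Pol_inf_Pr (lead_mem_Pol hL hD hm j) (hPr j m)) j k (Nat.zero_le k)
  funext j
  apply mX_injective (toK_ne_zero hθ)
  rw [e, Pi.zero_apply, map_zero]
  have : D j = 0 := Finsupp.ext (hD0 j)
  rw [this, map_zero]

lemma IsBaker.sub_one_mem {W : Submodule ℂ (Fin r → RatFunc ℂ)} {ψ : Matrix (Fin r) (Fin r) Fun2}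
    (h : IsBaker W ψ) (i j : Fin r) : (ψ - 1) i j ∈ box ⊤ Pr :=
  vanishAtInfty_eq ▸ h.1 i j

lemma IsBaker.unique {W : Submodule ℂ (Fin r → RatFunc ℂ)}
    (hL : leadingCoeffs W = Set.range polyVec) {ψ χ : Matrix (Fin r) (Fin r) Fun2}
    (hψ : IsBaker W ψ) (hχ : IsBaker W χ) : ψ = χ := by
  have h : ∀ i, ψ i - χ i = 0 := by
    intro i
    refine rowModule_inf_vanish hL ((rowModule W).sub_mem (hψ.2 i) (hχ.2 i)) fun j => ?_
    have := sub_mem (hψ.sub_one_mem i j) (hχ.sub_one_mem i j)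
    rwa [Matrix.sub_apply, Matrix.sub_apply, sub_sub_sub_cancel_right] at this
  funext i
  exact sub_eq_zero.1 (h i)

/-- The stationary Baker function also tends to `1` as `x → ∞`. -/
lemma IsBaker.sub_one_mem_Pr {W : Submodule ℂ (Fin r → RatFunc ℂ)}
    (hL : leadingCoeffs W = Set.range polyVec) {ψ : Matrix (Fin r) (Fin r) Fun2}
    (h : IsBaker W ψ) (i j : Fin r) : (ψ - 1) i j ∈ box Pr Pr := by
  obtain ⟨θ, hθ, D, hD, e⟩ := rowMem_iff.1 (h.2 i)
  -- The difference of D and θ(∂)e_i. Its symbol is θ(x) times the ith row of ψ - 1, so its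
  -- coefficients are proper in z.
  set v : Fin r → DiffOp := fun j => D j - if i = j then constOp θ else 0 with hv
  have hsym : ∀ j, sym (v j) = mX (toK θ) ((ψ - 1) i j) := by
    intro j
    rw [Matrix.sub_apply, hv, map_sub, map_sub, ← e, Matrix.one_apply]
    split_ifs
    · rw [sym_constOp, mX_apply _ 1, mul_one]
    · rw [map_zero, map_zero]
  have hPr : ∀ j k, v j k ∈ Pr := fun j k => by
    refine coeff_mem_of_sym_mem ?_ k
    rw [hsym]
    exact mX_mem (fun _ _ => Submodule.mem_top) (h.sub_one_mem i j)
  have hvD : ∀ j k, v j k = D j k - if i = j then algebraMap ℂ (RatFunc ℂ) (θ.coeff k) else 0 := by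
    intro j k
    simp only [hv]
    split_ifs
    · rw [Finsupp.sub_apply, constOp_apply]
    · rw [sub_zero, sub_zero]
  -- From deg θ upwards the top coefficient of v is a leading coefficient of D minus a constant,
  -- hence polynomial as well as proper. So v has order below deg θ, and division by θ makes its
  -- symbol proper in x.
  have hord : ∀ j k, θ.natDegree ≤ k → v j k = 0 := by
    refine fun j k hk => order_lt_of_forall (fun m hm hm' j => ?_) j k hk
    refine Pol_inf_Pr ?_ (hPr j m)
    rw [hvD]
    refine Pol.sub_mem (lead_mem_Pol hL hD (fun j k hk => ?_) j) ?_
    · have := hm' j k hk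
      rw [hvD, Polynomial.coeff_eq_zero_of_natDegree_lt (by omega), map_zero, ite_self,
        sub_zero] at this
      exact this
    · split_ifs
      · rw [← toK_C]
        exact toK_mem_Pol _
      · exact Pol.zero_mem
  have e2 : (ψ - 1) i j = mX (toK θ)⁻¹ (sym (v j)) := by
    rw [hsym, mX_mX, inv_mul_cancel₀ (toK_ne_zero hθ), mX_one]
  rw [e2, sym_apply, Finsupp.sum, map_sum]
  refine Submodule.sum_mem _ fun k hk => ?_
  rw [mX_tmul]
  refine tmul_mem_box ?_ (hPr j k)
  have hk' : k < θ.natDegree := by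
    by_contra hcon
    exact Finsupp.mem_support_iff.1 hk (hord j k (not_lt.1 hcon))
  have e3 : (toK θ)⁻¹ * RatFunc.X ^ k = toK (Polynomial.X ^ k) / toK θ := by
    rw [mul_comm, ← div_eq_mul_inv, ← toK_X, toK, toK, toK, map_pow]
  rw [e3, div_mem_Pr hθ, Polynomial.degree_X_pow, Polynomial.degree_eq_natDegree hθ]
  exact_mod_cast hk'

/-- The rows of operators whose coefficients vanish at infinity. -/
def prOps (r : ℕ) : Submodule ℂ (Fin r → DiffOp) where
  carrier := {D | ∀ j k, D j k ∈ Pr}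
  add_mem' hD hE j k := Pr.add_mem (hD j k) (hE j k)
  zero_mem' _ _ := Pr.zero_mem
  smul_mem' c _ hD j k := Pr.smul_mem c (hD j k)

/-- The row with the single entry `a ∂ ^ k` in the place `i`. -/
def monoOp (i : Fin r) (k : ℕ) : RatFunc ℂ →ₗ[ℂ] (Fin r → DiffOp) :=
  LinearMap.single ℂ (fun _ => DiffOp) i ∘ₗ Finsupp.lsingle k

lemma monoOp_apply (i : Fin r) (k : ℕ) (a : RatFunc ℂ) (j : Fin r) (l : ℕ) :
    monoOp i k a j l = if i = j ∧ k = l then a else 0 := by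
  simp only [monoOp, LinearMap.comp_apply, LinearMap.coe_single, Finsupp.lsingle_apply]
  rcases eq_or_ne i j with rfl | h
  · simp [Finsupp.single_apply]
  · rw [Pi.single_eq_of_ne' h]
    simp [h]

lemma monoOp_mem_opM {W : Submodule ℂ (Fin r → RatFunc ℂ)} {p : ℂ[X]}
    (hp : ∀ f : Fin r → ℂ[X], polyVec (fun j => p * f j) ∈ W) (i : Fin r) (k : ℕ) (g : ℂ[X]) :
    monoOp i k (toK (p * g)) ∈ opM W := by
  rw [mem_opM]
  intro f
  convert hp (Pi.single i (g * Polynomial.derivative^[k] f)) using 1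
  funext j
  rcases eq_or_ne i j with rfl | h
  · simp only [monoOp, LinearMap.comp_apply, LinearMap.coe_single, Finsupp.lsingle_apply, polyVec,
      Pi.single_eq_same, aK_single, dK_pow, iterate_ratDeriv_toK]
    simp only [toK, map_mul, mul_assoc]
  · simp only [monoOp, LinearMap.comp_apply, LinearMap.coe_single, polyVec,
      Pi.single_eq_of_ne' h, map_zero, mul_zero, LinearMap.zero_apply]

lemma shift_pow_order {D : DiffOp} {n : ℕ} (hD : ∀ k, n < k → D k = 0) (d k : ℕ)
    (hk : n + d < k) : (shift ^ d) D k = 0 := by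
  obtain ⟨l, rfl⟩ : ∃ l, k = l + d := ⟨k - d, by omega⟩
  rw [shift_pow_apply, hD l (by omega)]

/-- All operators are, up to a finite-dimensional space, sums of an operator in `opM W` and an
operator whose coefficients vanish at infinity. -/
lemma exists_finite_codim {W : Submodule ℂ (Fin r → RatFunc ℂ)} {p : ℂ[X]} (hp0 : p ≠ 0)
    (hp : ∀ f : Fin r → ℂ[X], polyVec (fun j => p * f j) ∈ W)
    (hL : leadingCoeffs W = Set.range polyVec) :
    ∃ S : Submodule ℂ (Fin r → DiffOp), S.FG ∧ opM W ⊔ prOps r ⊔ S = ⊤ := by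
  -- Operators in `opM W` whose leading coefficients represent all residue classes modulo p.
  have h1 : ∀ q : Fin r × Fin p.natDegree, ∃ E ∈ opM W, ∃ n : ℕ, (∀ j k, n < k → E j k = 0) ∧
      ∀ j, E j n = if q.1 = j then toK (Polynomial.X ^ (q.2 : ℕ)) else 0 := by
    intro q
    have : polyVec (Pi.single q.1 (Polynomial.X ^ (q.2 : ℕ))) ∈ leadingCoeffs W :=
      hL ▸ ⟨_, rfl⟩
    obtain ⟨E, hE, n, hn, hlead⟩ := this
    refine ⟨E, hE, n, fun j k hk => hn k hk j, fun j => ?_⟩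
    rw [← hlead, polyVec]
    split_ifs with h
    · rw [h, Pi.single_eq_same]
    · rw [Pi.single_eq_of_ne' h, map_zero]
  choose E hE n hn hlead using h1
  set n₀ := Finset.univ.sup n with hn₀
  -- Coefficients divisible by p are available in every order, and composing the operators E with ∂
  -- on the right yields all higher orders. Only the monomials z^a ∂^k with a < deg p and k < n₀ may
  -- be missing.
  set S : Submodule ℂ (Fin r → DiffOp) := Submodule.span ℂ (Set.range
    fun q : (Fin r × Fin p.natDegree) × Fin n₀ =>
      monoOp q.1.1 q.2 (toK (Polynomial.X ^ (q.1.2 : ℕ)))) with hS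
  refine ⟨S, Submodule.fg_span (Set.finite_range _), ?_⟩
  set T := opM W ⊔ prOps r ⊔ S with hT
  have hT1 : opM W ≤ T := le_sup_left.trans le_sup_left
  have hT2 : prOps r ≤ T := le_sup_right.trans le_sup_left
  have hT3 : S ≤ T := le_sup_right
  have key : ∀ k (D : Fin r → DiffOp), (∀ j l, k ≤ l → D j l = 0) → D ∈ T := by
    intro k
    induction k with
    | zero =>
      intro D hD
      have : D = 0 := funext fun j => Finsupp.ext fun l => hD j l (Nat.zero_le l)
      rw [this]
      exact T.zero_mem
    | succ k ih =>
      have hX : ∀ q : Fin r × Fin p.natDegree,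
          monoOp q.1 k (toK (Polynomial.X ^ (q.2 : ℕ))) ∈ T := by
        intro q
        by_cases hk : k < n₀
        · exact hT3 (Submodule.subset_span ⟨(q, ⟨k, hk⟩), rfl⟩)
        · have hnq : n q ≤ k := (Finset.le_sup (Finset.mem_univ q)).trans (not_lt.1 hk)
          obtain ⟨d, rfl⟩ : ∃ d, k = n q + d := ⟨k - n q, by omega⟩
          have h2 : (fun j => (shift ^ d) (E q j)) ∈ opM W := by
            have := shiftPoly_mem_opM (hE q) (Polynomial.X ^ d)
            simpa only [shiftPoly, map_pow, Polynomial.aeval_X] using this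
          have h3 := ih ((fun j => (shift ^ d) (E q j)) -
            monoOp q.1 (n q + d) (toK (Polynomial.X ^ (q.2 : ℕ)))) (fun j l hl => by
              rw [Pi.sub_apply, Finsupp.sub_apply, monoOp_apply]
              rcases eq_or_lt_of_le hl with rfl | hl
              · rw [shift_pow_apply, hlead]
                simp
              · rw [shift_pow_order (hn q j) d l hl, if_neg (by omega), sub_zero])
          have := T.sub_mem (hT1 h2) h3
          rwa [sub_sub_cancel] at this
      have hpoly : ∀ i (g : ℂ[X]), monoOp i k (toK g) ∈ T := by
        intro i g
        have e : toK g = toK (p * (g / p)) + toK (g % p) := by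
          rw [← map_add, EuclideanDomain.div_add_mod]
        rw [e, map_add]
        refine T.add_mem (hT1 (monoOp_mem_opM hp i k _)) ?_
        rcases eq_or_ne (g % p) 0 with h0 | h0
        · rw [h0, toK, map_zero, map_zero]
          exact T.zero_mem
        have hdeg : (g % p).natDegree < p.natDegree :=
          Polynomial.natDegree_lt_natDegree h0 (EuclideanDomain.mod_lt g hp0)
        rw [(g % p).as_sum_range' _ hdeg, toK, map_sum, map_sum]
        refine Submodule.sum_mem _ fun a ha => ?_
        rw [← Polynomial.smul_X_eq_monomial, ← toK, toK_smul, map_smul]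
        exact T.smul_mem _ (hX (i, ⟨a, Finset.mem_range.1 ha⟩))
      intro D hD
      have e : D = (D - ∑ i, monoOp i k (D i k)) + ∑ i, monoOp i k (D i k) := by
        rw [sub_add_cancel]
      rw [e]
      refine T.add_mem (ih _ fun j l hl => ?_) (Submodule.sum_mem _ fun i _ => ?_)
      · rw [Pi.sub_apply, Finsupp.sub_apply, Finset.sum_apply, Finsupp.finsetSum_apply]
        simp only [monoOp_apply]
        rcases eq_or_lt_of_le hl with rfl | hl
        · simp
        · rw [hD j l hl, Finset.sum_eq_zero, sub_zero]
          exact fun i _ => if_neg (by omega)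
      · have e2 : D i k = toK (polyPart (D i k)) + (D i k - toK (polyPart (D i k))) := by
          rw [add_sub_cancel]
        rw [e2, map_add]
        refine T.add_mem (hpoly i _) (hT2 fun j l => ?_)
        rw [monoOp_apply]
        split_ifs
        · exact sub_polyPart_mem _
        · exact Pr.zero_mem
  rw [eq_top_iff]
  rintro D -
  obtain ⟨m, hm⟩ := exists_order_bound D
  exact key m D hm

/-- A linear map from polynomials into a finitely generated subspace is not injective. -/
lemma exists_ne_zero_of_fg {N : Type*} [AddCommGroup N] [Module ℂ N] (g : ℂ[X] →ₗ[ℂ] N)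
    {B : Submodule ℂ N} (hB : B.FG) (h : ∀ θ, g θ ∈ B) : ∃ θ : ℂ[X], θ ≠ 0 ∧ g θ = 0 := by
  by_contra hcon
  push Not at hcon
  have hinj : Function.Injective (g.codRestrict B h) := by
    rw [injective_iff_map_eq_zero]
    intro θ hθ
    by_contra h0
    exact hcon θ h0 (congrArg Subtype.val hθ)
  have : Module.Finite ℂ B := Module.Finite.iff_fg.2 hB
  exact Polynomial.not_finite (Module.Finite.of_injective _ hinj)

/-- By finite codimension some θ(∂)e_i with θ ≠ 0 is m + v, with m in `opM W` and v proper. Then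
θ(x)⁻¹ sym m = e_i - θ(x)⁻¹ sym v is the ith row of ψ. -/
lemma exists_isBaker {W : Submodule ℂ (Fin r → RatFunc ℂ)} (hW : W ∈ Grad r) :
    ∃ ψ, IsBaker W ψ := by
  obtain ⟨⟨p, q, hp0, hq0, hp, hq⟩, -, hL⟩ := hW
  obtain ⟨S, hS, hST⟩ := exists_finite_codim hp0 hp hL
  have h1 : ∀ i : Fin r, ∃ θ : ℂ[X], θ ≠ 0 ∧
      LinearMap.single ℂ (fun _ => DiffOp) i (constOp θ) ∈ opM W ⊔ prOps r := by
    intro i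
    obtain ⟨θ, hθ, h⟩ := exists_ne_zero_of_fg ((opM W ⊔ prOps r).mkQ ∘ₗ
      LinearMap.single ℂ (fun _ => DiffOp) i ∘ₗ constOp) (hS.map (opM W ⊔ prOps r).mkQ)
      (fun θ => by
        have : LinearMap.single ℂ (fun _ => DiffOp) i (constOp θ) ∈ opM W ⊔ prOps r ⊔ S :=
          hST ▸ Submodule.mem_top
        obtain ⟨a, ha, b, hb, hab⟩ := Submodule.mem_sup.1 this
        refine ⟨b, hb, ?_⟩
        have ha' : (opM W ⊔ prOps r).mkQ a = 0 := (Submodule.Quotient.mk_eq_zero _).2 ha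
        rw [LinearMap.comp_apply, LinearMap.comp_apply, ← hab, map_add, ha', zero_add])
    exact ⟨θ, hθ, (Submodule.Quotient.mk_eq_zero _).1 h⟩
  choose θ hθ h2 using h1
  choose m hm v hv hmv using fun i => Submodule.mem_sup.1 (h2 i)
  refine ⟨Matrix.of fun i j => mX (toK (θ i))⁻¹ (sym (m i j)), fun i j => ?_, fun i => ?_⟩
  · have e : sym (m i j) = mX (toK (θ i)) ((1 : Matrix (Fin r) (Fin r) Fun2) i j) -
        sym (v i j) := by
      have := congrFun (hmv i) j
      rw [eq_sub_iff_add_eq, ← map_add, ← Pi.add_apply, this, LinearMap.coe_single,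
        Matrix.one_apply]
      split_ifs with h
      · rw [h, Pi.single_eq_same, sym_constOp, mX_apply, mul_one]
      · rw [Pi.single_eq_of_ne' h, map_zero, map_zero]
    rw [vanishAtInfty_eq, Matrix.sub_apply, Matrix.of_apply, e, map_sub, mX_mX,
      inv_mul_cancel₀ (toK_ne_zero (hθ i)), mX_one, sub_sub_cancel_left]
    exact neg_mem (mX_mem (fun _ _ => Submodule.mem_top)
      (box_mono le_top le_rfl (sym_mem (hv i j))))
  · exact mX_mem_rowModule (sym_mem_rowModule (hm i)) _

end

section

/-! ### Symmetric characterization of stationary Baker functions -/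

variable {r : ℕ}

/-- `ψ(z, x)ᵗ`. -/
def dualFun (ψ : Matrix (Fin r) (Fin r) Fun2) : Matrix (Fin r) (Fin r) Fun2 :=
  ψ.transpose.map swapXZ

lemma dualFun_apply (ψ : Matrix (Fin r) (Fin r) Fun2) (i j : Fin r) :
    dualFun ψ i j = sw (ψ j i) := rfl

lemma dualFun_dualFun (ψ : Matrix (Fin r) (Fin r) Fun2) : dualFun (dualFun ψ) = ψ := by
  ext i j
  rw [dualFun_apply, dualFun_apply, sw_sw]

lemma dualFun_sub_one (ψ : Matrix (Fin r) (Fin r) Fun2) (i j : Fin r) :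
    (dualFun ψ - 1) i j = sw ((ψ - 1) j i) := by
  rw [Matrix.sub_apply, Matrix.sub_apply, map_sub, dualFun_apply, Matrix.one_apply,
    Matrix.one_apply]
  rcases eq_or_ne i j with rfl | h
  · rw [if_pos rfl, sw_one]
  · rw [if_neg h, if_neg h.symm, map_zero]

/-- The row `p(z) e_i`. -/
def unitRow (p : ℂ[X]) (i : Fin r) : Fin r → Fun2 :=
  Pi.single i ((1 : RatFunc ℂ) ⊗ₜ[ℂ] toK p)

/-- `ψ = 1 + O(x⁻¹ z⁻¹)`, and every `e_i` has a multiple `p(z) e_i` of the form `Ξ(x).ψ`. -/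
structure HalfBaker (ψ : Matrix (Fin r) (Fin r) Fun2) : Prop where
  sub_one_mem : ∀ i j, (ψ - 1) i j ∈ box Pr Pr
  exists_row : ∀ i, ∃ p : ℂ[X], p ≠ 0 ∧ ∃ Ξ : Fin r → DiffOp, rowOp Ξ ψ = unitRow p i

lemma HalfBaker.sub_one_mem_top {ψ : Matrix (Fin r) (Fin r) Fun2} (h : HalfBaker ψ) (i j : Fin r) :
    (ψ - 1) i j ∈ box ⊤ Pr :=
  box_mono le_top le_rfl (h.sub_one_mem i j)

lemma deriv_mem_Finf (a : RatFunc ℂ) (ha : a ∈ Finf) : ratDeriv a ∈ Finf := F_deriv ha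

lemma Pr_le_Finf : Pr ≤ Finf.toSubmodule := Pr_le_F 1

lemma unitRow_mem {R : Subalgebra ℂ (RatFunc ℂ)} {p : ℂ[X]} {n : ℕ} (hp : p.degree < n)
    (i j : Fin r) : unitRow p i j ∈ box R.toSubmodule (F n) := by
  rw [unitRow]
  rcases eq_or_ne i j with rfl | h
  · rw [Pi.single_eq_same]
    exact tmul_mem_box R.one_mem (toK_mem_F.2 hp)
  · rw [Pi.single_eq_of_ne' h]
    exact zero_mem _

/-- The operators `Ξ` with `Ξ.ψ = p(z) e_i` have coefficients that are regular at infinity and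
are monic up to a constant. -/
lemma HalfBaker.row_spec {ψ : Matrix (Fin r) (Fin r) Fun2} (h : HalfBaker ψ) {p : ℂ[X]} {i : Fin r}
    {Ξ : Fin r → DiffOp} (hΞ : rowOp Ξ ψ = unitRow p i) :
    (∀ l k, Ξ l k ∈ Finf) ∧ (∀ l k, p.natDegree < k → Ξ l k = 0) ∧
      ∀ l, Ξ l p.natDegree = if i = l then algebraMap ℂ _ p.leadingCoeff else 0 := by
  have hdeg : p.degree < ((p.natDegree + 1 : ℕ) : WithBot ℕ) :=
    Polynomial.degree_lt_iff_coeff_zero _ _ |>.2 fun m hm =>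
      Polynomial.coeff_eq_zero_of_natDegree_lt hm
  have hord : ∀ l k, p.natDegree < k → Ξ l k = 0 := fun l k hk =>
    order_lt_of_rowOp_mem h.sub_one_mem_top (n := p.natDegree + 1)
      (fun j => by rw [hΞ]; exact box_mono le_top le_rfl (unitRow_mem (R := ⊤) hdeg i j)) l k hk
  refine ⟨fun l k => ?_, hord, fun l => ?_⟩
  -- Division inside the ring of functions regular at infinity gives an operator with the required
  -- coefficients; both operators have the same image up to terms proper in z, so they coincide.
  · obtain ⟨Ξ', h1, h2⟩ := exists_division Finf deriv_mem_Finf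
      (fun i j => box_mono Pr_le_Finf le_rfl (h.sub_one_mem i j)) _ (unitRow p i)
      (fun j => unitRow_mem hdeg i j)
    have h3 : Ξ - Ξ' = 0 := eq_zero_of_rowOp_mem h.sub_one_mem_top fun j => by
      rw [rowOp_sub, hΞ]
      exact box_mono le_top le_rfl (h2 j)
    rw [sub_eq_zero.1 h3]
    exact h1 l k
  · rw [← coefZ_rowOp h.sub_one_mem_top hord, hΞ, unitRow]
    split_ifs with hil
    · rw [hil, Pi.single_eq_same, coefZ_tmul, coef_toK, Algebra.algebraMap_eq_smul_one]
      rfl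
    · rw [Pi.single_eq_of_ne' hil, map_zero]

/-- Finitely many derivatives and multiplications enlarge a finite-dimensional space of functions of
x to a finite-dimensional one, uniformly in z. -/
lemma exists_common_fg (D : DiffOp) {B : Submodule ℂ (RatFunc ℂ)} (hB : B.FG) :
    ∃ B' : Submodule ℂ (RatFunc ℂ), B'.FG ∧ ∀ φ ∈ box B ⊤, aX D φ ∈ box B' ⊤ := by
  have h1 : ∀ k, ∃ B' : Submodule ℂ (RatFunc ℂ), B'.FG ∧ ∀ φ ∈ box B ⊤, (nX ^ k) φ ∈ box B' ⊤ := by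
    intro k
    induction k with
    | zero => exact ⟨B, hB, fun φ hφ => hφ⟩
    | succ k ih =>
      obtain ⟨C, hC, h⟩ := ih
      refine ⟨C ⊔ C.map dK, hC.sup (hC.map _), fun φ hφ => ?_⟩
      rw [pow_succ', Module.End.mul_apply]
      exact nX_mem le_sup_left (fun a ha => le_sup_right (a := C) (Submodule.mem_map_of_mem ha))
        le_top (fun _ _ => Submodule.mem_top) (h φ hφ)
  choose B' hB' h using h1
  refine ⟨D.support.sup fun k => (B' k).map (LinearMap.mulLeft ℂ (D k)), ?_, fun φ hφ => ?_⟩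
  · exact Submodule.fg_finset_sup _ _ fun k _ => (hB' k).map _
  · rw [aX_apply]
    refine Submodule.sum_mem _ fun k hk => ?_
    refine mX_mem (fun b hb => ?_) (h k φ hφ)
    exact Finset.le_sup (f := fun k => (B' k).map (LinearMap.mulLeft ℂ (D k))) hk
      (Submodule.mem_map_of_mem hb)

lemma exists_denom (φ : Fun2) : ∃ θ : ℂ[X], θ ≠ 0 ∧ mX (toK θ) φ ∈ box Pol ⊤ := by
  induction φ using TensorProduct.induction_on with
  | zero => exact ⟨1, one_ne_zero, by rw [map_zero]; exact zero_mem _⟩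
  | tmul a b =>
    obtain ⟨n, d, hd, rfl⟩ := exists_div a
    refine ⟨d, hd, ?_⟩
    rw [mX_tmul, mul_div_cancel₀ _ (toK_ne_zero hd)]
    exact tmul_mem_box (toK_mem_Pol n) Submodule.mem_top
  | add a b ha hb =>
    obtain ⟨θ, hθ, h1⟩ := ha
    obtain ⟨η, hη, h2⟩ := hb
    refine ⟨θ * η, mul_ne_zero hθ hη, ?_⟩
    have e : toK (θ * η) = toK θ * toK η := map_mul _ _ _
    rw [map_add]
    refine add_mem ?_ ?_
    · rw [e, mul_comm, ← mX_mX]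
      exact mX_mem (fun _ hc => Pol_mul (toK_mem_Pol _) hc) h1
    · rw [e, ← mX_mX]
      exact mX_mem (fun _ hc => Pol_mul (toK_mem_Pol _) hc) h2

lemma exists_common_denom {ι : Type*} [Fintype ι] (φ : ι → Fun2) :
    ∃ θ : ℂ[X], θ ≠ 0 ∧ ∀ i, mX (toK θ) (φ i) ∈ box Pol ⊤ := by
  classical
  choose θ hθ h using fun i => exists_denom (φ i)
  refine ⟨∏ i, θ i, Finset.prod_ne_zero_iff.2 fun i _ => hθ i, fun i => ?_⟩
  rw [← Finset.prod_erase_mul _ _ (Finset.mem_univ i), toK, map_mul, ← mX_mX]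
  exact mX_mem (fun _ hc => Pol_mul (toK_mem_Pol _) hc) (h i)

lemma exists_common_denomZ {ι : Type*} [Fintype ι] (φ : ι → Fun2) :
    ∃ q : ℂ[X], q ≠ 0 ∧ ∀ i, mZ (toK q) (φ i) ∈ box ⊤ Pol := by
  obtain ⟨q, hq, h⟩ := exists_common_denom fun i => sw (φ i)
  refine ⟨q, hq, fun i => ?_⟩
  rw [← sw_mem_box, sw_mZ]
  exact h i

/-- Such functions have the form g/θ with deg g < deg θ. -/
lemma fg_proper_denom {θ : ℂ[X]} (hθ : θ ≠ 0) :
    (Pr ⊓ Pol.comap (LinearMap.mulLeft ℂ (toK θ))).FG := by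
  have h : Pr ⊓ Pol.comap (LinearMap.mulLeft ℂ (toK θ)) ≤
      (Polynomial.degreeLT ℂ θ.natDegree).map (LinearMap.mulLeft ℂ (toK θ)⁻¹ ∘ₗ
        (IsScalarTower.toAlgHom ℂ ℂ[X] (RatFunc ℂ)).toLinearMap) := by
    rintro f ⟨hf, g, hg⟩
    have hθ' := toK_ne_zero hθ
    have hf' : f = toK g / toK θ := by
      rw [hg, LinearMap.mulLeft_apply, mul_div_cancel_left₀ _ hθ']
    refine ⟨g, ?_, ?_⟩
    · have := hf
      rw [SetLike.mem_coe, hf', div_mem_Pr hθ, Polynomial.degree_eq_natDegree hθ] at this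
      exact Polynomial.mem_degreeLT.2 this
    · rw [hf', LinearMap.comp_apply, LinearMap.mulLeft_apply, mul_comm, ← div_eq_mul_inv]
      rfl
  have hfin : Module.Finite ℂ (Polynomial.degreeLT ℂ θ.natDegree) :=
    Module.Finite.equiv (Polynomial.degreeLTEquiv ℂ θ.natDegree).symm
  have hfg := (Module.Finite.iff_fg.1 hfin).map (LinearMap.mulLeft ℂ (toK θ)⁻¹ ∘ₗ
        (IsScalarTower.toAlgHom ℂ ℂ[X] (RatFunc ℂ)).toLinearMap)
  have := Module.Finite.iff_fg.2 hfg
  exact Module.Finite.iff_fg.1 (Module.Finite.of_injective _ (Submodule.inclusion_injective h))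

lemma fg_poly_F (n : ℕ) : (Pol ⊓ F n).FG := by
  have h : Pol ⊓ F n ≤ (Polynomial.degreeLT ℂ n).map
        (IsScalarTower.toAlgHom ℂ ℂ[X] (RatFunc ℂ)).toLinearMap := by
    rintro f ⟨⟨g, rfl⟩, hg⟩
    exact ⟨g, Polynomial.mem_degreeLT.2 (toK_mem_F.1 hg), rfl⟩
  have hfin : Module.Finite ℂ (Polynomial.degreeLT ℂ n) :=
    Module.Finite.equiv (Polynomial.degreeLTEquiv ℂ n).symm
  have hfg := (Module.Finite.iff_fg.1 hfin).map
        (IsScalarTower.toAlgHom ℂ ℂ[X] (RatFunc ℂ)).toLinearMap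
  have := Module.Finite.iff_fg.2 hfg
  exact Module.Finite.iff_fg.1 (Module.Finite.of_injective _ (Submodule.inclusion_injective h))

lemma fg_box {A B : Submodule ℂ (RatFunc ℂ)} (hA : A.FG) (hB : B.FG) : (box A B).FG :=
  hA.map₂ _ hB

end

/-! ### Exchange of the roles of x and z -/

section

variable {r : ℕ}

/-- `rowOp` as a linear map. -/
def rowOpL {m : ℕ} (ψ : Matrix (Fin r) (Fin m) Fun2) : (Fin r → DiffOp) →ₗ[ℂ] (Fin m → Fun2) where
  toFun Ξ := rowOp Ξ ψ
  map_add' Ξ Ξ' := rowOp_add Ξ Ξ' ψ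
  map_smul' c Ξ := by
    funext j
    simp [rowOp, Finset.smul_sum]

/-- `unitRow` as a linear map. -/
def unitRowL (i : Fin r) : ℂ[X] →ₗ[ℂ] (Fin r → Fun2) :=
  LinearMap.single ℂ (fun _ => Fun2) i ∘ₗ TensorProduct.mk ℂ (RatFunc ℂ) (RatFunc ℂ) 1 ∘ₗ
    (IsScalarTower.toAlgHom ℂ ℂ[X] (RatFunc ℂ)).toLinearMap

lemma box_Pr_inf_Pol {φ : Fun2} (h : φ ∈ box Pr ⊤) (h' : φ ∈ box Pol ⊤) : φ = 0 := by
  have h2 : φ ∈ box (⊥ : Submodule ℂ (RatFunc ℂ)) ⊤ := by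
    refine box_mono ?_ le_rfl (box_inf_box_left h h')
    exact fun f hf => (Submodule.mem_bot ℂ).2 (Pol_inf_Pr hf.2 hf.1)
  rwa [box, Submodule.map₂_bot_left, Submodule.mem_bot] at h2

lemma box_Pr_inf_Pol_right {φ : Fun2} (h : φ ∈ box ⊤ Pr) (h' : φ ∈ box ⊤ Pol) : φ = 0 :=
  sw.injective (by
    rw [map_zero]
    exact box_Pr_inf_Pol (sw_mem_box.2 h) (sw_mem_box.2 h'))

/-- A function that is proper in `x`, and polynomial in `x` modulo functions polynomial in `z`,
is polynomial in `z`. -/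
lemma mem_box_Pol_of_sub {φ a b : Fun2} (hφ : φ ∈ box Pr ⊤) (ha : a ∈ box ⊤ Pol)
    (hb : b ∈ box Pol ⊤) (e : φ = a - b) : φ ∈ box ⊤ Pol := by
  -- π is the polynomial part. In the variable z, 1 - π kills a, so (1 - π)φ = -(1 - π)b is both
  -- proper and polynomial in x, hence zero.
  set π : RatFunc ℂ →ₗ[ℂ] RatFunc ℂ :=
    (IsScalarTower.toAlgHom ℂ ℂ[X] (RatFunc ℂ)).toLinearMap ∘ₗ polyPart with hπ
  have hπ1 : ∀ f, π f ∈ Pol := fun f => toK_mem_Pol _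
  have hπ2 : ∀ f ∈ Pol, π f = f := by
    rintro _ ⟨p, rfl⟩
    change toK (polyPart (toK p)) = _
    rw [polyPart_toK]
  have h1 : LinearMap.lTensor (RatFunc ℂ) (LinearMap.id - π) a = 0 := by
    refine box_ext (g := 0) (fun c _ d hd => ?_) ha
    rw [LinearMap.lTensor_tmul, LinearMap.sub_apply, LinearMap.id_apply, hπ2 d hd, sub_self,
      TensorProduct.tmul_zero, LinearMap.zero_apply]
  have h2 : LinearMap.lTensor (RatFunc ℂ) (LinearMap.id - π) φ ∈ box Pr ⊤ :=
    box_map (fun c hc d _ => tmul_mem_box hc Submodule.mem_top) hφ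
  have h3 : LinearMap.lTensor (RatFunc ℂ) (LinearMap.id - π) b ∈ box Pol ⊤ :=
    box_map (fun c hc d _ => tmul_mem_box hc Submodule.mem_top) hb
  have h4 : LinearMap.lTensor (RatFunc ℂ) (LinearMap.id - π) φ = 0 := by
    refine box_Pr_inf_Pol h2 ?_
    rw [e, map_sub, h1, zero_sub]
    exact neg_mem h3
  rw [LinearMap.lTensor_sub, LinearMap.sub_apply, LinearMap.lTensor_id, LinearMap.id_apply,
    sub_eq_zero] at h4
  rw [h4]
  exact box_map (fun c _ d _ => tmul_mem_box Submodule.mem_top (hπ1 d)) (mem_box_top φ)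

/-- A system of monic operators in `x` is injective on functions that are polynomial in `z`. -/
lemma eq_zero_of_monic_system {Ξ : Fin r → Fin r → DiffOp} {n : Fin r → ℕ} {c : Fin r → RatFunc ℂ}
    (hc : ∀ i, c i ≠ 0) (h1 : ∀ i l k, n i < k → Ξ i l k = 0)
    (h2 : ∀ i l, Ξ i l (n i) = if i = l then c i else 0) {σ : Fin r → Fun2}
    (hσ : ∀ l, σ l ∈ box ⊤ Pol) (h : ∀ i, ∑ l, aX (Ξ i l) (σ l) = 0) : σ = 0 := by
  -- If σ has degree at most N in z, the coefficient of z^(N + n i) in the ith equation is c_i times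
  -- the coefficient of z^N in σ_i. So the degree drops until σ is proper in z, while still
  -- polynomial.
  have key : ∀ N, (∀ l, σ l ∈ box ⊤ (F N)) → ∀ l, σ l ∈ box ⊤ (F 0) := by
    intro N
    induction N with
    | zero => exact id
    | succ N ih =>
      intro hN
      refine ih fun i => ?_
      have h3 : coefZ N (σ i) = 0 := by
        have h4 := congrArg (coefZ (N + n i)) (h i)
        rw [map_zero, map_sum, Finset.sum_congr rfl fun l _ => (aX_lead (h1 i l) (hN l)).2] at h4
        simp only [h2, ite_mul, zero_mul, Finset.sum_ite_eq, Finset.mem_univ, if_true] at h4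
        exact (mul_eq_zero.1 h4).resolve_left (hc i)
      have := sub_coefZ_mem (hN i)
      rwa [h3, TensorProduct.zero_tmul, sub_zero] at this
  obtain ⟨N, hN⟩ := exists_forall_mem_box_F σ
  funext l
  have := key N hN l
  rw [F_zero] at this
  exact box_Pr_inf_Pol_right this (hσ l)

/-- Sought is D(z) with ψ ⋆ D = θ(x)e_j and θ ≠ 0. Dividing θe_j by ψ leaves a remainder ρ(θ),
linear in θ. Applying the operators Ξ_i with Ξ_i.ψ = p_i e_i sends the remainders into a
finite-dimensional space, so some θ ≠ 0 goes to zero; and the system Ξ is injective. -/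
lemma HalfBaker.dual {ψ : Matrix (Fin r) (Fin r) Fun2} (h : HalfBaker ψ) :
    HalfBaker (dualFun ψ) := by
  have hsub : ∀ i j, (dualFun ψ - 1) i j ∈ box Pr Pr := fun i j => by
    rw [dualFun_sub_one, sw_mem_box]
    exact h.sub_one_mem j i
  refine ⟨hsub, fun j => ?_⟩
  choose p hp Ξ hΞ using h.exists_row
  -- division of the multiples of `e_j` by the columns of `ψ`
  have hdiv : ∀ k : ℕ, ∃ D : Fin r → DiffOp, ∀ l,
      unitRow (Polynomial.X ^ k) j l - rowOp D (dualFun ψ) l ∈ box Finf.toSubmodule Pr := by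
    intro k
    obtain ⟨D, -, hD⟩ := exists_division Finf deriv_mem_Finf
      (fun i j => box_mono Pr_le_Finf le_rfl (hsub i j)) (k + 1) (unitRow (Polynomial.X ^ k) j)
      (fun l => unitRow_mem (by
        rw [Polynomial.degree_X_pow]
        exact_mod_cast Nat.lt_succ_self k) j l)
    exact ⟨D, hD⟩
  choose D₀ hD₀ using hdiv
  -- The quotients chosen for the powers of z are extended linearly, since the dimension count needs
  -- linearity in θ.
  set D : ℂ[X] →ₗ[ℂ] (Fin r → DiffOp) := (Polynomial.basisMonomials ℂ).constr ℂ D₀ with hD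
  set ρ : ℂ[X] →ₗ[ℂ] (Fin r → Fun2) := unitRowL j - rowOpL (dualFun ψ) ∘ₗ D with hρ
  have hρ_apply : ∀ θ l, ρ θ l = unitRow θ j l - rowOp (D θ) (dualFun ψ) l := fun θ l => rfl
  have hρ_mem : ∀ θ l, ρ θ l ∈ box Finf.toSubmodule Pr := by
    intro θ l
    induction θ using Polynomial.induction_on' with
    | add a b ha hb =>
      rw [map_add]
      exact add_mem ha hb
    | monomial k c =>
      rw [← Polynomial.smul_X_eq_monomial, map_smul]
      refine Submodule.smul_mem _ c ?_
      rw [hρ_apply]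
      have : D (Polynomial.X ^ k) = D₀ k := by
        rw [hD, ← Polynomial.monomial_one_right_eq_X_pow]
        have := Module.Basis.constr_basis (Polynomial.basisMonomials ℂ) ℂ D₀ k
        rwa [Polynomial.coe_basisMonomials] at this
      rw [this]
      exact hD₀ k l
  have hρ_sw : ∀ θ l, sw (ρ θ l) = sw (unitRow θ j l) - ∑ m, aZ (D θ m) (ψ l m) := by
    intro θ l
    rw [hρ_apply, map_sub, rowOp, map_sum]
    simp only [sw_aX, dualFun_apply, sw_sw]
  have hunit : ∀ θ l, sw (unitRow θ j l) = if j = l then toK θ ⊗ₜ[ℂ] 1 else 0 := by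
    intro θ l
    rw [unitRow]
    split_ifs with hjl
    · rw [hjl, Pi.single_eq_same, sw_tmul]
    · rw [Pi.single_eq_of_ne' hjl, map_zero]
  obtain ⟨θ₀, hθ₀, hden⟩ := exists_common_denom fun q : Fin r × Fin r => ψ q.1 q.2
  set B := Pr ⊓ Pol.comap (LinearMap.mulLeft ℂ (toK θ₀)) with hB
  -- The poles in x of the remainders are bounded by those of ψ, because operators in z create no
  -- poles in x. Being also proper in x, the remainders lie in B ⊗ ℂ(z) with B finite-dimensional
  -- and independent of θ.
  have hρ_B : ∀ θ l, sw (ρ θ l) ∈ box B ⊤ := by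
    intro θ l
    refine box_inf_box_left (box_mono le_rfl le_top (sw_mem_box.2 (hρ_mem θ l))) ?_
    have h1 : mX (toK θ₀) (sw (ρ θ l)) ∈ box Pol ⊤ := by
      rw [hρ_sw, map_sub, map_sum, hunit]
      refine sub_mem ?_ (Submodule.sum_mem _ fun m _ => ?_)
      · split_ifs
        · rw [mX_tmul]
          exact tmul_mem_box (Pol_mul (toK_mem_Pol _) (toK_mem_Pol _)) Submodule.mem_top
        · rw [map_zero]
          exact zero_mem _
      · rw [mX_aZ]
        exact aZ_mem_Pol _ (hden (l, m))
    rw [← mX_one (sw (ρ θ l)), ← inv_mul_cancel₀ (toK_ne_zero hθ₀), ← mX_mX]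
    refine mX_mem (fun b hb => ?_) h1
    rw [Submodule.mem_comap, LinearMap.mulLeft_apply, mul_inv_cancel_left₀ (toK_ne_zero hθ₀)]
    exact hb
  choose B' hB' hB'_mem using fun q : Fin r × Fin r =>
    exists_common_fg (Ξ q.1 q.2) (fg_proper_denom hθ₀)
  set C : Fin r → Submodule ℂ (RatFunc ℂ) := fun i => Finset.univ.sup fun l => B' (i, l) with hC
  set g : ℂ[X] →ₗ[ℂ] (Fin r → Fun2) := LinearMap.pi fun i =>
    ∑ l, aX (Ξ i l) ∘ₗ sw.toLinearMap ∘ₗ LinearMap.proj l ∘ₗ ρ with hg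
  have hg_apply : ∀ θ i, g θ i = ∑ l, aX (Ξ i l) (sw (ρ θ l)) := by
    intro θ i
    rw [hg, LinearMap.pi_apply, LinearMap.sum_apply]
    rfl
  have hfg : (Submodule.pi Set.univ fun i =>
      box (C i) (Pol ⊓ F (0 + (p i).natDegree + 1))).FG :=
    Submodule.fg_pi fun i =>
      fg_box (Submodule.fg_finset_sup _ _ fun l _ => hB' (i, l)) (fg_poly_F _)
  obtain ⟨θ, hθ, hgθ⟩ := exists_ne_zero_of_fg g hfg (fun θ i _ => by
    rw [hg_apply]
    refine box_inf_box ?_ ?_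
    · refine Submodule.sum_mem _ fun l _ => box_mono ?_ le_rfl (hB'_mem (i, l) _ (hρ_B θ l))
      exact Finset.le_sup (f := fun l => B' (i, l)) (Finset.mem_univ l)
    have hN : ∑ l, aX (Ξ i l) (sw (ρ θ l)) ∈ box ⊤ (F (0 + (p i).natDegree + 1)) :=
      Submodule.sum_mem _ fun l _ => (aX_lead ((h.row_spec (hΞ i)).2.1 l)
        (box_mono le_top le_rfl (sw_mem_box.2 (hρ_mem θ l)))).1
    have hPr : ∑ l, aX (Ξ i l) (sw (ρ θ l)) ∈ box Pr ⊤ := by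
      refine Submodule.sum_mem _ fun l _ => aX_mem (fun _ ha => Pr_deriv ha)
        (fun _ _ => Submodule.mem_top)
        (fun k a ha => Finf_mul_Pr ((h.row_spec (hΞ i)).1 l k) ha)
        (box_mono le_rfl le_top (sw_mem_box.2 (hρ_mem θ l)))
    -- Applying Ξ_i to θe_j - ψ ⋆ D gives Ξ_ij.θ(x), constant in z in the factor of e^{xz} up to the
    -- powers of z from ∂_x, minus (p_i e_i) ⋆ D, which is polynomial in x. With properness in x
    -- this forces polynomiality in z.
    have hPol : ∑ l, aX (Ξ i l) (sw (ρ θ l)) ∈ box ⊤ Pol := by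
      refine mem_box_Pol_of_sub hPr (a := aX (Ξ i j) (toK θ ⊗ₜ[ℂ] 1))
        (b := ∑ m, aZ (D θ m) (unitRow (p i) i m)) ?_ ?_ ?_
      · exact aX_mem_Pol _ (tmul_mem_box Submodule.mem_top ⟨1, map_one _⟩)
      · refine Submodule.sum_mem _ fun m _ => aZ_mem_Pol _ ?_
        rw [unitRow]
        rcases eq_or_ne i m with rfl | hm
        · rw [Pi.single_eq_same]
          exact tmul_mem_box ⟨1, map_one _⟩ Submodule.mem_top
        · rw [Pi.single_eq_of_ne' hm]
          exact zero_mem _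
      · simp only [hρ_sw, map_sub, Finset.sum_sub_distrib, map_sum, hunit]
        congr 1
        · rw [Finset.sum_eq_single_of_mem j (Finset.mem_univ j), if_pos rfl]
          intro l _ hl
          rw [if_neg hl.symm, map_zero]
        · rw [Finset.sum_comm]
          refine Finset.sum_congr rfl fun m _ => ?_
          rw [← hΞ i, rowOp, map_sum]
          exact Finset.sum_congr rfl fun l _ => aX_aZ _ _ _
    have := box_inf_box_left (sw_mem_box.2 hPol) (sw_mem_box.2 hN)
    exact sw_mem_box.1 this)
  refine ⟨θ, hθ, D θ, ?_⟩
  -- Injectivity of the system is known for functions polynomial in z; multiplication by q(z), which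
  -- commutes with operators in x, reduces to that case.
  obtain ⟨q, hq, hq_mem⟩ := exists_common_denomZ fun l => sw (ρ θ l)
  have hσ : (fun l => mZ (toK q) (sw (ρ θ l))) = 0 := by
    refine eq_zero_of_monic_system (Ξ := Ξ) (n := fun i => (p i).natDegree)
      (c := fun i => algebraMap ℂ _ (p i).leadingCoeff) (fun i => ?_)
      (fun i => (h.row_spec (hΞ i)).2.1) (fun i => (h.row_spec (hΞ i)).2.2) hq_mem fun i => ?_
    · rw [Ne, FaithfulSMul.algebraMap_eq_zero_iff, Polynomial.leadingCoeff_eq_zero]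
      exact hp i
    · simp only [← mZ_aX]
      rw [← map_sum, ← hg_apply, hgθ, Pi.zero_apply, map_zero]
  funext l
  have h1 : mZ (toK q) (sw (ρ θ l)) = 0 := congrFun hσ l
  have h2 : ρ θ l = 0 := by
    apply sw.injective
    apply mZ_injective (toK_ne_zero hq)
    rw [h1, map_zero, map_zero]
  rw [hρ_apply, sub_eq_zero] at h2
  exact h2.symm

end

section

/-! ### Local analysis -/

variable {r : ℕ}

lemma regularAt_iff {c : ℂ} {f : RatFunc ℂ} :
    RegularAt c f ↔ ∃ a b : ℂ[X], b.eval c ≠ 0 ∧ f = toK a / toK b := by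
  constructor
  · exact fun h => ⟨f.num, f.denom, h, (RatFunc.num_div_denom f).symm⟩
  · rintro ⟨a, b, hb, rfl⟩ h0
    have hb0 : b ≠ 0 := by
      rintro rfl
      simp at hb
    obtain ⟨d, hd⟩ := RatFunc.denom_div_dvd a b
    apply hb
    rw [hd, Polynomial.eval_mul]
    have : (toK a / toK b).denom.eval c = 0 := h0
    rw [this, zero_mul]

/-- The ring of rational functions that are regular at `c`. -/
def Reg (c : ℂ) : Subalgebra ℂ (RatFunc ℂ) where
  carrier := {f | RegularAt c f}
  mul_mem' := by
    intro f g hf hg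
    obtain ⟨a, b, hb, rfl⟩ := regularAt_iff.1 hf
    obtain ⟨a', b', hb', rfl⟩ := regularAt_iff.1 hg
    refine regularAt_iff.2 ⟨a * a', b * b', ?_, ?_⟩
    · rw [Polynomial.eval_mul]
      exact mul_ne_zero hb hb'
    · simp only [toK, map_mul, div_mul_div_comm]
  add_mem' := by
    intro f g hf hg
    obtain ⟨a, b, hb, rfl⟩ := regularAt_iff.1 hf
    obtain ⟨a', b', hb', rfl⟩ := regularAt_iff.1 hg
    refine regularAt_iff.2 ⟨a * b' + b * a', b * b', ?_, ?_⟩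
    · rw [Polynomial.eval_mul]
      exact mul_ne_zero hb hb'
    · have h1 : toK b ≠ 0 := toK_ne_zero (by rintro rfl; simp at hb)
      have h2 : toK b' ≠ 0 := toK_ne_zero (by rintro rfl; simp at hb')
      rw [div_add_div _ _ h1 h2]
      simp only [toK, map_mul, map_add]
  algebraMap_mem' := by
    intro t
    refine regularAt_iff.2 ⟨Polynomial.C t, 1, ?_, ?_⟩
    · simp
    · rw [toK_C, toK, map_one, div_one]

lemma toK_mem_Reg (p : ℂ[X]) (c : ℂ) : toK p ∈ Reg c :=
  regularAt_iff.2 ⟨p, 1, by simp, by simp [toK]⟩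

lemma inv_toK_mem_Reg {p : ℂ[X]} {c : ℂ} (h : p.eval c ≠ 0) : (toK p)⁻¹ ∈ Reg c :=
  regularAt_iff.2 ⟨1, p, h, by simp [toK]⟩

lemma mem_Pol_of_forall_regularAt {f : RatFunc ℂ} (h : ∀ c, RegularAt c f) : f ∈ Pol := by
  have h1 : f.denom.degree = 0 := by
    by_contra h0
    obtain ⟨c, hc⟩ := IsAlgClosed.exists_root f.denom h0
    exact h c hc
  have h2 : f.denom = 1 := by
    have := RatFunc.monic_denom f
    exact this.natDegree_eq_zero.1 (Polynomial.natDegree_eq_of_degree_eq_some h1)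
  refine ⟨f.num, ?_⟩
  have := RatFunc.num_div_denom f
  rwa [h2, map_one, div_one] at this

lemma toK_X_sub_C (c : ℂ) : toK (Polynomial.X - Polynomial.C c) = linFactor c := by
  rw [toK, map_sub, RatFunc.algebraMap_X, RatFunc.algebraMap_C, linFactor]

lemma linFactor_ne_zero (c : ℂ) : linFactor c ≠ 0 := by
  rw [← toK_X_sub_C]
  exact toK_ne_zero (Polynomial.X_sub_C_ne_zero c)

/-- The functions `(z - c) ^ N f` with `f` regular at `c`. -/
def powReg (c : ℂ) (N : ℕ) : Submodule ℂ (RatFunc ℂ) :=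
  (Reg c).toSubmodule.comap (LinearMap.mulLeft ℂ (linFactor c ^ N)⁻¹)

lemma mem_powReg {c : ℂ} {N : ℕ} {f : RatFunc ℂ} :
    f ∈ powReg c N ↔ (linFactor c ^ N)⁻¹ * f ∈ Reg c := Iff.rfl

lemma mem_powReg_iff {c : ℂ} {N : ℕ} {f : RatFunc ℂ} :
    f ∈ powReg c N ↔ ∃ u ∈ Reg c, f = linFactor c ^ N * u := by
  have h := pow_ne_zero N (linFactor_ne_zero c)
  constructor
  · exact fun hf => ⟨(linFactor c ^ N)⁻¹ * f, hf, (mul_inv_cancel_left₀ h f).symm⟩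
  · rintro ⟨u, hu, rfl⟩
    rwa [mem_powReg, inv_mul_cancel_left₀ h]

lemma mem_powReg_zero {c : ℂ} {f : RatFunc ℂ} : f ∈ powReg c 0 ↔ f ∈ Reg c := by
  rw [mem_powReg, pow_zero, inv_one, one_mul]

lemma linFactor_mem_Reg (c d : ℂ) : linFactor c ∈ Reg d := toK_X_sub_C c ▸ toK_mem_Reg _ _

lemma powReg_antitone {c : ℂ} {M N : ℕ} (h : M ≤ N) : powReg c N ≤ powReg c M := by
  intro f hf
  obtain ⟨u, hu, rfl⟩ := mem_powReg_iff.1 hf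
  refine mem_powReg_iff.2 ⟨linFactor c ^ (N - M) * u,
    (Reg c).mul_mem ((Reg c).pow_mem (linFactor_mem_Reg c c) _) hu, ?_⟩
  rw [← mul_assoc, ← pow_add, Nat.add_sub_cancel' h]

lemma toK_mem_powReg {c : ℂ} {N : ℕ} {p : ℂ[X]} (h : (Polynomial.X - Polynomial.C c) ^ N ∣ p) :
    toK p ∈ powReg c N := by
  obtain ⟨q, rfl⟩ := h
  exact mem_powReg_iff.2 ⟨toK q, toK_mem_Reg _ _, by
    rw [← toK_X_sub_C, toK, toK, toK, map_mul, map_pow]⟩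

/-- The cofactor of (z - c)^mult in p is a unit of the local ring at c. -/
lemma exists_linFactor_pow_mul_mem {p : ℂ[X]} (hp : p ≠ 0) (c : ℂ) {f : RatFunc ℂ}
    (h : toK p * f ∈ Reg c) : linFactor c ^ p.rootMultiplicity c * f ∈ Reg c := by
  obtain ⟨q, e, hq⟩ := Polynomial.exists_eq_pow_rootMultiplicity_mul_and_not_dvd p hp c
  have hq0 : q.eval c ≠ 0 := fun h0 => hq (Polynomial.dvd_iff_isRoot.2 h0)
  have hq' : toK q ≠ 0 := toK_ne_zero (by rintro rfl; simp at hq0)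
  have h2 := (Reg c).mul_mem (inv_toK_mem_Reg hq0) h
  have e2 : toK p = linFactor c ^ p.rootMultiplicity c * toK q := by
    conv_lhs => rw [e]
    rw [← toK_X_sub_C, toK, toK, toK, map_mul, map_pow]
  have e3 : (toK q)⁻¹ * (toK p * f) = linFactor c ^ p.rootMultiplicity c * f := by
    rw [e2]
    field_simp
  rwa [e3] at h2

/-- A function that vanishes to the order of `p` at every point is a multiple of `p`. -/
lemma exists_eq_mul_of_forall_mem_powReg {p : ℂ[X]} (hp : p ≠ 0) {f : RatFunc ℂ}
    (h : ∀ c, f ∈ powReg c (p.rootMultiplicity c)) : ∃ g : ℂ[X], f = toK (p * g) := by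
  have hp' := toK_ne_zero hp
  have h1 : (toK p)⁻¹ * f ∈ Pol := by
    refine mem_Pol_of_forall_regularAt fun c => ?_
    obtain ⟨q, e, hq⟩ := Polynomial.exists_eq_pow_rootMultiplicity_mul_and_not_dvd p hp c
    have hq0 : q.eval c ≠ 0 := fun h0 => hq (Polynomial.dvd_iff_isRoot.2 h0)
    have e2 : toK p = linFactor c ^ p.rootMultiplicity c * toK q := by
      conv_lhs => rw [e]
      rw [← toK_X_sub_C, toK, toK, toK, map_mul, map_pow]
    rw [e2, mul_inv, mul_comm (_ ^ _)⁻¹, mul_assoc]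
    exact (Reg c).mul_mem (inv_toK_mem_Reg hq0) (h c)
  obtain ⟨g, hg⟩ := h1
  refine ⟨g, ?_⟩
  rw [toK, map_mul, ← toK, ← toK, hg, mul_inv_cancel_left₀ hp']

lemma exists_pow_mul_mem_Reg (c : ℂ) (a : RatFunc ℂ) : ∃ m : ℕ, linFactor c ^ m * a ∈ Reg c := by
  obtain ⟨n, d, hd, rfl⟩ := exists_div a
  refine ⟨_, exists_linFactor_pow_mul_mem hd c ?_⟩
  rw [mul_div_cancel₀ _ (toK_ne_zero hd)]
  exact toK_mem_Reg _ _

/-- An operator maps polynomials that vanish to high order at `c` to functions that vanish to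
high order at `c`. -/
lemma exists_order_shift (D : DiffOp) (c : ℂ) (N : ℕ) : ∃ K₀ : ℕ, ∀ K, K₀ ≤ K → ∀ g : ℂ[X],
    (Polynomial.X - Polynomial.C c) ^ K ∣ g → aK D (toK g) ∈ powReg c N := by
  induction D using Finsupp.induction_linear with
  | zero => exact ⟨0, fun K _ g _ => by rw [map_zero, LinearMap.zero_apply]; exact zero_mem _⟩
  | add D E hD hE =>
    obtain ⟨K₁, h1⟩ := hD
    obtain ⟨K₂, h2⟩ := hE
    refine ⟨max K₁ K₂, fun K hK g hg => ?_⟩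
    rw [map_add, LinearMap.add_apply]
    exact add_mem (h1 K (by omega) g hg) (h2 K (by omega) g hg)
  | single k a =>
    obtain ⟨m, hm⟩ := exists_pow_mul_mem_Reg c a
    -- The k derivatives cost k orders of vanishing, and the pole of the coefficient a costs at most
    -- m.
    refine ⟨k + (N + m), fun K hK g hg => ?_⟩
    rw [aK_single, dK_pow, iterate_ratDeriv_toK]
    have h1 := Polynomial.pow_sub_dvd_iterate_derivative_of_pow_dvd k hg
    have h2 := toK_mem_powReg ((pow_dvd_pow _ (by omega : N + m ≤ K - k)).trans h1)
    obtain ⟨u, hu, e⟩ := mem_powReg_iff.1 h2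
    refine mem_powReg_iff.2 ⟨linFactor c ^ m * a * u, (Reg c).mul_mem hm hu, ?_⟩
    rw [e, pow_add]
    ring

lemma isCoprime_pow_prod (Z : Finset ℂ) {c : ℂ} (hc : c ∉ Z) (K : ℕ) :
    IsCoprime ((Polynomial.X - Polynomial.C c) ^ K)
      (∏ μ ∈ Z, (Polynomial.X - Polynomial.C μ) ^ K) := by
  refine IsCoprime.prod_right fun μ hμ => IsCoprime.pow ?_
  refine Polynomial.isCoprime_X_sub_C_of_isUnit_sub (IsUnit.mk0 _ (sub_ne_zero.2 ?_))
  rintro rfl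
  exact hc hμ

/-! ### Primary decomposability and differential operators -/

/-- Taylor expansion around z, evaluated at c, gives g(c) = ∑ (c - z)^k g⁽ᵏ⁾(z)/k!; truncation at K
leaves only multiples of (z - c)^K. -/
lemma taylor_dvd (c : ℂ) (K : ℕ) (g : ℂ[X]) :
    (Polynomial.X - Polynomial.C c) ^ K ∣
      ∑ k ∈ Finset.range K, (Polynomial.C c - Polynomial.X) ^ k * Polynomial.hasseDeriv k g -
        Polynomial.C (g.eval c) := by
  induction g using Polynomial.induction_on' with
  | add p q hp hq =>
    convert dvd_add hp hq using 1
    simp only [map_add, mul_add, Finset.sum_add_distrib, Polynomial.eval_add]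
    ring
  | monomial n a =>
    have h1 : ∑ k ∈ Finset.range (n + 1), (Polynomial.C c - Polynomial.X) ^ k *
        Polynomial.hasseDeriv k (Polynomial.monomial n a) =
          Polynomial.C ((Polynomial.monomial n a).eval c) := by
      have h2 := add_pow (Polynomial.C c - Polynomial.X) Polynomial.X n
      rw [sub_add_cancel] at h2
      rw [Polynomial.eval_monomial, map_mul, map_pow, h2, Finset.mul_sum]
      refine Finset.sum_congr rfl fun k _ => ?_
      rw [Polynomial.hasseDeriv_monomial, ← Polynomial.C_mul_X_pow_eq_monomial, map_mul,
        map_natCast]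
      ring
    have h3 : ∑ k ∈ Finset.range (max K (n + 1)), (Polynomial.C c - Polynomial.X) ^ k *
        Polynomial.hasseDeriv k (Polynomial.monomial n a) =
          Polynomial.C ((Polynomial.monomial n a).eval c) := by
      rw [← h1]
      symm
      refine Finset.sum_subset (Finset.range_mono (le_max_right _ _)) fun k _ hk => ?_
      rw [Finset.mem_range, not_lt] at hk
      rw [Polynomial.hasseDeriv_monomial, Nat.choose_eq_zero_of_lt (by omega), Nat.cast_zero,
        zero_mul, map_zero, mul_zero]
    rw [← h3, ← Finset.sum_range_add_sum_Ico _ (le_max_left K (n + 1)), sub_add_cancel_left,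
      dvd_neg]
    refine Finset.dvd_sum fun k hk => Dvd.dvd.mul_right ?_ _
    refine (pow_dvd_pow _ (Finset.mem_Ico.1 hk).1).trans ?_
    have e : (Polynomial.C c - Polynomial.X) ^ k =
        (-1) ^ k * (Polynomial.X - Polynomial.C c) ^ k := by
      rw [← neg_sub, neg_pow]
    rw [e]
    exact dvd_mul_left _ _

/-- There is an operator `E` with `E.1 = 1` that maps all polynomials to polynomials that are
constant up to order `K` at `c`. -/
lemma exists_local_constant_op (c : ℂ) (K : ℕ) (hK : 0 < K) : ∃ E : DiffOp, aK E 1 = 1 ∧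
    ∀ g : ℂ[X], ∃ h : ℂ[X], aK E (toK g) = toK h ∧
      ∃ a : ℂ, (Polynomial.X - Polynomial.C c) ^ K ∣ h - Polynomial.C a := by
  have hE : ∀ g : ℂ[X], aK (∑ k ∈ Finset.range K, Finsupp.single k
      (toK (Polynomial.C ((k.factorial : ℂ)⁻¹) * (Polynomial.C c - Polynomial.X) ^ k))) (toK g) =
      toK (∑ k ∈ Finset.range K, (Polynomial.C c - Polynomial.X) ^ k *
        Polynomial.hasseDeriv k g) := by
    intro g
    have hs : ∀ f : ℕ → ℂ[X], toK (∑ k ∈ Finset.range K, f k) =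
        ∑ k ∈ Finset.range K, toK (f k) := fun f => map_sum _ _ _
    rw [map_sum, LinearMap.sum_apply, hs]
    refine Finset.sum_congr rfl fun k _ => ?_
    rw [aK_single, dK_pow, iterate_ratDeriv_toK, toK, toK, ← map_mul]
    congr 1
    have h1 := congrFun (Polynomial.factorial_smul_hasseDeriv (R := ℂ) k) g
    have h0 : (k.factorial : ℂ) ≠ 0 := by exact_mod_cast k.factorial_ne_zero
    rw [← h1, LinearMap.smul_apply, ← Nat.cast_smul_eq_nsmul ℂ, Polynomial.smul_eq_C_mul,
      mul_assoc, mul_left_comm _ (Polynomial.C (k.factorial : ℂ)), ← mul_assoc, ← Polynomial.C_mul,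
      inv_mul_cancel₀ h0, Polynomial.C_1, one_mul]
  refine ⟨_, ?_, fun g => ⟨_, hE g, _, taylor_dvd c K g⟩⟩
  have h1 := hE 1
  have h2 : toK 1 = 1 := map_one _
  rw [h2] at h1
  rw [h1, ← h2]
  congr 1
  rw [Finset.sum_eq_single_of_mem 0 (Finset.mem_range.2 hK)]
  · simp
  · intro k _ hk
    rw [Polynomial.hasseDeriv_apply_one _ (Nat.pos_of_ne_zero hk), mul_zero]

/-- The same for finitely many points. -/
lemma exists_constant_op (Z : Finset ℂ) (K : ℕ) (hK : 0 < K) : ∃ E : DiffOp, aK E 1 = 1 ∧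
    ∀ g : ℂ[X], ∃ h : ℂ[X], aK E (toK g) = toK h ∧
      ∀ c ∈ Z, ∃ a : ℂ, (Polynomial.X - Polynomial.C c) ^ K ∣ h - Polynomial.C a := by
  classical
  induction Z using Finset.induction_on with
  | empty => exact ⟨Finsupp.single 0 1, by simp [aK_single], fun g => ⟨g, by simp [aK_single],
      fun c hc => absurd hc (Finset.notMem_empty c)⟩⟩
  | insert c Z hc ih =>
    obtain ⟨E, hE1, hE⟩ := ih
    obtain ⟨E', hE1', hE'⟩ := exists_local_constant_op c K hK
    obtain ⟨u, v, huv⟩ := isCoprime_pow_prod Z hc K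
    have huv' : toK (u * (Polynomial.X - Polynomial.C c) ^ K) +
        toK (v * ∏ μ ∈ Z, (Polynomial.X - Polynomial.C μ) ^ K) = 1 := by
      rw [← map_add, huv, map_one]
    -- Chinese remainder gluing: the coefficient of E is 1 modulo order K on Z and vanishes at c,
    -- and conversely for E'.
    refine ⟨toK (u * (Polynomial.X - Polynomial.C c) ^ K) • E +
      toK (v * ∏ μ ∈ Z, (Polynomial.X - Polynomial.C μ) ^ K) • E', ?_, fun g => ?_⟩
    · rw [map_add, LinearMap.add_apply, aK_smul, aK_smul, hE1, hE1', mul_one, mul_one, huv']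
    · obtain ⟨h, e, hh⟩ := hE g
      obtain ⟨h', e', hh'⟩ := hE' g
      refine ⟨u * (Polynomial.X - Polynomial.C c) ^ K * h +
        v * (∏ μ ∈ Z, (Polynomial.X - Polynomial.C μ) ^ K) * h', ?_, ?_⟩
      · rw [map_add, LinearMap.add_apply, aK_smul, aK_smul, e, e']
        simp only [toK, map_add, map_mul]
      · intro μ hμ
        rcases Finset.mem_insert.1 hμ with rfl | hμ
        · obtain ⟨a, ha⟩ := hh'
          refine ⟨a, ?_⟩
          have e3 : u * (Polynomial.X - Polynomial.C μ) ^ K * h +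
              v * (∏ μ ∈ Z, (Polynomial.X - Polynomial.C μ) ^ K) * h' - Polynomial.C a =
              (Polynomial.X - Polynomial.C μ) ^ K * (u * (h - h')) + (h' - Polynomial.C a) := by
            linear_combination h' * huv
          rw [e3]
          exact dvd_add (dvd_mul_right _ _) ha
        · obtain ⟨a, ha⟩ := hh μ hμ
          refine ⟨a, ?_⟩
          have e3 : u * (Polynomial.X - Polynomial.C c) ^ K * h +
              v * (∏ μ ∈ Z, (Polynomial.X - Polynomial.C μ) ^ K) * h' - Polynomial.C a =
              (∏ μ ∈ Z, (Polynomial.X - Polynomial.C μ) ^ K) * (v * (h' - h)) +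
                (h - Polynomial.C a) := by
            linear_combination h * huv
          rw [e3]
          exact dvd_add ((Finset.dvd_prod_of_mem
            (fun μ => (Polynomial.X - Polynomial.C μ) ^ K) hμ).mul_right _) ha

/-- A primary decomposable space is spanned by the images of `1` under the operators in
`opM W`. -/
lemma exists_op_of_mem {W : Submodule ℂ (Fin r → RatFunc ℂ)} (hW : IsPrimaryDecomposable W)
    {f : Fin r → RatFunc ℂ} (hf : f ∈ W) : ∃ D ∈ opM W, ∀ j, aK (D j) 1 = f j := by
  obtain ⟨w, hw, hfin, rfl⟩ := hW
  choose N hN using hw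
  -- The operators sought are f_j E. At a special point c, f_j E.g is a constant multiple of f_j up
  -- to an error in (z - c)^K f_j. As f_j has a pole of order at most N c, K ≥ 2 N c puts the error
  -- in (z - c)^(N c) O_c; the + 1 makes K positive.
  obtain ⟨E, hE1, hE⟩ := exists_constant_op hfin.toFinset
    (hfin.toFinset.sup (fun c => 2 * N c) + 1) (Nat.succ_pos _)
  refine ⟨fun j => f j • E, ?_, fun j => by rw [aK_smul, hE1, mul_one]⟩
  rw [mem_opM]
  intro g
  obtain ⟨h, e, hh⟩ := hE g
  simp only [aK_smul, e]
  rw [Submodule.mem_iInf] at hf ⊢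
  intro c
  by_cases hc : c ∈ hfin.toFinset
  · obtain ⟨a, q, hq⟩ := hh c hc
    set K := hfin.toFinset.sup (fun c => 2 * N c) + 1 with hK
    have hKN : 2 * N c ≤ K :=
      (Finset.le_sup (f := fun c => 2 * N c) hc).trans (Nat.le_succ _)
    have e2 : (fun j => f j * toK h) = a • f + fun j => linFactor c ^ N c *
        (linFactor c ^ (K - 2 * N c) * toK q * (linFactor c ^ N c * f j)) := by
      funext j
      have e3 : toK h = algebraMap ℂ _ a + linFactor c ^ K * toK q := by
        rw [← toK_X_sub_C, ← toK_C]
        simp only [toK]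
        rw [← map_pow, ← map_mul, ← map_add, ← hq, add_sub_cancel]
      have e4 : linFactor c ^ K =
          linFactor c ^ N c * linFactor c ^ N c * linFactor c ^ (K - 2 * N c) := by
        rw [← pow_add, ← pow_add]
        congr 1
        omega
      rw [e3, e4, Pi.add_apply, Pi.smul_apply, Algebra.smul_def]
      ring
    rw [e2]
    refine add_mem ((w c).smul_mem a (hf c)) ((hN c).1 _ fun j => ?_)
    exact (Reg c).mul_mem ((Reg c).mul_mem ((Reg c).pow_mem (linFactor_mem_Reg c c) _)
      (toK_mem_Reg _ _)) ((hN c).2 f (hf c) j)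
  · rw [Set.Finite.mem_toFinset, Set.mem_ofPred_eq, not_not] at hc
    exact (hc _).2 fun j => (Reg c).mul_mem ((hc f).1 (hf c) j) (toK_mem_Reg _ _)

end

section

/-! ### A criterion for primary decomposability -/

variable {r : ℕ}

/-- Elements of `W` can be cut off to an arbitrary finite order at finitely many points. -/
lemma exists_localization {W : Submodule ℂ (Fin r → RatFunc ℂ)}
    (hW : W ≤ Submodule.span ℂ
      {w | ∃ D ∈ opM W, ∃ f : ℂ[X], w = fun j => aK (D j) (toK f)})
    (Z : Finset ℂ) (N : ℕ) (c : ℂ) {w : Fin r → RatFunc ℂ} (hw : w ∈ W) :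
    ∃ w' ∈ W, (∀ j, w' j - w j ∈ powReg c N) ∧ ∀ μ ∈ Z, μ ≠ c → ∀ j, w' j ∈ powReg μ N := by
  classical
  replace hw := hW hw
  induction hw using Submodule.span_induction with
  | mem w h =>
    obtain ⟨D, hD, f, rfl⟩ := h
    choose K₀ hK₀ using fun (j : Fin r) μ => exists_order_shift (D j) μ N
    set K := Finset.univ.sup fun j => (insert c Z).sup (K₀ j) with hK
    have hle : ∀ j, ∀ μ ∈ insert c Z, K₀ j μ ≤ K := fun j μ hμ =>
      (Finset.le_sup hμ).trans
        (Finset.le_sup (f := fun j => (insert c Z).sup (K₀ j)) (Finset.mem_univ j))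
    -- The multiplier v∏ is 1 modulo (z - c)^K and vanishes to order K at the other points.
    -- Replacing f by its product with this multiplier stays in W because D maps every polynomial
    -- into W.
    obtain ⟨u, v, huv⟩ := isCoprime_pow_prod (Z.erase c) (Finset.notMem_erase c Z) K
    refine ⟨fun j => aK (D j) (toK (f * (v * ∏ μ ∈ Z.erase c,
      (Polynomial.X - Polynomial.C μ) ^ K))), mem_opM.1 hD _, fun j => ?_, fun μ hμ hμc j => ?_⟩
    · rw [← map_sub, ← map_sub]
      refine hK₀ j c K (hle j c (Finset.mem_insert_self c Z)) _ ?_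
      have e : f * (v * ∏ μ ∈ Z.erase c, (Polynomial.X - Polynomial.C μ) ^ K) - f =
          (Polynomial.X - Polynomial.C c) ^ K * (-(f * u)) := by
        linear_combination f * huv
      rw [e]
      exact dvd_mul_right _ _
    · refine hK₀ j μ K (hle j μ (Finset.mem_insert_of_mem hμ)) _ ?_
      exact ((Finset.dvd_prod_of_mem (fun μ => (Polynomial.X - Polynomial.C μ) ^ K)
        (Finset.mem_erase.2 ⟨hμc, hμ⟩)).mul_left _).mul_left _
  | zero => exact ⟨0, W.zero_mem, fun j => by simp, fun μ _ _ j => zero_mem _⟩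
  | add x y hx hy ihx ihy =>
    obtain ⟨x', hx', h1, h2⟩ := ihx
    obtain ⟨y', hy', h1', h2'⟩ := ihy
    refine ⟨x' + y', W.add_mem hx' hy', fun j => ?_, fun μ hμ hμc j =>
      add_mem (h2 μ hμ hμc j) (h2' μ hμ hμc j)⟩
    rw [Pi.add_apply, Pi.add_apply, add_sub_add_comm]
    exact add_mem (h1 j) (h1' j)
  | smul t x hx ih =>
    obtain ⟨x', hx', h1, h2⟩ := ih
    refine ⟨t • x', W.smul_mem t hx', fun j => ?_, fun μ hμ hμc j =>
      Submodule.smul_mem _ t (h2 μ hμ hμc j)⟩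
    rw [Pi.smul_apply, Pi.smul_apply, ← smul_sub]
    exact Submodule.smul_mem _ t (h1 j)

/-- The local space at c is W plus the functions vanishing at c to the order of p. An element of all
of these agrees with some a_c in W near each bad point c; cutting off the a_c and adding them gives
an element of W that differs from it by a multiple of p. -/
lemma isPrimaryDecomposable_of_le_span {W : Submodule ℂ (Fin r → RatFunc ℂ)} (hfat : IsFat W)
    (hW : W ≤ Submodule.span ℂ
      {w | ∃ D ∈ opM W, ∃ f : ℂ[X], w = fun j => aK (D j) (toK f)}) :
    IsPrimaryDecomposable W := by
  classical
  obtain ⟨p, q, hp0, hq0, hp, hq⟩ := hfat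
  set Q : ℂ → Submodule ℂ (Fin r → RatFunc ℂ) := fun c =>
    Submodule.pi Set.univ fun _ => powReg c (p.rootMultiplicity c) with hQ
  have memQ : ∀ c f, f ∈ Q c ↔ ∀ j, f j ∈ powReg c (p.rootMultiplicity c) := fun c f => by
    simp [hQ, Submodule.mem_pi]
  have h1 : ∀ c (f : Fin r → RatFunc ℂ), (∀ j, RegularAt c (f j)) →
      (fun j => linFactor c ^ (p.rootMultiplicity c + q.rootMultiplicity c) * f j) ∈ W ⊔ Q c := by
    intro c f hf
    refine Submodule.mem_sup_right ((memQ _ _).2 fun j => ?_)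
    exact powReg_antitone (Nat.le_add_right _ _) (mem_powReg_iff.2 ⟨f j, hf j, rfl⟩)
  have h2 : ∀ c, ∀ f ∈ W ⊔ Q c, ∀ j,
      RegularAt c (linFactor c ^ (p.rootMultiplicity c + q.rootMultiplicity c) * f j) := by
    intro c f hf j
    obtain ⟨a, ha, b, hb, rfl⟩ := Submodule.mem_sup.1 hf
    rw [Pi.add_apply, mul_add]
    refine (Reg c).add_mem ?_ ?_
    · obtain ⟨g, hg⟩ := hq a ha
      have h3 : toK q * a j ∈ Reg c := by
        have : toK q * a j = toK (g j) := congrFun hg j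
        rw [this]
        exact toK_mem_Reg _ _
      rw [pow_add, mul_assoc]
      exact (Reg c).mul_mem ((Reg c).pow_mem (linFactor_mem_Reg c c) _)
        (exists_linFactor_pow_mul_mem hq0 c h3)
    · exact (Reg c).mul_mem ((Reg c).pow_mem (linFactor_mem_Reg c c) _)
        (mem_powReg_zero.1 (powReg_antitone (Nat.zero_le _) ((memQ _ _).1 hb j)))
  set Z := (p * q).roots.toFinset with hZ
  have h3 : ∀ c, c ∉ Z → p.rootMultiplicity c = 0 ∧ q.rootMultiplicity c = 0 := by
    intro c hc
    have hc' : ¬ (p * q).IsRoot c := fun h => hc (by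
      rw [hZ, Multiset.mem_toFinset]
      exact (Polynomial.mem_roots (mul_ne_zero hp0 hq0)).2 h)
    rw [Polynomial.IsRoot, Polynomial.eval_mul, mul_eq_zero, not_or] at hc'
    exact ⟨Polynomial.rootMultiplicity_eq_zero hc'.1, Polynomial.rootMultiplicity_eq_zero hc'.2⟩
  have h4 : ∀ c, c ∉ Z → ∀ f, f ∈ W ⊔ Q c ↔ ∀ j, RegularAt c (f j) := by
    intro c hc f
    have h1' := h1 c f
    have h2' := h2 c f
    rw [(h3 c hc).1, (h3 c hc).2] at h1' h2'
    simp only [add_zero, pow_zero, one_mul] at h1' h2'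
    exact ⟨h2', h1'⟩
  refine ⟨fun c => W ⊔ Q c, fun c => ⟨_, h1 c, h2 c⟩, Z.finite_toSet.subset fun c hc => ?_,
    le_antisymm (le_iInf fun c => le_sup_left) fun f hf => ?_⟩
  · by_contra hcZ
    exact hc (h4 c hcZ)
  · rw [Submodule.mem_iInf] at hf
    choose a ha b hb hab using fun c => Submodule.mem_sup.1 (hf c)
    -- `p.natDegree` bounds all root multiplicities of p, so one order of cut-off serves every
    -- point.
    choose a' ha' h5 h6 using fun c => exists_localization hW Z p.natDegree c (ha c)
    have hg : ∑ c ∈ Z, a' c ∈ W := W.sum_mem fun c _ => ha' c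
    have hmult : ∀ c, p.rootMultiplicity c ≤ p.natDegree := fun c => by
      rw [← Polynomial.count_roots]
      exact (Multiset.count_le_card _ _).trans (Polynomial.card_roots' p)
    have h7 : ∀ j c, f j - (∑ μ ∈ Z, a' μ) j ∈ powReg c (p.rootMultiplicity c) := by
      intro j c
      by_cases hc : c ∈ Z
      · have e : f j - (∑ μ ∈ Z, a' μ) j =
            b c j - (a' c j - a c j) - ∑ μ ∈ Z.erase c, a' μ j := by
          rw [Finset.sum_apply, ← Finset.add_sum_erase _ _ hc, ← hab c, Pi.add_apply]
          ring
        rw [e]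
        refine sub_mem (sub_mem ((memQ _ _).1 (hb c) j) (powReg_antitone (hmult c) (h5 c j)))
          (Submodule.sum_mem _ fun μ hμ => powReg_antitone (hmult c) ?_)
        exact h6 μ c hc (Finset.ne_of_mem_erase hμ).symm j
      · rw [(h3 c hc).1, mem_powReg_zero]
        exact (Reg c).sub_mem ((h4 c hc f).1 (hf c) j)
          ((h4 c hc _).1 (Submodule.mem_sup_left hg) j)
    choose g hfg using fun j => exists_eq_mul_of_forall_mem_powReg hp0 (h7 j)
    have e : f = polyVec (fun j => p * g j) + ∑ μ ∈ Z, a' μ := by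
      funext j
      exact sub_eq_iff_eq_add.1 (hfg j)
    rw [e]
    exact W.add_mem (hp g) hg

/-! ### Baker functions of points of the adelic Grassmannian -/

/-- The remainder of the division by ψ is again in `rowModule W` and vanishes at z = ∞, so it is
zero. -/
lemma exists_rowOp_eq {W : Submodule ℂ (Fin r → RatFunc ℂ)}
    (hL : leadingCoeffs W = Set.range polyVec) {ψ : Matrix (Fin r) (Fin r) Fun2}
    (hψ : IsBaker W ψ) {φ : Fin r → Fun2} (hφ : φ ∈ rowModule W) :
    ∃ Ξ : Fin r → DiffOp, rowOp Ξ ψ = φ := by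
  obtain ⟨n, hn⟩ := exists_forall_mem_box_F φ
  obtain ⟨Ξ, -, h⟩ := exists_division ⊤ (fun _ _ => Algebra.mem_top)
    (fun i j => by rw [Algebra.top_toSubmodule]; exact hψ.sub_one_mem i j) n φ
    (fun j => by rw [Algebra.top_toSubmodule]; exact hn j)
  refine ⟨Ξ, (sub_eq_zero.1 ?_).symm⟩
  refine rowModule_inf_vanish hL ((rowModule W).sub_mem hφ (rowOp_mem_rowModule hψ.2 Ξ))
    fun j => ?_
  have := h j
  rwa [Algebra.top_toSubmodule] at this

lemma sym_monoOp_zero (i : Fin r) (p : ℂ[X]) :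
    (fun j => sym (monoOp i 0 (toK p) j)) = unitRow p i := by
  funext j
  simp only [monoOp, LinearMap.comp_apply, LinearMap.coe_single, Finsupp.lsingle_apply, unitRow]
  rcases eq_or_ne i j with rfl | h
  · rw [Pi.single_eq_same, Pi.single_eq_same, sym_single, pow_zero]
  · rw [Pi.single_eq_of_ne' h, Pi.single_eq_of_ne' h, map_zero]

lemma rowOp_monoOp_zero (i : Fin r) (a : RatFunc ℂ) (ψ : Matrix (Fin r) (Fin r) Fun2) :
    rowOp (monoOp i 0 a) ψ = fun j => mX a (ψ i j) := by
  funext j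
  rw [rowOp, Finset.sum_eq_single_of_mem i (Finset.mem_univ i)]
  · simp only [monoOp, LinearMap.comp_apply, LinearMap.coe_single, Finsupp.lsingle_apply,
      Pi.single_eq_same, aX_single, pow_zero, Module.End.one_apply]
  · intro l _ hl
    simp only [monoOp, LinearMap.comp_apply, LinearMap.coe_single,
      Pi.single_eq_of_ne hl, map_zero, LinearMap.zero_apply]

/-- By fatness p(z)e_i, as an operator of order zero, is in `opM W`, so its symbol is a combination
of the rows of ψ. -/
lemma IsBaker.halfBaker {W : Submodule ℂ (Fin r → RatFunc ℂ)} (hW : W ∈ Grad r)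
    {ψ : Matrix (Fin r) (Fin r) Fun2} (hψ : IsBaker W ψ) : HalfBaker ψ := by
  obtain ⟨⟨p, q, hp0, -, hp, -⟩, -, hL⟩ := hW
  refine ⟨hψ.sub_one_mem_Pr hL, fun i => ⟨p, hp0, exists_rowOp_eq hL hψ ?_⟩⟩
  rw [← sym_monoOp_zero]
  have := monoOp_mem_opM hp i 0 1
  rw [mul_one] at this
  exact sym_mem_rowModule this

/-- The space spanned by the images of polynomials under the operators that correspond to
rows of the form `Ξ(x).ψ`. -/
def rowSpace (ψ : Matrix (Fin r) (Fin r) Fun2) : Submodule ℂ (Fin r → RatFunc ℂ) :=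
  Submodule.span ℂ {w | ∃ T : Fin r → DiffOp, (∃ Ξ, (fun j => sym (T j)) = rowOp Ξ ψ) ∧
    ∃ f : ℂ[X], w = fun j => aK (T j) (toK f)}

variable {ψ : Matrix (Fin r) (Fin r) Fun2}

lemma mem_opM_rowSpace {T Ξ : Fin r → DiffOp} (h : (fun j => sym (T j)) = rowOp Ξ ψ) :
    T ∈ opM (rowSpace ψ) :=
  mem_opM.2 fun p => Submodule.subset_span ⟨T, ⟨Ξ, h⟩, p, rfl⟩

lemma aK_mem_Pol {D : DiffOp} (h : ∀ k, D k ∈ Pol) (p : ℂ[X]) : aK D (toK p) ∈ Pol := by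
  rw [aK_apply]
  refine Submodule.sum_mem _ fun k _ => ?_
  simp only [dK_pow, iterate_ratDeriv_toK]
  exact Pol_mul (h k) (toK_mem_Pol _)

/-- The rows p_i(z)e_i = Ξ_i.ψ supply the lower bound. A common denominator of ψ in z supplies the
upper one, since operators in x create no poles in z. -/
lemma HalfBaker.isFat (hψ : HalfBaker ψ) : IsFat (rowSpace ψ) := by
  classical
  choose p hp0 Ξ hΞ using hψ.exists_row
  obtain ⟨q, hq0, hq⟩ := exists_common_denomZ fun a : Fin r × Fin r => ψ a.1 a.2
  refine ⟨∏ i, p i, q, Finset.prod_ne_zero_iff.2 fun i _ => hp0 i, hq0, fun f => ?_,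
    fun f hf => ?_⟩
  · have h1 : ∀ i (g : ℂ[X]), Pi.single i (toK (p i * g)) ∈ rowSpace ψ := by
      intro i g
      have := mem_opM.1 (mem_opM_rowSpace ((sym_monoOp_zero i (p i)).trans (hΞ i).symm)) g
      convert this using 1
      funext j
      simp only [monoOp, LinearMap.comp_apply, LinearMap.coe_single, Finsupp.lsingle_apply]
      rcases eq_or_ne i j with rfl | h
      · rw [Pi.single_eq_same, Pi.single_eq_same, aK_single, pow_zero, Module.End.one_apply]
        exact map_mul _ _ _
      · rw [Pi.single_eq_of_ne' h, Pi.single_eq_of_ne' h, map_zero, LinearMap.zero_apply]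
    have e : polyVec (fun j => (∏ i, p i) * f j) =
        ∑ i, Pi.single i (toK (p i * ((∏ l ∈ Finset.univ.erase i, p l) * f i))) := by
      rw [Finset.univ_sum_single]
      funext j
      rw [polyVec, ← mul_assoc, Finset.mul_prod_erase _ _ (Finset.mem_univ j)]
    rw [e]
    exact Submodule.sum_mem _ fun i _ => h1 i _
  · have h1 : rowSpace ψ ≤
        Submodule.pi Set.univ fun _ => Pol.comap (LinearMap.mulLeft ℂ (toK q)) := by
      refine Submodule.span_le.2 ?_
      rintro _ ⟨T, ⟨Ξ, hT⟩, g, rfl⟩ j -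
      have h2 : sym (toK q • T j) ∈ box ⊤ Pol := by
        rw [sym_smul, show sym (T j) = rowOp Ξ ψ j from congrFun hT j, rowOp, map_sum]
        refine Submodule.sum_mem _ fun i _ => ?_
        rw [mZ_aX]
        exact aX_mem_Pol _ (hq (i, j))
      have h3 := aK_mem_Pol (coeff_mem_of_sym_mem h2) g
      rwa [aK_smul] at h3
    choose g hg using fun j => h1 hf j (Set.mem_univ j)
    exact ⟨g, funext fun j => (hg j).symm⟩

lemma HalfBaker.isPrimaryDecomposable (hψ : HalfBaker ψ) : IsPrimaryDecomposable (rowSpace ψ) :=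
  isPrimaryDecomposable_of_le_span hψ.isFat (Submodule.span_mono fun _ ⟨T, ⟨_, h⟩, f, hf⟩ =>
    ⟨T, mem_opM_rowSpace h, f, hf⟩)

lemma mem_F_of_sym (D : DiffOp) {n : ℕ} (h : ∀ k, n < k → D k = 0) :
    sym D ∈ box (F (n + 1)) ⊤ := by
  rw [sym_apply]
  refine Submodule.sum_mem _ fun k hk => tmul_mem_box ?_ Submodule.mem_top
  have hk' : k ≤ n := by
    by_contra hcon
    exact Finsupp.mem_support_iff.1 hk (h k (not_le.1 hcon))
  exact F_mono (by omega) (X_pow_mem_F k)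

/-- Here duality enters: there is D(z) with ψ ⋆ D = χ(x)e_j. Then ⋆ D maps `rowSpace ψ` into ℂ[z],
so the product of T and D has polynomial coefficients; the one of order n + deg χ is a nonzero
multiple of the jth entry of the leading coefficient of T. -/
lemma HalfBaker.lead_mem_Pol (hψ : HalfBaker ψ) {T : Fin r → DiffOp}
    (hT : T ∈ opM (rowSpace ψ)) {n : ℕ} (hn : ∀ j k, n < k → T j k = 0) (j : Fin r) :
    T j n ∈ Pol := by
  obtain ⟨χ, hχ0, D, hD⟩ := hψ.dual.exists_row j
  obtain ⟨-, hord, hlead⟩ := hψ.dual.row_spec hD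
  set E : Matrix (Fin r) (Fin 1) DiffOp := Matrix.of fun l _ => D l with hE
  have h1 : ∀ i k, rightAct ψ E i k ∈ box ⊤ Pol := by
    intro i k
    have h2 : starZ (ψ i) E k = sw (unitRow χ j i) := by
      rw [← hD, rowOp, map_sum]
      simp only [sw_aX, dualFun_apply, sw_sw]
      rfl
    rw [rightAct_apply, h2, sw_mem_box, unitRow]
    rcases eq_or_ne j i with rfl | h
    · rw [Pi.single_eq_same]
      exact tmul_mem_box (by simpa [toK] using toK_mem_Pol 1) Submodule.mem_top
    · rw [Pi.single_eq_of_ne' h]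
      exact zero_mem _
  have h2 : E ∈ opSpace (rowSpace ψ) (Submodule.pi Set.univ fun _ => Pol) := by
    intro u hu
    induction hu using Submodule.span_induction with
    | mem u h =>
      obtain ⟨T, ⟨Ξ, hT⟩, f, rfl⟩ := h
      rw [← aK_compRow]
      intro k _
      refine aK_mem_Pol (coeff_mem_of_sym_mem ?_) f
      have := congrFun (sym_compRow T E) k
      rw [this, hT, starZ_rowOp]
      exact Submodule.sum_mem _ fun i _ => aX_mem_Pol _ (h1 i k)
    | zero =>
      rw [rowStar_eq]
      intro k _
      simp
    | add x y _ _ hx hy =>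
      rw [rowStar_eq] at *
      intro k hk
      have := add_mem (hx k hk) (hy k hk)
      simpa [Finset.sum_add_distrib] using this
    | smul t x _ hx =>
      rw [rowStar_eq] at *
      intro k hk
      have := Submodule.smul_mem _ t (hx k hk)
      simpa [Finset.smul_sum] using this
  have h3 : ∀ k, compRow T E 0 k ∈ Pol :=
    mem_Pol_of_aK_mem fun p => mem_opM.1 (compRow_mem_opM h2 hT) p 0 (Set.mem_univ _)
  have h4 : compRow T E 0 (n + χ.natDegree) = χ.leadingCoeff • T j n := by
    have h5 : ∀ l, coefX (n + χ.natDegree) (aZ (D l) (sym (T l))) =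
        if j = l then χ.leadingCoeff • T j n else 0 := by
      intro l
      rw [(aZ_lead (hord l) (mem_F_of_sym (T l) (hn l))).2, coefX_sym, hlead]
      split_ifs with h
      · rw [← h, Algebra.smul_def]
      · rw [zero_mul]
    have h6 := congrFun (sym_compRow T E) 0
    rw [← coefX_sym, h6, starZ, map_sum]
    exact (Finset.sum_congr rfl fun l _ => h5 l).trans (by simp)
  have h5 := h3 (n + χ.natDegree)
  rwa [h4, Pol.smul_mem_iff (Polynomial.leadingCoeff_ne_zero.2 hχ0)] at h5

lemma coefX_eq_zero {n k : ℕ} (h : n ≤ k) {φ : Fun2} (hφ : φ ∈ box (F n) ⊤) : coefX k φ = 0 := by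
  rw [← coefZ_sw]
  exact coefZ_eq_zero h (sw_mem_box.2 hφ)

lemma toK_mul_mem_F (p : ℂ[X]) {f : RatFunc ℂ} (hf : f ∈ Pr) :
    toK p * f ∈ F p.natDegree := by
  have h1 : ∀ k, toK (Polynomial.X ^ k) * f ∈ F k := by
    intro k
    induction k with
    | zero => simpa [toK, F_zero] using hf
    | succ k ih =>
      rw [pow_succ', toK, map_mul, RatFunc.algebraMap_X, mul_assoc]
      exact X_mul_mem_F ih
  have h2 : toK p =
      ∑ k ∈ Finset.range (p.natDegree + 1), p.coeff k • toK (Polynomial.X ^ k) := by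
    conv_lhs => rw [p.as_sum_range, toK, map_sum]
    refine Finset.sum_congr rfl fun k _ => ?_
    rw [← Polynomial.smul_X_eq_monomial]
    exact toK_smul _ _
  rw [h2, Finset.sum_mul]
  refine Submodule.sum_mem _ fun k hk => ?_
  rw [smul_mul_assoc]
  exact (F _).smul_mem _ (F_mono (Nat.lt_succ_iff.1 (Finset.mem_range.1 hk)) (h1 k))

/-- There are operators of the same order in `opM (rowSpace ψ)` whose leading coefficients
are the unit vectors up to a constant. -/
lemma HalfBaker.exists_op (hψ : HalfBaker ψ) : ∃ θ : ℂ[X], θ ≠ 0 ∧ ∃ T : Fin r → Fin r → DiffOp,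
    (∀ i, T i ∈ opM (rowSpace ψ)) ∧ (∀ i j, sym (T i j) = mX (toK θ) (ψ i j)) ∧
    ∀ i j k, θ.natDegree ≤ k →
      T i j k = if i = j then algebraMap ℂ (RatFunc ℂ) (θ.coeff k) else 0 := by
  obtain ⟨θ, hθ, h⟩ := exists_common_denom fun a : Fin r × Fin r => ψ a.1 a.2
  choose T hT using fun i j => exists_sym_eq (h (i, j))
  refine ⟨θ, hθ, T, fun i => ?_, hT, fun i j k hk => ?_⟩
  · exact mem_opM_rowSpace (Ξ := monoOp i 0 (toK θ)) (by
      rw [rowOp_monoOp_zero]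
      exact funext fun j => hT i j)
  · have e : ψ i j = (1 : Matrix (Fin r) (Fin r) Fun2) i j + (ψ - 1) i j := by
      rw [Matrix.sub_apply, add_sub_cancel]
    have h1 : mX (toK θ) ((ψ - 1) i j) ∈ box (F θ.natDegree) ⊤ := by
      exact mX_mem (fun b hb => toK_mul_mem_F θ hb)
        (box_mono le_rfl le_top (hψ.sub_one_mem i j))
    rw [← coefX_sym, hT]
    simp only
    rw [e, map_add, map_add, coefX_eq_zero hk h1, add_zero, Matrix.one_apply]
    split_ifs
    · rw [mX_apply, mul_one, coefX_tmul, coef_toK, Algebra.algebraMap_eq_smul_one]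
    · rw [map_zero, map_zero]

/-- Composition with z on the right multiplies the leading coefficient by z without changing the
order. All operators built this way share the order deg θ, so their leading coefficients can be
added. -/
lemma HalfBaker.polyVec_mem (hψ : HalfBaker ψ) (f : Fin r → ℂ[X]) :
    polyVec f ∈ leadingCoeffs (rowSpace ψ) := by
  obtain ⟨θ, hθ, T, hT, -, hTk⟩ := hψ.exists_op
  have hlc := Polynomial.leadingCoeff_ne_zero.2 hθ
  have key : ∀ i (g : ℂ[X]), ∃ D ∈ opM (rowSpace ψ), (∀ j k, θ.natDegree < k → D j k = 0) ∧
      ∀ j, D j θ.natDegree = if i = j then toK g else 0 := by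
    intro i g
    induction g using Polynomial.induction_on with
    | C a =>
      refine ⟨(a * θ.leadingCoeff⁻¹) • T i, (opM _).smul_mem _ (hT i), fun j k hk => ?_,
        fun j => ?_⟩
      · rw [Pi.smul_apply, Finsupp.smul_apply, hTk i j k hk.le,
          Polynomial.coeff_eq_zero_of_natDegree_lt hk, map_zero, ite_self, smul_zero]
      · rw [Pi.smul_apply, Finsupp.smul_apply, hTk i j _ le_rfl, smul_ite, smul_zero,
          Algebra.smul_def, ← map_mul, toK_C, Polynomial.coeff_natDegree,
          inv_mul_cancel_right₀ hlc]
    | add p q hp hq =>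
      obtain ⟨D, hD, h1, h2⟩ := hp
      obtain ⟨E, hE, h3, h4⟩ := hq
      refine ⟨D + E, add_mem hD hE, fun j k hk => ?_, fun j => ?_⟩
      · rw [Pi.add_apply, Finsupp.add_apply, h1 j k hk, h3 j k hk, add_zero]
      · rw [Pi.add_apply, Finsupp.add_apply, h2, h4]
        split_ifs
        · exact (map_add _ _ _).symm
        · exact add_zero _
    | monomial n a ih =>
      obtain ⟨D, hD, h1, h2⟩ := ih
      refine ⟨fun j => mulZ (D j), mulZ_mem_opM hD, fun j => (mulZ_lead (h1 j)).1, fun j => ?_⟩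
      rw [(mulZ_lead (h1 j)).2, h2]
      split_ifs
      · rw [← toK_X, pow_succ', mul_left_comm]
        exact (map_mul _ _ _).symm
      · exact mul_zero _
  choose D hD h1 h2 using fun i => key i (f i)
  refine ⟨∑ i, D i, Submodule.sum_mem _ fun i _ => hD i, θ.natDegree, fun k hk j => ?_,
    fun j => ?_⟩
  · rw [Finset.sum_apply, Finsupp.finsetSum_apply]
    exact Finset.sum_eq_zero fun i _ => h1 i j k hk
  · rw [Finset.sum_apply, Finsupp.finsetSum_apply]
    simp [h2, polyVec]

lemma HalfBaker.rowSpace_mem_Grad (hψ : HalfBaker ψ) : rowSpace ψ ∈ Grad r := by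
  refine ⟨hψ.isFat, hψ.isPrimaryDecomposable, Set.Subset.antisymm ?_ ?_⟩
  · rintro a ⟨T, hT, n, hn, ha⟩
    choose f hf using hψ.lead_mem_Pol hT fun j k hk => hn k hk j
    exact ⟨f, funext fun j => (hf j).trans (ha j).symm⟩
  · rintro _ ⟨f, rfl⟩
    exact hψ.polyVec_mem f

lemma HalfBaker.isBaker (hψ : HalfBaker ψ) : IsBaker (rowSpace ψ) ψ := by
  obtain ⟨θ, hθ, T, hT, hsym, -⟩ := hψ.exists_op
  refine ⟨fun i j => vanishAtInfty_eq ▸ hψ.sub_one_mem_top i j, fun i => ?_⟩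
  exact rowMem_iff.2 ⟨θ, hθ, T i, hT i, fun j => (hsym i j).symm⟩

end

section

/-! ### The bispectral involution -/

section bisp
variable {r : ℕ} {W : Submodule ℂ (Fin r → RatFunc ℂ)}

lemma baker_spec (hW : W ∈ Grad r) : IsBaker W (baker W) :=
  Classical.epsilon_spec (exists_isBaker hW)

/-- A point of the adelic Grassmannian is determined by its stationary Baker function. -/
lemma IsBaker.le {W' : Submodule ℂ (Fin r → RatFunc ℂ)} (hW : W ∈ Grad r)
    {ψ : Matrix (Fin r) (Fin r) Fun2} (h : IsBaker W ψ) (h' : IsBaker W' ψ) : W ≤ W' := by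
  intro w hw
  -- w = D.1, and the symbol of D is Ξ.ψ. As the rows of ψ also belong to W', so does D, and with it
  -- D.1.
  obtain ⟨D, hD, hDw⟩ := exists_op_of_mem hW.2.1 hw
  obtain ⟨Ξ, hΞ⟩ := exists_rowOp_eq hW.2.2 h (sym_mem_rowModule hD)
  have h1 : D ∈ opM W' := mem_opM_of_sym_mem (hΞ ▸ rowOp_mem_rowModule h'.2 Ξ)
  have h2 := mem_opM.1 h1 1
  have h3 : toK 1 = 1 := map_one _
  rw [h3] at h2
  rwa [funext hDw] at h2

lemma isBispectralDual_rowSpace (hW : W ∈ Grad r) :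
    IsBispectralDual W (rowSpace (dualFun (baker W))) :=
  have h := ((baker_spec hW).halfBaker hW).dual
  ⟨h.rowSpace_mem_Grad, h.isBaker⟩

lemma bisp_spec (hW : W ∈ Grad r) : IsBispectralDual W (bisp W) :=
  Classical.epsilon_spec ⟨_, isBispectralDual_rowSpace hW⟩

lemma existsUnique_isBaker (hW : W ∈ Grad r) : ∃! ψ, IsBaker W ψ :=
  ⟨_, baker_spec hW, fun _ h => h.unique hW.2.2 (baker_spec hW)⟩

lemma existsUnique_isBispectralDual (hW : W ∈ Grad r) : ∃! W', IsBispectralDual W W' :=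
  ⟨_, bisp_spec hW, fun _ h => le_antisymm (h.2.le h.1 (bisp_spec hW).2)
    ((bisp_spec hW).2.le (bisp_spec hW).1 h.2)⟩

/-- Transposition and exchange of variables interchange the factor in x with the factor in z; the
two signs introduced by the dual quadruple cancel. -/
lemma CMQuadruple.baker_dual {n : ℕ} (q : CMQuadruple n r) : q.dual.baker = dualFun q.baker := by
  set c := algebraMap ℂ (RatFunc ℂ) with hc
  set L : Matrix (Fin r) (Fin n) (RatFunc ℂ) :=
    q.w.map c * (Matrix.scalar (Fin n) RatFunc.X + q.X.map c)⁻¹ with hL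
  set R : Matrix (Fin n) (Fin r) (RatFunc ℂ) :=
    (Matrix.scalar (Fin n) RatFunc.X - q.Y.map c)⁻¹ * q.v.map c with hR
  have hmap : ∀ {k l : ℕ} (A : Matrix (Fin k) (Fin l) ℂ),
      (-A.transpose).map c = -(A.map c).transpose := fun A => by
    ext i j
    simp
  have hs : (Matrix.scalar (Fin n) (RatFunc.X : RatFunc ℂ)).transpose =
      Matrix.scalar (Fin n) RatFunc.X := by
    simp
  have hL' : q.dual.w.map c * (Matrix.scalar (Fin n) RatFunc.X + q.dual.X.map c)⁻¹ =
      -R.transpose := by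
    rw [hR, Matrix.transpose_mul, Matrix.transpose_nonsing_inv, Matrix.transpose_sub, hs,
      ← Matrix.neg_mul, CMQuadruple.dual, hmap, hmap, sub_eq_add_neg]
  have hR' : (Matrix.scalar (Fin n) RatFunc.X - q.dual.Y.map c)⁻¹ * q.dual.v.map c =
      -L.transpose := by
    rw [hL, Matrix.transpose_mul, Matrix.transpose_nonsing_inv, Matrix.transpose_add, hs,
      ← Matrix.mul_neg, CMQuadruple.dual, hmap, hmap, sub_neg_eq_add]
  have h1 : ∀ i j, q.baker i j = (1 : Matrix (Fin r) (Fin r) Fun2) i j +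
      ∑ k, L i k ⊗ₜ[ℂ] R k j := fun i j => by
    rw [CMQuadruple.baker, Matrix.add_apply, Matrix.mul_apply]
    simp only [Matrix.map_apply, Algebra.TensorProduct.tmul_mul_tmul, mul_one, one_mul]
    rfl
  ext i j
  rw [dualFun_apply, h1, map_add, map_sum, CMQuadruple.baker, Matrix.add_apply,
    Matrix.mul_apply, hL', hR']
  congr 1
  · rw [Matrix.one_apply, Matrix.one_apply]
    rcases eq_or_ne i j with rfl | h
    · rw [if_pos rfl, sw_one]
    · rw [if_neg h, if_neg h.symm, map_zero]
  · refine Finset.sum_congr rfl fun k _ => ?_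
    simp only [Matrix.map_apply, Matrix.neg_apply, Matrix.transpose_apply,
      Algebra.TensorProduct.tmul_mul_tmul, mul_one, one_mul, sw_tmul]
    rw [TensorProduct.tmul_neg, TensorProduct.neg_tmul, neg_neg]

lemma isBaker_bisp_dual_baker (hW : W ∈ Grad r) {n : ℕ} (q : CMQuadruple n r)
    (h : IsBaker W q.baker) : IsBaker (bisp W) q.dual.baker := by
  rw [q.baker_dual, h.unique hW.2.2 (baker_spec hW)]
  exact (bisp_spec hW).2

end bisp

/-! ### Operators between points of the adelic Grassmannian -/

variable {r s : ℕ} {U : Submodule ℂ (Fin r → RatFunc ℂ)} {V : Submodule ℂ (Fin s → RatFunc ℂ)}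
  {ψ : Matrix (Fin r) (Fin r) Fun2} {χ : Matrix (Fin s) (Fin s) Fun2}

lemma leftAct_injective (hχ : ∀ i j, (χ - 1) i j ∈ box ⊤ Pr)
    {Θ Θ' : Matrix (Fin r) (Fin s) DiffOp} (h : leftAct Θ χ = leftAct Θ' χ) : Θ = Θ' := by
  funext i
  refine sub_eq_zero.1 (eq_zero_of_rowOp_mem hχ fun j => ?_)
  rw [rowOp_sub, ← leftAct_apply, ← leftAct_apply, h, sub_self]
  exact zero_mem _

lemma rightAct_dualFun (Θ : Matrix (Fin r) (Fin s) DiffOp) (i : Fin s) (j : Fin r) :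
    rightAct (dualFun χ) Θ.transpose i j = sw (leftAct Θ χ j i) := by
  simp only [rightAct, leftAct, Matrix.of_apply, map_sum, actX_eq, actZ_eq, sw_aX,
    dualFun_apply, Matrix.transpose_apply]

lemma leftAct_dualFun (D : Matrix (Fin r) (Fin s) DiffOp) (i : Fin s) (j : Fin r) :
    leftAct D.transpose (dualFun ψ) i j = sw (rightAct ψ D j i) := by
  simp only [rightAct, leftAct, Matrix.of_apply, map_sum, actX_eq, actZ_eq, sw_aZ,
    dualFun_apply, Matrix.transpose_apply]

/-- Exchange of x and z turns operators in x into operators in z, so the intertwining relation keeps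
its form with D and Θ in swapped roles. -/
lemma rightAct_dualFun_eq {D Θ : Matrix (Fin r) (Fin s) DiffOp}
    (h : rightAct ψ D = leftAct Θ χ) :
    rightAct (dualFun χ) Θ.transpose = leftAct D.transpose (dualFun ψ) := by
  ext i j
  rw [rightAct_dualFun, leftAct_dualFun, h]

/-- Each u in U is T.1 with symbol Ξ.ψ. Applying D gives Ξ.(Θ.χ), which lies in `rowModule V`, so
the product of T and D is in `opM V`; its value at 1 is u ⋆ D. -/
lemma mem_opSpace_of_rightAct (hU : U ∈ Grad r) (hψ : IsBaker U ψ) (hχ : IsBaker V χ)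
    {D Θ : Matrix (Fin r) (Fin s) DiffOp} (h : rightAct ψ D = leftAct Θ χ) : D ∈ opSpace U V := by
  intro u hu
  obtain ⟨T, hT, hTu⟩ := exists_op_of_mem hU.2.1 hu
  obtain ⟨Ξ, hΞ⟩ := exists_rowOp_eq hU.2.2 hψ (sym_mem_rowModule hT)
  have h1 : compRow T D ∈ opM V := by
    refine mem_opM_of_sym_mem ?_
    rw [sym_compRow, ← hΞ, starZ_rowOp, h]
    refine rowOp_mem_rowModule (fun i => ?_) Ξ
    rw [leftAct_apply]
    exact rowOp_mem_rowModule hχ.2 _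
  have h2 := mem_opM.1 h1 1
  have h3 : toK 1 = 1 := map_one _
  rwa [h3, aK_compRow, funext hTu] at h2

lemma exists_leftAct_eq (hV : V ∈ Grad s) (hψ : IsBaker U ψ) (hχ : IsBaker V χ)
    {D : Matrix (Fin r) (Fin s) DiffOp} (hD : D ∈ opSpace U V) :
    ∃ Θ : Matrix (Fin r) (Fin s) DiffOp, rightAct ψ D = leftAct Θ χ := by
  choose Θ hΘ using fun i => exists_rowOp_eq hV.2.2 hχ (starZ_mem_rowModule hD (hψ.2 i))
  refine ⟨Matrix.of Θ, ?_⟩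
  funext i
  rw [rightAct_apply, leftAct_apply, ← hΘ]
  rfl

end

end AdelicGr

end

theorem mainTheorem3 {r s : ℕ}
    (U : Submodule ℂ (Fin r → RatFunc ℂ)) (V : Submodule ℂ (Fin s → RatFunc ℂ))
    (hU : U ∈ AdelicGr.Grad r) (hV : V ∈ AdelicGr.Grad s) :
    -- the stationary Baker functions of `U` and `V` exist and are unique
    (∃! ψ, AdelicGr.IsBaker U ψ) ∧ (∃! ψ, AdelicGr.IsBaker V ψ) ∧
    -- the points `b(U)` and `b(V)` of the adelic Grassmannians exist and are unique
    (∃! U', AdelicGr.IsBispectralDual U U') ∧ (∃! V', AdelicGr.IsBispectralDual V V') ∧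
    -- `b` is induced by the involution on the Calogero-Moser spaces
    (∀ (n : ℕ) (q : AdelicGr.CMQuadruple n r), AdelicGr.IsBaker U q.baker →
      AdelicGr.IsBaker (AdelicGr.bisp U) q.dual.baker) ∧
    (∀ (n : ℕ) (q : AdelicGr.CMQuadruple n s), AdelicGr.IsBaker V q.baker →
      AdelicGr.IsBaker (AdelicGr.bisp V) q.dual.baker) ∧
    -- `F` is the map that sends `D(z)` to `Θ(z)ᵗ`
    ∃ F : Matrix (Fin r) (Fin s) AdelicGr.DiffOp → Matrix (Fin s) (Fin r) AdelicGr.DiffOp,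
      (∀ D ∈ AdelicGr.opSpace U V, ∀ Θ : Matrix (Fin r) (Fin s) AdelicGr.DiffOp,
        AdelicGr.rightAct (AdelicGr.baker U) D = AdelicGr.leftAct Θ (AdelicGr.baker V) ↔
          F D = Θ.transpose) ∧
      Set.BijOn F (AdelicGr.opSpace U V)
        (AdelicGr.opSpace (AdelicGr.bisp V) (AdelicGr.bisp U)) := by
  classical
  have hbU := AdelicGr.bisp_spec hU
  have hbV := AdelicGr.bisp_spec hV
  have hψ := AdelicGr.baker_spec hU
  have hχ := AdelicGr.baker_spec hV
  have hex : ∀ D ∈ AdelicGr.opSpace U V, ∃ Θ : Matrix (Fin r) (Fin s) AdelicGr.DiffOp,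
      AdelicGr.rightAct (AdelicGr.baker U) D = AdelicGr.leftAct Θ (AdelicGr.baker V) :=
    fun D hD => AdelicGr.exists_leftAct_eq hV hψ hχ hD
  choose! G hG using hex
  have hF : ∀ D ∈ AdelicGr.opSpace U V, ∀ Θ : Matrix (Fin r) (Fin s) AdelicGr.DiffOp,
      AdelicGr.rightAct (AdelicGr.baker U) D = AdelicGr.leftAct Θ (AdelicGr.baker V) ↔
        (G D).transpose = Θ.transpose := by
    intro D hD Θ
    rw [Matrix.transpose_inj, hG D hD]
    exact ⟨AdelicGr.leftAct_injective hχ.sub_one_mem, fun h => by rw [h]⟩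
  refine ⟨AdelicGr.existsUnique_isBaker hU, AdelicGr.existsUnique_isBaker hV,
    AdelicGr.existsUnique_isBispectralDual hU, AdelicGr.existsUnique_isBispectralDual hV,
    fun n q => AdelicGr.isBaker_bisp_dual_baker hU q,
    fun n q => AdelicGr.isBaker_bisp_dual_baker hV q,
    fun D => (G D).transpose, hF, fun D hD => ?_, fun D hD D' hD' h => ?_, fun E hE => ?_⟩
  -- The transposed relation shows that Θᵗ maps b(V) into b(U).
  · exact AdelicGr.mem_opSpace_of_rightAct hbV.1 hbV.2 hbU.2
      (AdelicGr.rightAct_dualFun_eq (hG D hD))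
  -- Dᵗ is the left operator attached to Θᵗ in the transposed relation, so it is unique.
  · have h1 := AdelicGr.rightAct_dualFun_eq (hG D hD)
    have h2 := AdelicGr.rightAct_dualFun_eq (hG D' hD')
    have h3 : (G D).transpose = (G D').transpose := h
    rw [h3, h2] at h1
    exact Matrix.transpose_injective (AdelicGr.leftAct_injective hbU.2.sub_one_mem h1).symm
  -- The left operator Ξ attached to E has as its transpose the preimage, because dualizing the two
  -- Baker functions again restores ψ_U and ψ_V.
  · obtain ⟨Ξ, hΞ⟩ := AdelicGr.exists_leftAct_eq hbU.1 hbV.2 hbU.2 hE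
    have h1 := AdelicGr.rightAct_dualFun_eq hΞ
    have h2 : AdelicGr.dualFun ((AdelicGr.baker U).transpose.map AdelicGr.swapXZ) =
        AdelicGr.baker U := AdelicGr.dualFun_dualFun _
    have h3 : AdelicGr.dualFun ((AdelicGr.baker V).transpose.map AdelicGr.swapXZ) =
        AdelicGr.baker V := AdelicGr.dualFun_dualFun _
    rw [h2, h3] at h1
    have hD := AdelicGr.mem_opSpace_of_rightAct hU hψ hχ h1
    exact ⟨_, hD, (hF _ hD _).1 h1⟩
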